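/- **Setting.** There are $K\ge 1$ users and time is slotted. Let $0<\beta<1$ and $r_1,\dots,r_K>0$, and let $X_1,\dots,X_K$ be i.i.d. non-negative random variables with mean $1$. The achievable rates $R_k(n)$ ($k=1,\dots,K$; $n=1,2,\dots$) are independent, and each $R_k(n)$ has the law of $R_k=r_kX_k$. (This is assumption (A1), with positive mean rates.) **Algorithm (JPS-PF).** In slot $n$, given the current throughput vector $\mathbf T=\mathbf T(n-1)\in[0,\infty)^K$, sort the users so that $r_{k_1}/T_{k_1}\ge\dots\ge r_{k_K}/T_{k_K}$. Probe them in this order, learning $R_{k_1}(n),R_{k_2}(n),\dots$, and write $w_j=\max_{i\le j}R_{k_i}(n)/T_{k_i}$. At least one user is probed. After $j\ge1$ probes, probing goes on if and only if $j<K$ and $$(1-j\beta)\,w_j<(1-(j+1)\beta)\,\mathbb E\big[\,w_j\vee (R_{k_{j+1}}/T_{k_{j+1}})\,\big|\,w_j\,\big].$$ If probing stops after $J$ probes, a probed user $k$ with $R_k(n)/T_k=w_J$ is served, so that $B_k(n)=(1-J\beta)R_k(n)$ for this user and $B_l(n)=0$ for all others; then $$\mathbf T(n)=\tfrac{n-1}{n}\,\mathbf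 T(n-1)+\tfrac1n\,\mathbf B(n).$$ A positive number divided by $0$ is $\infty$ here, $0/0=0$ and $0\cdot\infty=0$; a negative factor $1-(j+1)\beta$ may be replaced by $0$. Ties in the sorting are broken by any measurable rule depending on $\mathbf T$, and ties for the best probed user by any measurable rule depending on $\mathbf T$ and the rates of the slot. Let $\mathbf h(\mathbf T)=-\mathbf T+\mathbb E[\mathbf B(n)\mid\mathbf T(n-1)=\mathbf T]$. Since $\mathbf h$ is in general discontinuous where ties occur, the ODE $\dot{\mathbf T}=\mathbf h(\mathbf T)$ in $(0,\infty)^K$ is understood in the usual regularized sense: a solution is a locally absolutely continuous $\mathbf T:[0,\infty)\to(0,\infty)^K$ with $\dot{\mathbf T}(t)\in H(\mathbf T(t))$ for almost every $t$, where $H(\mathbf x)=\bigcap_{\delta>0}\overline{\mathrm{conv}}\,\mathbf h(B(\mathbf x,\delta))$ (so $H(\mathbf x)=\{\mathbf h(\mathbf x)\}$ where $\mathbf h$ is continuous). **Theorem.** There are $\mathbf T^*\in(0,\infty)^K$ and $\kappa$, depending only on $K$, $\beta$, $(r_k)$ and the law of $X_1$, such that for every choice of the tie-breaking rules: 1. $\mathbf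 T^*$ is the limit point of the ODE $\dot{\mathbf T}=\mathbf h(\mathbf T)$ in $(0,\infty)^K$: it is an equilibrium, $\mathbf 0\in H(\mathbf T^*)$, and every solution in $(0,\infty)^K$ converges to $\mathbf T^*$ as $t\to\infty$; 2. for every initial condition, that is, for every $n_0\ge0$ and every $\boldsymbol\tau\in[0,\infty)^K$, the throughput sequence with $\mathbf T(n_0)=\boldsymbol\tau$ that the algorithm produces in slots $n_0+1,n_0+2,\dots$ converges to $\mathbf T^*$ almost surely (the algorithm's own start is $n_0=0$, $\boldsymbol\tau=(1,\dots,1)$). Moreover, the steady-state throughputs are proportional to the mean rates with a common ratio: $$\frac{T_1^*}{r_1}=\frac{T_2^*}{r_2}=\dots=\frac{T_K^*}{r_K}=\kappa .$$ -/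

import Mathlib

open MeasureTheory ProbabilityTheory Filter Topology
open scoped ENNReal

namespace JPSPF

noncomputable section

/-! Conventions.  There are `K` users, probing one user costs the fraction `β` of a slot, `ν` is the
law of the normalized rates `X₁, …, X_K`, and `r k` is the mean rate of user `k`. -/

/-- The law of the achievable rate `r k * X k` of user `k`. -/
def rateLaw {K : ℕ} (ν : Measure ℝ) (r : Fin K → ℝ) (k : Fin K) : Measure ℝ :=
  ν.map (fun x => r k * x)

/-- A rate `ρ` divided by a throughput `τ`, both nonnegative.  The value is an extended nonnegative
number: a positive rate over a zero throughput is `∞`, and `0 / 0 = 0`. -/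
def normalized (ρ τ : ℝ) : ℝ≥0∞ := ENNReal.ofReal ρ / ENNReal.ofReal τ

/-- The largest throughput-normalized rate `w_j` among the first `j` users in the probing order `σ`
(`σ i` is the user in position `i`, positions start at `0`).  It is `0` for `j = 0`. -/
def bestSoFar {K : ℕ} (σ : Equiv.Perm (Fin K)) (T R : Fin K → ℝ) (j : ℕ) : ℝ≥0∞ :=
  ⨆ i : Fin K, ⨆ _ : (i : ℕ) < j, normalized (R (σ i)) (T (σ i))

/-- After `j` probes there is an unprobed user left, and
`(1 - j β) w_j < (1 - (j+1) β) E[w_j ∨ R_{k_{j+1}} / T_{k_{j+1}}]`,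
the expectation being over the rate of the next user, for the observed value of `w_j`. Negative
factors are truncated to `0`; either way the inequality then fails and probing stops. -/
def Continues {K : ℕ} (β : ℝ) (ν : Measure ℝ) (r : Fin K → ℝ) (σ : Equiv.Perm (Fin K))
    (T R : Fin K → ℝ) (j : ℕ) : Prop :=
  ∃ h : j < K,
    ENNReal.ofReal (1 - j * β) * bestSoFar σ T R j <
      ENNReal.ofReal (1 - (j + 1) * β) *
        ∫⁻ ρ, max (bestSoFar σ T R j) (normalized ρ (T (σ ⟨j, h⟩))) ∂(rateLaw ν r (σ ⟨j, h⟩))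

/-- The number of users that are probed: at least one user is probed, and probing goes on while the
condition `Continues` holds.  The set is nonempty, because `Continues` fails for `j ≥ K`. -/
def numProbes {K : ℕ} (β : ℝ) (ν : Measure ℝ) (r : Fin K → ℝ) (σ : Equiv.Perm (Fin K))
    (T R : Fin K → ℝ) : ℕ :=
  sInf {j : ℕ | 1 ≤ j ∧ ¬ Continues β ν r σ T R j}

/-- One-slot decisions of the algorithm, with an arbitrary (measurable) way of breaking ties.
`order T` sorts the users by decreasing throughput-normalized mean rate when the current throughput
vector is `T`; it cannot depend on the rates of the slot.  `pick T R` is a best user among those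
that have been probed when the rates of the slot are `R`. -/
structure Rule {K : ℕ} (β : ℝ) (ν : Measure ℝ) (r : Fin K → ℝ) where
  order : (Fin K → ℝ) → Equiv.Perm (Fin K)
  pick : (Fin K → ℝ) → (Fin K → ℝ) → Fin K
  order_sorted : ∀ T, Antitone fun i => normalized (r (order T i)) (T (order T i))
  pick_probed : ∀ T R, ∃ i : Fin K,
    (i : ℕ) < numProbes β ν r (order T) T R ∧ order T i = pick T R
  pick_best : ∀ T R, normalized (R (pick T R)) (T (pick T R)) =
    bestSoFar (order T) T R (numProbes β ν r (order T) T R)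
  measurable_order : ∀ i, Measurable fun T => order T i
  measurable_pick : Measurable fun p : (Fin K → ℝ) × (Fin K → ℝ) => pick p.1 p.2

namespace Rule

variable {K : ℕ} {β : ℝ} {ν : Measure ℝ} {r : Fin K → ℝ}

/-- The amounts of data `B_k = (1 - J β) R_k I_k` transmitted in a slot that starts with throughput
vector `T` and has rate vector `R`. -/
def transmitted (A : Rule β ν r) (T R : Fin K → ℝ) (k : Fin K) : ℝ :=
  (1 - numProbes β ν r (A.order T) T R * β) * R k * (if A.pick T R = k then 1 else 0)

/-- The throughput vectors, `throughput R n₀ τ n` being that after slot `n`, where slot `n + 1` has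
rate vector `R n`.  The initial condition is `τ`, imposed at time `n₀`, so that for `n ≥ n₀`
`T(n+1) = (n / (n+1)) T(n) + (1 / (n+1)) B(n+1)`. -/
def throughput (A : Rule β ν r) (R : ℕ → Fin K → ℝ) (n₀ : ℕ) (τ : Fin K → ℝ) : ℕ → Fin K → ℝ
  | 0 => τ
  | n + 1 =>
    if n < n₀ then τ
    else fun k => (n : ℝ) / (n + 1) * throughput A R n₀ τ n k +
      1 / ((n : ℝ) + 1) * A.transmitted (throughput A R n₀ τ n) (R n) k

/-- The vector field `h(T) = -T + E[B(n) | T(n-1) = T]`; the rate vector of slot `n` is independent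
of `T(n-1)`, with independent coordinates. -/
def drift (A : Rule β ν r) (T : Fin K → ℝ) (k : Fin K) : ℝ :=
  -T k + ∫ R, A.transmitted T R k ∂(Measure.pi (rateLaw ν r))

end Rule

/-- The values at `x` of the (Krasovskii) convex regularization `⋂_{δ > 0} cl conv h(B(x, δ))` of a
vector field `h`.  It is `{h x}` where `h` is continuous. -/
def regularize {K : ℕ} (h : (Fin K → ℝ) → (Fin K → ℝ)) (x : Fin K → ℝ) : Set (Fin K → ℝ) :=
  ⋂ (δ : ℝ) (_ : 0 < δ), closure (convexHull ℝ (h '' Metric.ball x δ))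

/-- `φ : [0, ∞) → (0, ∞)^K` is a solution of `dφ/dt = h(φ)`, in the sense that applies to a vector
field with discontinuities: `φ` is locally absolutely continuous and its derivative is almost
everywhere in the regularization of `h`. -/
structure IsSolution {K : ℕ} (h : (Fin K → ℝ) → (Fin K → ℝ)) (φ : ℝ → Fin K → ℝ) : Prop where
  pos : ∀ t, 0 ≤ t → ∀ k, 0 < φ t k
  absolutelyContinuous : ∀ b, 0 ≤ b → AbsolutelyContinuousOnInterval φ 0 b
  deriv_mem : ∀ᵐ t ∂(volume.restrict (Set.Ioi (0 : ℝ))),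
    ∃ v ∈ regularize h (φ t), HasDerivAt φ v t

/-- `x` is the limit point of `dφ/dt = h(φ)` in `(0, ∞)^K`: it is an equilibrium, and every solution
in `(0, ∞)^K` converges to it. -/
structure IsLimitPoint {K : ℕ} (h : (Fin K → ℝ) → (Fin K → ℝ)) (x : Fin K → ℝ) : Prop where
  pos : ∀ k, 0 < x k
  equilibrium : 0 ∈ regularize h x
  attracting : ∀ φ, IsSolution h φ → Tendsto φ atTop (𝓝 x)

end

end JPSPF

/-!
Measure throughputs and rates in units of the mean rates: `x k = T k / r k`, and let `p k` be the
mean amount of data transmitted to user `k` in a slot, divided by `r k`.  Let `κ` be `1 / K` times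
the value of the stopping problem in which all users have the same weight (`symmetricValue`).  The
limit is `x k = κ` for all `k`, and the whole proof rests on three properties of the mean service,
collected in `IsProportionalService`:

* `∑ p k ≤ K κ`: no nonanticipating probing rule serves more in total than the optimal one for
  users with equal weights;
* `∑ p k / x k ≥ κ ∑ 1 / x k` for `x > 0`: weighted with the marginal utilities, the algorithm serves
  at least as much as the rule that stops and picks as if all weights were equal;
* some user with the least `x k` has `p k ≥ c` for a constant `c > 0`; this replaces the second
  property at the boundary of the orthant.

The first two need that one-step lookahead stopping is optimal when the users are sorted by
decreasing weight (`integral_stopped_le_lookahead`).  This is the monotone case of optimal stopping: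
the discounted best value is a sum of increments whose conditional expectations, once not positive,
stay so, and the lookahead rule collects exactly the positive ones.  For the second property one
also needs that the rule for equal weights serves earlier positions more, which follows by exchanging
the rates of two positions (`symmetricReward_le_swap`); then Chebyshev's sum inequality compares the
weighted service with the average weight (`symmetricValue_mul_sum_le`).  The third holds because
with positive probability the first rate is so good that probing stops at once
(`measure_stopAtOnce_pos`).

From the first two properties, the convex function `L = ∑ (x k / κ - 1 - log (x k / κ))` satisfies
`dL/dt = ∑ (1 / κ - 1 / x k) (p k - x k) ≤ -L` (`sum_drift_le`).  The inequalities are linear in `p`,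
with coefficients continuous in `x`, hence they survive the convex regularization of the vector
field, and `exp t * L` is nonincreasing along every solution.  That the regularization contains `0`
at the limit point is a separation argument: a functional separating the two would contradict the
second property at a point obtained by moving the marginal utilities slightly.

For the stochastic recursion, the throughputs may come close to the boundary or start there, so `L` is
evaluated at `x + d`; this costs only `O(d)` in the decrease (`exists_sum_shifted_drift_le`).  The
transmitted amount is its mean, plus a centred noise, plus a bias tending to `0`, once the rate of
slot `n + 1` is truncated at `n`; under a finite first moment the truncation matters in finitely
many slots only and makes `∑ noise n / (n + 1)` an `L²`-bounded martingale.  With a convergent noise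
series the convergence is deterministic (`tendsto_of_recursion`).
-/

namespace JPSPF

noncomputable section

/-! ### Lookahead stopping along a fixed probing order -/

/-- The fraction of the slot that is left after `j` probes, truncated at `0`. -/
def discount (β : ℝ) (j : ℕ) : ℝ := max (1 - j * β) 0

lemma discount_nonneg (β : ℝ) (j : ℕ) : 0 ≤ discount β j := le_max_right _ _

lemma discount_le_one {β : ℝ} (hβ : 0 ≤ β) (j : ℕ) : discount β j ≤ 1 :=
  max_le (by have : 0 ≤ (j : ℝ) * β := by positivity
             linarith) zero_le_one

lemma discount_antitone {β : ℝ} (hβ : 0 ≤ β) : Antitone (discount β) := by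
  intro i j hij
  have : (i : ℝ) * β ≤ j * β := by gcongr
  exact max_le_max (by linarith) le_rfl

lemma ofReal_discount (β : ℝ) (j : ℕ) :
    ENNReal.ofReal (discount β j) = ENNReal.ofReal (1 - j * β) := by
  unfold discount
  rcases le_total (1 - j * β) 0 with h | h
  · rw [max_eq_right h, ENNReal.ofReal_zero, ENNReal.ofReal_of_nonpos h]
  · rw [max_eq_left h]

/-- The largest of the first `j` values `y i * X i`, where `i` is a position in the probing order,
`X i` the normalized rate found there and `y i` the weight of the user in that position. -/
def weightedMax {K : ℕ} (y : Fin K → ℝ≥0∞) (X : Fin K → ℝ) (j : ℕ) : ℝ≥0∞ :=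
  ⨆ i : Fin K, ⨆ _ : (i : ℕ) < j, y i * ENNReal.ofReal (X i)

/-- The lookahead condition for probing position `j` (positions start at `0`), for weights `y` in
the positions of the probing order. -/
def LookaheadContinues {K : ℕ} (β : ℝ) (ν : Measure ℝ) (y : Fin K → ℝ≥0∞) (X : Fin K → ℝ)
    (j : ℕ) : Prop :=
  ∃ h : j < K,
    ENNReal.ofReal (discount β j) * weightedMax y X j <
      ENNReal.ofReal (discount β (j + 1)) *
        ∫⁻ x, max (weightedMax y X j) (y ⟨j, h⟩ * ENNReal.ofReal x) ∂ν

/-- The number of probes under the lookahead rule with weights `y`. -/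
def lookaheadStop {K : ℕ} (β : ℝ) (ν : Measure ℝ) (y : Fin K → ℝ≥0∞) (X : Fin K → ℝ) : ℕ :=
  sInf {j : ℕ | 1 ≤ j ∧ ¬ LookaheadContinues β ν y X j}

section Stop

variable {K : ℕ} {β : ℝ} {ν : Measure ℝ} {y : Fin K → ℝ≥0∞} {X : Fin K → ℝ}

lemma not_lookaheadContinues_of_le {j : ℕ} (h : K ≤ j) : ¬ LookaheadContinues β ν y X j :=
  fun ⟨h', _⟩ => by omega

lemma lookaheadStop_mem (hK : 0 < K) :
    1 ≤ lookaheadStop β ν y X ∧ ¬ LookaheadContinues β ν y X (lookaheadStop β ν y X) :=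
  Nat.sInf_mem (s := {j : ℕ | 1 ≤ j ∧ ¬ LookaheadContinues β ν y X j})
    ⟨K, hK, not_lookaheadContinues_of_le le_rfl⟩

lemma one_le_lookaheadStop (hK : 0 < K) : 1 ≤ lookaheadStop β ν y X :=
  (lookaheadStop_mem hK).1

lemma lookaheadStop_le_of_not {j : ℕ} (hj : 1 ≤ j) (h : ¬ LookaheadContinues β ν y X j) :
    lookaheadStop β ν y X ≤ j :=
  Nat.sInf_le ⟨hj, h⟩

lemma lookaheadStop_le (hK : 0 < K) : lookaheadStop β ν y X ≤ K :=
  lookaheadStop_le_of_not hK (not_lookaheadContinues_of_le le_rfl)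

lemma continues_of_lt_lookaheadStop {j : ℕ} (hj : 1 ≤ j) (h : j < lookaheadStop β ν y X) :
    LookaheadContinues β ν y X j := by
  by_contra hc
  exact absurd (lookaheadStop_le_of_not hj hc) (by omega)

lemma lt_lookaheadStop_iff (hK : 0 < K) {j : ℕ} :
    j < lookaheadStop β ν y X ↔ ∀ i, 1 ≤ i → i ≤ j → LookaheadContinues β ν y X i := by
  constructor
  · intro h i hi hij
    exact continues_of_lt_lookaheadStop hi (by omega)
  · intro h
    by_contra hc
    exact (lookaheadStop_mem hK).2 (h _ (lookaheadStop_mem (β := β) (ν := ν) (y := y)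
      (X := X) hK).1 (by omega))

/-- Probing never goes on until the whole slot is used up. -/
lemma discount_lookaheadStop_pos (hK : 0 < K) (hβ1 : β < 1) :
    0 < 1 - (lookaheadStop β ν y X : ℝ) * β := by
  obtain ⟨h1, -⟩ := lookaheadStop_mem (β := β) (ν := ν) (y := y) (X := X) hK
  rcases h1.eq_or_lt with h | h
  · rw [← h]; simpa using hβ1
  · obtain ⟨m, hm⟩ : ∃ m, lookaheadStop β ν y X = m + 1 := ⟨_, (Nat.sub_add_cancel h1).symm⟩
    obtain ⟨_, hlt⟩ := continues_of_lt_lookaheadStop (β := β) (ν := ν) (y := y) (X := X)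
      (j := m) (by omega) (by omega)
    by_contra hc
    rw [hm] at hc
    have : discount β (m + 1) = 0 := max_eq_right (not_lt.1 hc)
    rw [this] at hlt
    simp at hlt

lemma discount_lookaheadStop (hK : 0 < K) (hβ1 : β < 1) :
    discount β (lookaheadStop β ν y X) = 1 - (lookaheadStop β ν y X : ℝ) * β :=
  max_eq_left (discount_lookaheadStop_pos hK hβ1).le

lemma weightedMax_update {j : ℕ} (h : j < K) (x : ℝ) {i : ℕ} (hij : i ≤ j) :
    weightedMax y (Function.update X ⟨j, h⟩ x) i = weightedMax y X i := by
  unfold weightedMax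
  refine iSup_congr fun l => iSup_congr fun hl => ?_
  rw [Function.update_of_ne]
  rintro rfl
  simp at hl
  omega

/-- Whether position `j` is probed does not depend on the rate found there. -/
lemma lt_lookaheadStop_update (hK : 0 < K) {j : ℕ} (h : j < K) (x : ℝ) :
    j < lookaheadStop β ν y (Function.update X ⟨j, h⟩ x) ↔ j < lookaheadStop β ν y X := by
  rw [lt_lookaheadStop_iff hK, lt_lookaheadStop_iff hK]
  refine forall_congr' fun i => forall_congr' fun _ => forall_congr' fun hij => ?_
  unfold LookaheadContinues
  rw [weightedMax_update h x hij]

@[fun_prop]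
lemma measurable_weightedMax (j : ℕ) :
    Measurable fun p : (Fin K → ℝ≥0∞) × (Fin K → ℝ) => weightedMax p.1 p.2 j := by
  unfold weightedMax
  fun_prop

lemma measurableSet_lookaheadContinues [SFinite ν] (j : ℕ) :
    MeasurableSet {p : (Fin K → ℝ≥0∞) × (Fin K → ℝ) | LookaheadContinues β ν p.1 p.2 j} := by
  by_cases h : j < K
  · have : {p : (Fin K → ℝ≥0∞) × (Fin K → ℝ) | LookaheadContinues β ν p.1 p.2 j} =
        {p | ENNReal.ofReal (discount β j) * weightedMax p.1 p.2 j <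
          ENNReal.ofReal (discount β (j + 1)) *
            ∫⁻ x, max (weightedMax p.1 p.2 j) (p.1 ⟨j, h⟩ * ENNReal.ofReal x) ∂ν} := by
      ext p
      exact ⟨fun ⟨_, h'⟩ => h', fun h' => ⟨h, h'⟩⟩
    rw [this]
    refine measurableSet_lt (by fun_prop) (Measurable.const_mul ?_ _)
    refine Measurable.lintegral_prod_right' (f := fun q : ((Fin K → ℝ≥0∞) × (Fin K → ℝ)) × ℝ =>
      max (weightedMax q.1.1 q.1.2 j) (q.1.1 ⟨j, h⟩ * ENNReal.ofReal q.2)) ?_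
    refine Measurable.max ((measurable_weightedMax j).comp measurable_fst) (by fun_prop)
  · convert MeasurableSet.empty
    ext p
    simp [not_lookaheadContinues_of_le (not_lt.1 h)]

lemma measurable_lookaheadStop [SFinite ν] (hK : 0 < K) :
    Measurable fun p : (Fin K → ℝ≥0∞) × (Fin K → ℝ) => lookaheadStop β ν p.1 p.2 := by
  refine measurable_of_Ioi fun j => ?_
  have : (fun p : (Fin K → ℝ≥0∞) × (Fin K → ℝ) => lookaheadStop β ν p.1 p.2) ⁻¹' Set.Ioi j =
      ⋂ i : ℕ, ⋂ _ : 1 ≤ i, ⋂ _ : i ≤ j, {p | LookaheadContinues β ν p.1 p.2 i} := by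
    ext p
    simp [lt_lookaheadStop_iff hK]
  rw [this]
  exact MeasurableSet.iInter fun i => MeasurableSet.iInter fun _ => MeasurableSet.iInter fun _ =>
    measurableSet_lookaheadContinues i

end Stop

/-- The real version of `weightedMax`, for finite weights. -/
def runMax {K : ℕ} (y : Fin K → ℝ) (X : Fin K → ℝ) : ℕ → ℝ
  | 0 => 0
  | j + 1 => if h : j < K then max (runMax y X j) (y ⟨j, h⟩ * X ⟨j, h⟩) else runMax y X j

section RunMax

variable {K : ℕ} {y : Fin K → ℝ} {X : Fin K → ℝ}

lemma runMax_succ {j : ℕ} (h : j < K) :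
    runMax y X (j + 1) = max (runMax y X j) (y ⟨j, h⟩ * X ⟨j, h⟩) := by
  simp [runMax, h]

lemma runMax_mono : Monotone (runMax y X) := by
  refine monotone_nat_of_le_succ fun j => ?_
  by_cases h : j < K
  · rw [runMax_succ h]; exact le_max_left _ _
  · simp [runMax, h]

lemma runMax_nonneg (j : ℕ) : 0 ≤ runMax y X j :=
  runMax_mono (Nat.zero_le j)

lemma le_runMax {i : Fin K} {j : ℕ} (h : (i : ℕ) < j) : y i * X i ≤ runMax y X j :=
  calc y i * X i ≤ runMax y X (i + 1) := by rw [runMax_succ i.2]; exact le_max_right _ _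
    _ ≤ runMax y X j := runMax_mono h

lemma runMax_le {j : ℕ} {a : ℝ} (ha : 0 ≤ a) (h : ∀ i : Fin K, (i : ℕ) < j → y i * X i ≤ a) :
    runMax y X j ≤ a := by
  induction j with
  | zero => exact ha
  | succ j ih =>
    have ih' := ih fun i hi => h i (by omega)
    by_cases hj : j < K
    · rw [runMax_succ hj]
      exact max_le ih' (h _ (by simp))
    · simpa [runMax, hj] using ih'

lemma weightedMax_ofReal (hy : ∀ i, 0 ≤ y i) (j : ℕ) :
    weightedMax (fun i => ENNReal.ofReal (y i)) X j = ENNReal.ofReal (runMax y X j) := by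
  apply le_antisymm
  · refine iSup_le fun i => iSup_le fun hi => ?_
    rw [← ENNReal.ofReal_mul (hy i)]
    exact ENNReal.ofReal_le_ofReal (le_runMax hi)
  · induction j with
    | zero => simp [runMax]
    | succ j ih =>
      have ih' : ENNReal.ofReal (runMax y X j) ≤
          weightedMax (fun i => ENNReal.ofReal (y i)) X (j + 1) :=
        ih.trans (iSup_mono fun i => iSup_mono' fun hi => ⟨by omega, le_rfl⟩)
      by_cases hj : j < K
      · rw [runMax_succ hj, ENNReal.ofReal_max]
        refine max_le ih' ?_
        rw [ENNReal.ofReal_mul (hy _)]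
        exact le_iSup₂_of_le (⟨j, hj⟩ : Fin K) (by simp) le_rfl
      · simpa [runMax, hj] using ih'

lemma runMax_update {j : ℕ} (h : j < K) (x : ℝ) {i : ℕ} (hij : i ≤ j) :
    runMax y (Function.update X ⟨j, h⟩ x) i = runMax y X i := by
  induction i with
  | zero => rfl
  | succ i ih =>
    rw [runMax_succ (by omega), runMax_succ (by omega), ih (by omega), Function.update_of_ne]
    simp
    omega

lemma runMax_le_sum (hX : ∀ i, 0 ≤ X i) (hy : ∀ i, 0 ≤ y i) (j : ℕ) :
    runMax y X j ≤ ∑ i, y i * X i :=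
  runMax_le (Finset.sum_nonneg fun i _ => mul_nonneg (hy i) (hX i)) fun i _ =>
    Finset.single_le_sum (f := fun i => y i * X i) (fun i _ => mul_nonneg (hy i) (hX i))
      (Finset.mem_univ i)

@[fun_prop]
lemma measurable_runMax (y : Fin K → ℝ) (j : ℕ) : Measurable fun X => runMax y X j := by
  induction j with
  | zero => exact measurable_const
  | succ j ih =>
    by_cases h : j < K
    · simp only [runMax, h, dite_true]
      fun_prop
    · simpa [runMax, h] using ih

end RunMax

/-! ### Optimality of lookahead stopping -/

/-- Resampling one coordinate of a product of probability measures does not change the law. -/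
lemma measurePreserving_update {ι : Type*} [Fintype ι] [DecidableEq ι] (ν : Measure ℝ)
    [IsProbabilityMeasure ν] (i : ι) :
    MeasurePreserving (fun p : (ι → ℝ) × ℝ => Function.update p.1 i p.2)
      ((Measure.pi fun _ => ν).prod ν) (Measure.pi fun _ => ν) := by
  have hm : Measurable (fun p : (ι → ℝ) × ℝ => Function.update p.1 i p.2) := by
    refine measurable_pi_iff.2 fun j => ?_
    by_cases h : j = i
    · subst h; simpa using measurable_snd
    · simp only [Function.update_of_ne h]
      exact (measurable_pi_apply j).comp measurable_fst
  refine ⟨hm, (Measure.pi_eq fun s hs => ?_).symm⟩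
  rw [Measure.map_apply hm (MeasurableSet.univ_pi hs)]
  have : (fun p : (ι → ℝ) × ℝ => Function.update p.1 i p.2) ⁻¹' Set.univ.pi s =
      (Set.univ.pi (Function.update s i Set.univ)) ×ˢ s i := by
    ext ⟨X, x⟩
    simp only [Set.mem_preimage, Set.mem_pi, Set.mem_univ, true_imp_iff, Set.mem_prod]
    constructor
    · intro h
      refine ⟨fun j => ?_, by simpa using h i⟩
      by_cases hj : j = i
      · subst hj; simp
      · simpa [Function.update_of_ne hj] using h j
    · rintro ⟨h1, h2⟩ j
      by_cases hj : j = i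
      · subst hj; simpa using h2
      · simpa [Function.update_of_ne hj] using h1 j
  rw [this, Measure.prod_prod, Measure.pi_pi, ← Finset.mul_prod_erase _ _ (Finset.mem_univ i),
    ← Finset.mul_prod_erase Finset.univ (fun j => ν (s j)) (Finset.mem_univ i),
    Function.update_self, measure_univ, one_mul, mul_comm]
  congr 1
  refine Finset.prod_congr rfl fun j hj => ?_
  rw [Function.update_of_ne (Finset.ne_of_mem_erase hj)]

lemma integral_update {ι : Type*} [Fintype ι] [DecidableEq ι] (ν : Measure ℝ)
    [IsProbabilityMeasure ν] (i : ι) {f : (ι → ℝ) → ℝ} (hf : Integrable f (Measure.pi fun _ => ν)) :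
    ∫ X, f X ∂(Measure.pi fun _ => ν) =
      ∫ X, ∫ x, f (Function.update X i x) ∂ν ∂(Measure.pi fun _ => ν) := by
  have h := measurePreserving_update ν i
  have h' : Integrable (fun p : (ι → ℝ) × ℝ => f (Function.update p.1 i p.2))
    ((Measure.pi fun _ => ν).prod ν) := h.integrable_comp_of_integrable hf
  rw [← integral_prod _ h']
  conv_lhs => rw [← h.map_eq]
  exact integral_map h.measurable.aemeasurable (by rw [h.map_eq]; exact hf.1)

section Optimality

variable {K : ℕ} {β : ℝ} {ν : Measure ℝ} [IsProbabilityMeasure ν]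

lemma ae_pi_nonneg (hν : ∀ᵐ x ∂ν, 0 ≤ x) :
    ∀ᵐ X : Fin K → ℝ ∂(Measure.pi fun _ => ν), ∀ i, 0 ≤ X i :=
  ae_all_iff.2 fun i =>
    (measurePreserving_eval (fun _ : Fin K => ν) i).quasiMeasurePreserving.ae hν

lemma integrable_eval_pi (hi : Integrable (fun x : ℝ => x) ν) (i : Fin K) :
    Integrable (fun X : Fin K → ℝ => X i) (Measure.pi fun _ => ν) :=
  (measurePreserving_eval (fun _ : Fin K => ν) i).integrable_comp_of_integrable hi

lemma integrable_runMax (hi : Integrable (fun x : ℝ => x) ν) (y : Fin K → ℝ) (j : ℕ) :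
    Integrable (fun X => runMax y X j) (Measure.pi fun _ => ν) := by
  induction j with
  | zero => simp [runMax]
  | succ j ih =>
    by_cases h : j < K
    · simp only [runMax, h, dite_true]
      exact ih.sup ((integrable_eval_pi hi _).const_mul _)
    · simpa [runMax, h] using ih

lemma integrable_max_const (hi : Integrable (fun x : ℝ => x) ν) (w a : ℝ) :
    Integrable (fun x => max w (a * x)) ν :=
  (integrable_const w).sup (hi.const_mul a)

/-- The conditional expectation of the change of the discounted best value caused by probing
position `j`, given that the best value so far is `w`. -/
def probeGain {K : ℕ} (β : ℝ) (ν : Measure ℝ) (y : Fin K → ℝ) (j : ℕ) (w : ℝ) : ℝ :=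
  if h : j < K then
    discount β (j + 1) * (∫ x, max w (y ⟨j, h⟩ * x) ∂ν) - discount β j * w
  else 0

/-- For finite weights the lookahead rule probes on exactly when the expected gain of one more probe
is positive. -/
lemma lookaheadContinues_iff (hi : Integrable (fun x : ℝ => x) ν)
    {y : Fin K → ℝ} (hy : ∀ i, 0 ≤ y i) (X : Fin K → ℝ) (j : ℕ) :
    LookaheadContinues β ν (fun i => ENNReal.ofReal (y i)) X j ↔
      0 < probeGain β ν y j (runMax y X j) := by
  unfold LookaheadContinues probeGain
  by_cases h : j < K
  · simp only [h, dite_true, exists_true_left]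
    have h1 : ∀ x, max (ENNReal.ofReal (runMax y X j)) (ENNReal.ofReal (y ⟨j, h⟩) * ENNReal.ofReal x)
        = ENNReal.ofReal (max (runMax y X j) (y ⟨j, h⟩ * x)) := fun x => by
      rw [ENNReal.ofReal_max, ENNReal.ofReal_mul (hy _)]
    simp_rw [weightedMax_ofReal hy, h1]
    rw [← ofReal_integral_eq_lintegral_ofReal (integrable_max_const hi _ _)
      (Eventually.of_forall fun x => (runMax_nonneg j).trans (le_max_left _ _)),
      ← ENNReal.ofReal_mul (discount_nonneg _ _), ← ENNReal.ofReal_mul (discount_nonneg _ _),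
      ENNReal.ofReal_lt_ofReal_iff', sub_pos]
    refine ⟨fun h => h.1, fun h => ⟨h, lt_of_le_of_lt ?_ h⟩⟩
    exact mul_nonneg (discount_nonneg _ _) (runMax_nonneg j)
  · simp [h]

/-- The monotone case of optimal stopping: if one more probe pays off at position `j + 1`, it already
paid off at position `j`, where the best value was smaller and the user to be probed better. -/
lemma probeGain_pos_of_succ (hβ : 0 < β) (hν : ∀ᵐ x ∂ν, 0 ≤ x)
    (hi : Integrable (fun x : ℝ => x) ν) {y : Fin K → ℝ} (hy : Antitone y)
    {j : ℕ} {w w' : ℝ} (hw : 0 ≤ w) (hww : w ≤ w') (h : 0 < probeGain β ν y (j + 1) w') :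
    0 < probeGain β ν y j w := by
  unfold probeGain at h ⊢
  by_cases hj : j + 1 < K
  · have hj' : j < K := by omega
    simp only [hj, hj', dite_true] at h ⊢
    have hyle : y ⟨j + 1, hj⟩ ≤ y ⟨j, hj'⟩ := hy (by simp)
    have hle : ∫ x, max w' (y ⟨j + 1, hj⟩ * x) + (w - w') ∂ν ≤ ∫ x, max w (y ⟨j, hj'⟩ * x) ∂ν := by
      refine integral_mono_ae ((integrable_max_const hi _ _).add (integrable_const _))
        (integrable_max_const hi _ _) ?_
      filter_upwards [hν] with x hx
      have h1 : y ⟨j + 1, hj⟩ * x ≤ y ⟨j, hj'⟩ * x := by gcongr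
      rcases le_total w' (y ⟨j + 1, hj⟩ * x) with h2 | h2
      · rw [max_eq_right h2]
        exact le_trans (by linarith) (le_max_right _ _)
      · rw [max_eq_left h2]
        exact le_trans (by linarith) (le_max_left _ _)
    rw [integral_add (integrable_max_const hi _ _) (integrable_const _)] at hle
    simp only [integral_const, probReal_univ, one_smul] at hle
    set M' := ∫ x, max w' (y ⟨j + 1, hj⟩ * x) ∂ν
    set M := ∫ x, max w (y ⟨j, hj'⟩ * x) ∂ν
    have hM' : w' ≤ M' := by
      calc w' = ∫ _, w' ∂ν := by simp
        _ ≤ M' := integral_mono (integrable_const _) (integrable_max_const hi _ _)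
            fun x => le_max_left _ _
    have hpos : 0 < 1 - ((j + 1 + 1 : ℕ) : ℝ) * β := by
      by_contra hc
      have h0 : discount β (j + 1 + 1) = 0 := max_eq_right (not_lt.1 hc)
      rw [h0] at h
      have := mul_nonneg (discount_nonneg β (j + 1)) (hw.trans hww)
      linarith
    have e2 : discount β (j + 1 + 1) = 1 - ((j + 1 + 1 : ℕ) : ℝ) * β := max_eq_left hpos.le
    have e1 : discount β (j + 1) = 1 - ((j + 1 : ℕ) : ℝ) * β :=
      max_eq_left (by push_cast at hpos ⊢; linarith)
    have e0 : discount β j = 1 - (j : ℝ) * β :=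
      max_eq_left (by push_cast at hpos ⊢; linarith)
    rw [e2, e1] at h
    rw [e1, e0]
    push_cast at h hpos ⊢
    have h3 : β * (M' - w') ≤ β * (M - w) :=
      mul_le_mul_of_nonneg_left (by linarith) hβ.le
    have h4 : (1 - ((j : ℝ) + 1 + 1) * β) * (M' - w') ≤ (1 - ((j : ℝ) + 1 + 1) * β) * (M - w) :=
      mul_le_mul_of_nonneg_left (by linarith) hpos.le
    have h5 : 0 ≤ β * (M' - w') := mul_nonneg hβ.le (by linarith)
    have h6 : β * w ≤ β * w' := by gcongr
    nlinarith
  · simp [hj] at h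

/-- With antitone weights, position `j` is probed by the lookahead rule as soon as the lookahead
condition holds at `j`. -/
lemma lt_lookaheadStop_iff_probeGain_pos (hβ : 0 < β) (hν : ∀ᵐ x ∂ν, 0 ≤ x)
    (hi : Integrable (fun x : ℝ => x) ν) {y : Fin K → ℝ} (hy0 : ∀ i, 0 ≤ y i) (hy : Antitone y)
    (hK : 0 < K) (X : Fin K → ℝ) {j : ℕ} (hj : 1 ≤ j) :
    j < lookaheadStop β ν (fun i => ENNReal.ofReal (y i)) X ↔
      0 < probeGain β ν y j (runMax y X j) := by
  rw [lt_lookaheadStop_iff hK]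
  constructor
  · intro h
    exact (lookaheadContinues_iff hi hy0 X j).1 (h j hj le_rfl)
  · intro h
    have key : ∀ m, m ≤ j → 0 < probeGain β ν y (j - m) (runMax y X (j - m)) := by
      intro m
      induction m with
      | zero => intro _; simpa using h
      | succ m ih =>
        intro hm
        have h1 := ih (by omega)
        have e : j - m = (j - (m + 1)) + 1 := by omega
        rw [e] at h1
        exact probeGain_pos_of_succ hβ hν hi hy (runMax_nonneg _) (runMax_mono (by omega)) h1
    intro i _ hij
    rw [lookaheadContinues_iff hi hy0]
    have := key (j - i) (by omega)
    rwa [Nat.sub_sub_self hij] at this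

/-- The discounted best value at a nonanticipating stopping index `N` is in expectation the sum of
the gains `probeGain` of the probes that are made. -/
lemma integral_stopped_eq_sum (hi : Integrable (fun x : ℝ => x) ν) (y : Fin K → ℝ)
    {N : (Fin K → ℝ) → ℕ}
    (hNK : ∀ X, N X ≤ K) (hNm : ∀ j, MeasurableSet {X | j < N X})
    (hNa : ∀ j (h : j < K) X x, j < N (Function.update X ⟨j, h⟩ x) ↔ j < N X) :
    ∫ X, discount β (N X) * runMax y X (N X) ∂(Measure.pi fun _ => ν) =
      ∑ j ∈ Finset.range K,
        ∫ X, (if j < N X then probeGain β ν y j (runMax y X j) else 0)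
          ∂(Measure.pi fun _ => ν) := by
  classical
  have hint : ∀ j, Integrable (fun X => discount β (j + 1) * runMax y X (j + 1) -
      discount β j * runMax y X j) (Measure.pi fun _ : Fin K => ν) := fun j =>
    ((integrable_runMax hi y _).const_mul _).sub ((integrable_runMax hi y _).const_mul _)
  have hind : ∀ j (f : (Fin K → ℝ) → ℝ), (fun X => if j < N X then f X else 0) =
      Set.indicator {X | j < N X} f := by
    intro j f; ext X; simp [Set.indicator_apply]
  have hint' : ∀ j, Integrable (fun X => if j < N X then discount β (j + 1) * runMax y X (j + 1) -
      discount β j * runMax y X j else 0) (Measure.pi fun _ : Fin K => ν) := fun j => by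
    rw [hind]
    exact (hint j).indicator (hNm j)
  have h1 : ∀ X, discount β (N X) * runMax y X (N X) = ∑ j ∈ Finset.range K,
      if j < N X then discount β (j + 1) * runMax y X (j + 1) - discount β j * runMax y X j
        else 0 := by
    intro X
    rw [← Finset.sum_filter]
    have : (Finset.range K).filter (fun j => j < N X) = Finset.range (N X) := by
      ext j; simp; have := hNK X; omega
    rw [this, Finset.sum_range_sub (fun j => discount β j * runMax y X j)]
    simp [runMax]
  simp_rw [h1]
  rw [integral_finsetSum _ fun j _ => hint' j]
  refine Finset.sum_congr rfl fun j hj => ?_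
  have hjK : j < K := Finset.mem_range.1 hj
  rw [integral_update ν ⟨j, hjK⟩ (hint' j)]
  refine integral_congr_ae (Eventually.of_forall fun X => ?_)
  simp only [hNa j hjK, runMax_succ hjK, runMax_update hjK _ le_rfl, Function.update_self]
  split_ifs with h
  · rw [integral_sub ((integrable_max_const hi _ _).const_mul _) (integrable_const _),
      integral_const_mul]
    simp [probeGain, hjK]
  · simp

lemma integrable_probeGain (hi : Integrable (fun x : ℝ => x) ν) (y : Fin K → ℝ) (j : ℕ) :
    Integrable (fun X => probeGain β ν y j (runMax y X j)) (Measure.pi fun _ : Fin K => ν) := by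
  by_cases h : j < K
  · simp only [probeGain, h, dite_true]
    refine Integrable.sub (Integrable.const_mul ?_ _) ((integrable_runMax hi y _).const_mul _)
    have h2 := ((measurePreserving_update ν ⟨j, h⟩).integrable_comp_of_integrable
      (integrable_runMax hi y (j + 1))).integral_prod_left
    refine h2.congr (Eventually.of_forall fun X => ?_)
    simp [runMax_succ h, runMax_update h]
  · simp [probeGain, h]

/-- Among all nonanticipating rules that probe at least one user in the given order, the lookahead
rule maximizes the expected discounted best value: it collects exactly the positive gains. -/
theorem integral_stopped_le_lookahead (hβ : 0 < β) (hν : ∀ᵐ x ∂ν, 0 ≤ x)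
    (hi : Integrable (fun x : ℝ => x) ν) {y : Fin K → ℝ} (hy0 : ∀ i, 0 ≤ y i) (hy : Antitone y)
    (hK : 0 < K) {N : (Fin K → ℝ) → ℕ} (hN1 : ∀ X, 1 ≤ N X)
    (hNK : ∀ X, N X ≤ K) (hNm : ∀ j, MeasurableSet {X | j < N X})
    (hNa : ∀ j (h : j < K) X x, j < N (Function.update X ⟨j, h⟩ x) ↔ j < N X) :
    ∫ X, discount β (N X) * runMax y X (N X) ∂(Measure.pi fun _ => ν) ≤
      ∫ X, discount β (lookaheadStop β ν (fun i => ENNReal.ofReal (y i)) X) *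
        runMax y X (lookaheadStop β ν (fun i => ENNReal.ofReal (y i)) X)
          ∂(Measure.pi fun _ => ν) := by
  classical
  set J : (Fin K → ℝ) → ℕ := lookaheadStop β ν (fun i => ENNReal.ofReal (y i)) with hJ
  have hJm : ∀ j, MeasurableSet {X | j < J X} := fun j =>
    ((measurable_lookaheadStop (β := β) (ν := ν) hK).comp
      (measurable_const.prodMk measurable_id)) measurableSet_Ioi
  rw [integral_stopped_eq_sum hi y hNK hNm hNa,
    integral_stopped_eq_sum hi y (N := J) (fun X => lookaheadStop_le hK) hJm
      (fun j h X x => lt_lookaheadStop_update hK h x)]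
  have hind : ∀ (N : (Fin K → ℝ) → ℕ) j (f : (Fin K → ℝ) → ℝ),
      (fun X => if j < N X then f X else 0) = Set.indicator {X | j < N X} f := by
    intro N j f; ext X; simp [Set.indicator_apply]
  refine Finset.sum_le_sum fun j _ => ?_
  refine integral_mono ?_ ?_ fun X => ?_
  · rw [hind]; exact (integrable_probeGain hi y j).indicator (hNm j)
  · rw [hind]; exact (integrable_probeGain hi y j).indicator (hJm j)
  · simp only
    rcases Nat.eq_zero_or_pos j with rfl | hj
    · rw [if_pos (show 0 < N X from hN1 X), if_pos (show 0 < J X from one_le_lookaheadStop hK)]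
    · by_cases hc : 0 < probeGain β ν y j (runMax y X j)
      · rw [if_pos ((lt_lookaheadStop_iff_probeGain_pos hβ hν hi hy0 hy hK X hj).2 hc)]
        split_ifs
        · exact le_rfl
        · exact hc.le
      · rw [if_neg fun h => hc ((lt_lookaheadStop_iff_probeGain_pos hβ hν hi hy0 hy hK X hj).1 h)]
        split_ifs
        · exact not_lt.1 hc
        · exact le_rfl

end Optimality

/-! ### The symmetric problem and its comparison with unequal weights -/

/-- Reindexing the coordinates of a product measure. -/
lemma measurePreserving_reindex {ι : Type*} [Fintype ι] (μ : ι → Measure ℝ)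
    [∀ i, IsProbabilityMeasure (μ i)] (σ : Equiv.Perm ι) :
    MeasurePreserving (fun (R : ι → ℝ) i => R (σ i)) (Measure.pi μ)
      (Measure.pi fun i => μ (σ i)) := by
  have hm : Measurable (fun (R : ι → ℝ) i => R (σ i)) := by fun_prop
  refine ⟨hm, (Measure.pi_eq fun s hs => ?_).symm⟩
  rw [Measure.map_apply hm (MeasurableSet.univ_pi hs)]
  have : (fun (R : ι → ℝ) i => R (σ i)) ⁻¹' Set.univ.pi s =
      Set.univ.pi fun k => s (σ.symm k) := by
    ext R
    simp only [Set.mem_preimage, Set.mem_pi, Set.mem_univ, true_imp_iff]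
    exact ⟨fun h k => by simpa using h (σ.symm k), fun h i => by simpa using h (σ i)⟩
  rw [this, Measure.pi_pi, ← Equiv.prod_comp σ]
  simp

/-- The maximal expected discounted value `E[(1 - J β) max_{i ≤ J} X_i]` when all users have the
same weight. -/
def symmetricValue (K : ℕ) (β : ℝ) (ν : Measure ℝ) : ℝ :=
  ∫ X : Fin K → ℝ, discount β (lookaheadStop β ν (fun _ => 1) X) *
    runMax (fun _ => 1) X (lookaheadStop β ν (fun _ => 1) X) ∂(Measure.pi fun _ => ν)

/-- Position `i` is the first one with the best rate among the first `n` positions. -/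
def IsFirstBest {K : ℕ} (X : Fin K → ℝ) (n : ℕ) (i : Fin K) : Prop :=
  (i : ℕ) < n ∧ (∀ l, l < i → X l < X i) ∧ ∀ l : Fin K, (l : ℕ) < n → X l ≤ X i

open Classical in
/-- The contribution of position `i` to `symmetricValue`, ties for the best rate being broken in
favour of the earliest position. -/
def symmetricReward {K : ℕ} (β : ℝ) (ν : Measure ℝ) (i : Fin K) (X : Fin K → ℝ) : ℝ :=
  if IsFirstBest X (lookaheadStop β ν (fun _ => 1) X) i then
    discount β (lookaheadStop β ν (fun _ => 1) X) * X i else 0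

section Symmetric

variable {K : ℕ} {β : ℝ} {ν : Measure ℝ}

lemma exists_isFirstBest (X : Fin K → ℝ) {n : ℕ} (hn : 1 ≤ n) (hK : 0 < K) :
    ∃ i, IsFirstBest X n i := by
  classical
  have hne : (Finset.univ.filter fun l : Fin K => (l : ℕ) < n).Nonempty :=
    ⟨⟨0, hK⟩, Finset.mem_filter.2 ⟨Finset.mem_univ _, hn⟩⟩
  obtain ⟨b, hb, hmax⟩ := Finset.exists_max_image _ X hne
  have hne' : (Finset.univ.filter fun l : Fin K => (l : ℕ) < n ∧ X l = X b).Nonempty :=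
    ⟨b, by simpa using hb⟩
  obtain ⟨i, hi, hmin⟩ := Finset.exists_min_image _ id hne'
  simp only [Finset.mem_filter, Finset.mem_univ, true_and, id] at hi hmin hmax
  refine ⟨i, hi.1, fun l hl => ?_, fun l hl => hi.2 ▸ hmax l hl⟩
  have hl' : (l : ℕ) < n := lt_trans (Fin.lt_def.1 hl) hi.1
  refine lt_of_le_of_ne (hi.2 ▸ hmax l hl') fun he => ?_
  exact absurd (hmin l ⟨hl', he.trans hi.2⟩) (not_le.2 hl)

lemma IsFirstBest.unique {X : Fin K → ℝ} {n : ℕ} {i j : Fin K} (hi : IsFirstBest X n i)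
    (hj : IsFirstBest X n j) : i = j := by
  rcases lt_trichotomy i j with h | h | h
  · exact absurd (hj.2.1 i h) (not_lt.2 (hi.2.2 j hj.1))
  · exact h
  · exact absurd (hi.2.1 j h) (not_lt.2 (hj.2.2 i hi.1))

lemma sum_symmetricReward (hK : 0 < K) (a X : Fin K → ℝ) :
    ∃ i : Fin K, IsFirstBest X (lookaheadStop β ν (fun _ => 1) X) i ∧
      ∑ l, a l * symmetricReward β ν l X =
        discount β (lookaheadStop β ν (fun _ => 1) X) * (a i * X i) := by
  obtain ⟨i, hi⟩ := exists_isFirstBest X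
    (one_le_lookaheadStop (β := β) (ν := ν) (y := fun _ => 1) (X := X) hK) hK
  refine ⟨i, hi, ?_⟩
  rw [Finset.sum_eq_single i]
  · rw [symmetricReward, if_pos hi]; ring
  · intro l _ hl
    rw [symmetricReward, if_neg fun h => hl (h.unique hi), mul_zero]
  · simp

lemma sum_symmetricReward_le (hK : 0 < K) (a X : Fin K → ℝ) :
    ∑ l, a l * symmetricReward β ν l X ≤ discount β (lookaheadStop β ν (fun _ => 1) X) *
      runMax a X (lookaheadStop β ν (fun _ => 1) X) := by
  obtain ⟨i, hi, h⟩ := sum_symmetricReward (β := β) (ν := ν) hK a X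
  rw [h]
  exact mul_le_mul_of_nonneg_left (le_runMax hi.1) (discount_nonneg _ _)

lemma sum_symmetricReward_eq (hK : 0 < K) {X : Fin K → ℝ} (hX : ∀ i, 0 ≤ X i) :
    ∑ l, symmetricReward β ν l X = discount β (lookaheadStop β ν (fun _ => 1) X) *
      runMax (fun _ => 1) X (lookaheadStop β ν (fun _ => 1) X) := by
  obtain ⟨i, hi, h⟩ := sum_symmetricReward (β := β) (ν := ν) hK (fun _ => 1) X
  simp only [one_mul] at h
  rw [h]
  congr 1
  refine le_antisymm (by simpa using le_runMax (y := fun _ => (1 : ℝ)) (X := X) hi.1) ?_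
  exact runMax_le (hX i) fun l hl => by simpa using hi.2.2 l hl

lemma weightedMax_comp_swap (X : Fin K → ℝ) {i l : Fin K} {m : ℕ}
    (h : m ≤ i ∧ m ≤ l ∨ (i : ℕ) < m ∧ (l : ℕ) < m) :
    weightedMax (fun _ => 1) (fun a => X (Equiv.swap i l a)) m = weightedMax (fun _ => 1) X m := by
  unfold weightedMax
  refine Equiv.iSup_congr (Equiv.swap i l) fun a => ?_
  refine iSup_congr_Prop ?_ fun _ => rfl
  rcases eq_or_ne a i with rfl | ha
  · rw [Equiv.swap_apply_left]; omega
  rcases eq_or_ne a l with rfl | hb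
  · rw [Equiv.swap_apply_right]; omega
  rw [Equiv.swap_apply_of_ne_of_ne ha hb]

lemma lookaheadContinues_congr {y : Fin K → ℝ≥0∞} {X X' : Fin K → ℝ} {j : ℕ}
    (h : weightedMax y X j = weightedMax y X' j) :
    LookaheadContinues β ν y X j ↔ LookaheadContinues β ν y X' j := by
  unfold LookaheadContinues; rw [h]

/-- If a later position `l` carries the best rate, then after exchanging the rates of positions `i`
and `l` the earlier position `i` carries it, and probing does not take longer. -/
lemma symmetricReward_le_swap (hβ : 0 ≤ β) (hK : 0 < K) {X : Fin K → ℝ} (hX : ∀ i, 0 ≤ X i)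
    {i l : Fin K} (hil : i < l) :
    symmetricReward β ν l X ≤ symmetricReward β ν i fun a => X (Equiv.swap i l a) := by
  have h0 : ∀ (X : Fin K → ℝ) (i : Fin K), 0 ≤ X i → 0 ≤ symmetricReward β ν i X := by
    intro X i h
    unfold symmetricReward
    split_ifs
    · exact mul_nonneg (discount_nonneg _ _) h
    · exact le_rfl
  by_cases hE : IsFirstBest X (lookaheadStop β ν (fun _ => 1) X) l
  · set X' : Fin K → ℝ := fun a => X (Equiv.swap i l a) with hX'
    have hil' : (i : ℕ) < l := hil
    have hi' : X' i = X l := by simp [hX']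
    have hle : lookaheadStop β ν (fun _ => 1) X' ≤ lookaheadStop β ν (fun _ => 1) X := by
      refine lookaheadStop_le_of_not (one_le_lookaheadStop hK) ?_
      rw [lookaheadContinues_congr (weightedMax_comp_swap X (Or.inr ⟨by have := hE.1; omega, hE.1⟩))]
      exact (lookaheadStop_mem hK).2
    have hlt : (i : ℕ) < lookaheadStop β ν (fun _ => 1) X' := by
      rw [lt_lookaheadStop_iff hK]
      intro m hm hmi
      rw [lookaheadContinues_congr (weightedMax_comp_swap X (Or.inl ⟨hmi, by omega⟩))]
      exact continues_of_lt_lookaheadStop hm (by have := hE.1; omega)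
    have hE' : IsFirstBest X' (lookaheadStop β ν (fun _ => 1) X') i := by
      refine ⟨hlt, fun a ha => ?_, fun a ha => ?_⟩
      · have : X' a = X a := by
          simp only [hX']
          rw [Equiv.swap_apply_of_ne_of_ne ha.ne (ha.trans hil).ne]
        rw [this, hi']
        exact hE.2.1 a (ha.trans hil)
      · rw [hi']
        simp only [hX']
        rcases eq_or_ne a i with rfl | h1
        · simp
        rcases eq_or_ne a l with rfl | h2
        · rw [Equiv.swap_apply_right]
          exact hE.2.2 i (by have := hE.1; omega)
        rw [Equiv.swap_apply_of_ne_of_ne h1 h2]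
        exact hE.2.2 a (by omega)
    rw [symmetricReward, if_pos hE, symmetricReward, if_pos hE', hi']
    exact mul_le_mul_of_nonneg_right (discount_antitone hβ hle) (hX l)
  · rw [symmetricReward, if_neg hE]
    exact h0 _ _ (hX _)

variable [IsProbabilityMeasure ν]

lemma measurable_lookaheadStop_right (hK : 0 < K) (y : Fin K → ℝ≥0∞) :
    Measurable fun X : Fin K → ℝ => lookaheadStop β ν y X :=
  Measurable.comp (f := fun X : Fin K → ℝ => (y, X)) (measurable_lookaheadStop hK)
    (by fun_prop)

lemma measurable_symmetricReward (hK : 0 < K) (i : Fin K) :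
    Measurable (symmetricReward β ν i) := by
  have hs := measurable_lookaheadStop_right (β := β) (ν := ν) hK fun _ : Fin K => 1
  unfold symmetricReward
  refine Measurable.ite ?_ (Measurable.mul ?_ (measurable_pi_apply i)) measurable_const
  · unfold IsFirstBest
    refine MeasurableSet.inter (hs measurableSet_Ioi) (MeasurableSet.inter ?_ ?_)
    · have : {X : Fin K → ℝ | ∀ l < i, X l < X i} = ⋂ l, ⋂ _ : l < i, {X | X l < X i} := by
        ext; simp
      change MeasurableSet {X : Fin K → ℝ | ∀ l < i, X l < X i}
      rw [this]
      exact MeasurableSet.iInter fun l => MeasurableSet.iInter fun _ =>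
        measurableSet_lt (measurable_pi_apply l) (measurable_pi_apply i)
    · have : {X : Fin K → ℝ | ∀ l : Fin K, (l : ℕ) < lookaheadStop β ν (fun _ => 1) X → X l ≤ X i} =
          ⋂ l : Fin K, ({X | (l : ℕ) < lookaheadStop β ν (fun _ => 1) X}ᶜ ∪ {X | X l ≤ X i}) := by
        ext X
        simp only [Set.mem_ofPred_eq, Set.mem_iInter, Set.mem_union, Set.mem_compl_iff]
        exact forall_congr' fun l => imp_iff_not_or
      change MeasurableSet
        {X : Fin K → ℝ | ∀ l : Fin K, (l : ℕ) < lookaheadStop β ν (fun _ => 1) X → X l ≤ X i}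
      rw [this]
      exact MeasurableSet.iInter fun l => (hs measurableSet_Ioi).compl.union
        (measurableSet_le (measurable_pi_apply l) (measurable_pi_apply i))
  · exact (measurable_from_nat (f := discount β)).comp hs

lemma integrable_symmetricReward (hβ : 0 ≤ β) (hK : 0 < K) (hi : Integrable (fun x : ℝ => x) ν)
    (i : Fin K) : Integrable (symmetricReward β ν i) (Measure.pi fun _ => ν) := by
  refine (integrable_eval_pi hi i).mono (measurable_symmetricReward hK i).aestronglyMeasurable
    (Eventually.of_forall fun X => ?_)
  unfold symmetricReward
  split_ifs
  · rw [norm_mul, Real.norm_of_nonneg (discount_nonneg _ _)]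
    exact mul_le_of_le_one_left (norm_nonneg _) (discount_le_one hβ _)
  · simp

/-- In the symmetric problem, earlier positions are served more. -/
lemma antitone_integral_symmetricReward (hβ : 0 ≤ β) (hK : 0 < K)
    (hν : ∀ᵐ x ∂ν, 0 ≤ x) (hi : Integrable (fun x : ℝ => x) ν) :
    Antitone fun i : Fin K => ∫ X, symmetricReward β ν i X ∂(Measure.pi fun _ => ν) := by
  intro i l hil
  rcases hil.eq_or_lt with rfl | h
  · exact le_rfl
  have hs := measurePreserving_reindex (fun _ : Fin K => ν) (Equiv.swap i l)
  calc ∫ X, symmetricReward β ν l X ∂(Measure.pi fun _ => ν)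
      ≤ ∫ X, symmetricReward β ν i (fun a => X (Equiv.swap i l a)) ∂(Measure.pi fun _ => ν) := by
        refine integral_mono_ae (integrable_symmetricReward hβ hK hi l)
          (hs.integrable_comp_of_integrable (integrable_symmetricReward hβ hK hi i)) ?_
        filter_upwards [ae_pi_nonneg hν] with X hX
        exact symmetricReward_le_swap hβ hK hX h
    _ = ∫ X, symmetricReward β ν i X ∂(Measure.pi fun _ => ν) := by
        conv_rhs => rw [← hs.map_eq]
        exact (integral_map hs.measurable.aemeasurable
          (measurable_symmetricReward hK i).aestronglyMeasurable).symm

lemma sum_integral_symmetricReward (hβ : 0 ≤ β) (hK : 0 < K) (hν : ∀ᵐ x ∂ν, 0 ≤ x)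
    (hi : Integrable (fun x : ℝ => x) ν) :
    ∑ i : Fin K, ∫ X, symmetricReward β ν i X ∂(Measure.pi fun _ => ν) = symmetricValue K β ν := by
  rw [← integral_finsetSum _ fun i _ => integrable_symmetricReward hβ hK hi i]
  refine integral_congr_ae ?_
  filter_upwards [ae_pi_nonneg hν] with X hX
  exact sum_symmetricReward_eq hK hX

lemma integrable_stopped (hβ : 0 ≤ β) (hν : ∀ᵐ x ∂ν, 0 ≤ x) (hi : Integrable (fun x : ℝ => x) ν)
    {y : Fin K → ℝ} (hy : ∀ i, 0 ≤ y i) {N : (Fin K → ℝ) → ℕ} (hN : Measurable N) :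
    Integrable (fun X => discount β (N X) * runMax y X (N X)) (Measure.pi fun _ => ν) := by
  have hm : Measurable fun X => discount β (N X) * runMax y X (N X) := by
    refine ((measurable_from_nat (f := discount β)).comp hN).mul ?_
    exact (measurable_from_prod_countable_right
      (f := fun p : ℕ × (Fin K → ℝ) => runMax y p.2 p.1) fun n => measurable_runMax y n).comp
      (hN.prodMk measurable_id)
  refine Integrable.mono' (g := fun X : Fin K → ℝ => ∑ i, y i * X i)
    (integrable_finsetSum _ fun i _ => (integrable_eval_pi hi i).const_mul _)
    hm.aestronglyMeasurable ?_
  filter_upwards [ae_pi_nonneg hν] with X hX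
  rw [Real.norm_of_nonneg (mul_nonneg (discount_nonneg _ _) (runMax_nonneg _))]
  exact (mul_le_of_le_one_left (runMax_nonneg _) (discount_le_one hβ _)).trans
    (runMax_le_sum hX hy _)

/-- No nonanticipating rule beats the lookahead rule in the symmetric problem. -/
lemma integral_stopped_le_symmetricValue (hβ : 0 < β) (hν : ∀ᵐ x ∂ν, 0 ≤ x)
    (hi : Integrable (fun x : ℝ => x) ν) (hK : 0 < K) {N : (Fin K → ℝ) → ℕ} (hN1 : ∀ X, 1 ≤ N X)
    (hNK : ∀ X, N X ≤ K) (hNm : ∀ j, MeasurableSet {X | j < N X})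
    (hNa : ∀ j (h : j < K) X x, j < N (Function.update X ⟨j, h⟩ x) ↔ j < N X) :
    ∫ X, discount β (N X) * runMax (fun _ => 1) X (N X) ∂(Measure.pi fun _ => ν) ≤
      symmetricValue K β ν := by
  have := integral_stopped_le_lookahead hβ hν hi (y := fun _ : Fin K => (1 : ℝ))
    (fun _ => zero_le_one) antitone_const hK hN1 hNK hNm hNa
  simp only [ENNReal.ofReal_one] at this
  exact this

/-- With antitone weights the lookahead rule earns at least the average weight times the value of
the symmetric problem.  The comparison rule stops and picks as if the weights were equal; it serves
earlier positions more, so Chebyshev's sum inequality applies. -/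
lemma symmetricValue_mul_sum_le (hβ : 0 < β) (hν : ∀ᵐ x ∂ν, 0 ≤ x)
    (hi : Integrable (fun x : ℝ => x) ν) (hK : 0 < K) {y : Fin K → ℝ} (hy0 : ∀ i, 0 ≤ y i)
    (hy : Antitone y) :
    symmetricValue K β ν / K * ∑ i, y i ≤
      ∫ X, discount β (lookaheadStop β ν (fun i => ENNReal.ofReal (y i)) X) *
        runMax y X (lookaheadStop β ν (fun i => ENNReal.ofReal (y i)) X)
          ∂(Measure.pi fun _ => ν) := by
  have hKr : (0 : ℝ) < K := by exact_mod_cast hK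
  have hm := measurable_lookaheadStop_right (β := β) (ν := ν) hK (fun _ : Fin K => (1 : ℝ≥0∞))
  have hopt := integral_stopped_le_lookahead hβ hν hi hy0 hy hK
    (N := lookaheadStop β ν fun _ => 1) (fun _ => one_le_lookaheadStop hK)
    (fun _ => lookaheadStop_le hK) (fun j => hm measurableSet_Ioi)
    (fun j h X x => lt_lookaheadStop_update hK h x)
  refine le_trans ?_ hopt
  have hcheb := ((hy.monovary (antitone_integral_symmetricReward (K := K) hβ.le hK hν hi))
    ).sum_mul_sum_le_card_mul_sum
  rw [sum_integral_symmetricReward hβ.le hK hν hi, Fintype.card_fin] at hcheb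
  calc symmetricValue K β ν / K * ∑ i, y i
      ≤ ∑ i, y i * ∫ X, symmetricReward β ν i X ∂(Measure.pi fun _ => ν) := by
        rw [div_mul_eq_mul_div, div_le_iff₀ hKr]
        linarith
    _ = ∫ X, ∑ i, y i * symmetricReward β ν i X ∂(Measure.pi fun _ => ν) := by
        rw [integral_finsetSum _ fun i _ => (integrable_symmetricReward hβ.le hK hi i).const_mul _]
        simp_rw [integral_const_mul]
    _ ≤ _ := by
        refine integral_mono
          (integrable_finsetSum _ fun i _ => (integrable_symmetricReward hβ.le hK hi i).const_mul _)
          (integrable_stopped hβ.le hν hi hy0 hm) fun X => sum_symmetricReward_le hK y X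

lemma symmetricValue_pos (hβ : 0 < β) (hβ1 : β < 1) (hν : ∀ᵐ x ∂ν, 0 ≤ x)
    (hi : Integrable (fun x : ℝ => x) ν) (h1 : ∫ x, x ∂ν = 1) (hK : 0 < K) :
    0 < symmetricValue K β ν := by
  have := integral_stopped_le_symmetricValue hβ hν hi hK (N := fun _ => 1) (fun _ => le_rfl)
    (fun _ => hK) (fun j => by simp) (fun j h X x => Iff.rfl)
  refine lt_of_lt_of_le ?_ this
  rw [integral_const_mul]
  have e : discount β 1 = 1 - β := by
    unfold discount; rw [max_eq_left] <;> push_cast <;> linarith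
  have h2 : ∫ X : Fin K → ℝ, runMax (fun _ => 1) X 1 ∂(Measure.pi fun _ => ν) = 1 := by
    have h3 := (measurePreserving_eval (fun _ : Fin K => ν) ⟨0, hK⟩)
    have h4 : ∫ X : Fin K → ℝ, X ⟨0, hK⟩ ∂(Measure.pi fun _ => ν) = 1 := by
      rw [← h1]
      conv_rhs => rw [← h3.map_eq]
      exact (integral_map h3.measurable.aemeasurable measurable_id.aestronglyMeasurable).symm
    refine Eq.trans ?_ h4
    refine integral_congr_ae ?_
    filter_upwards [ae_pi_nonneg hν] with X hX
    rw [runMax_succ hK]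
    simpa [runMax] using hX ⟨0, hK⟩
  rw [e, h2]
  linarith

end Symmetric

/-! ### Rates at which probing stops at once -/

/-- The rates `x > 0` of the first probed user at which the lookahead rule would stop if the next
user had the same weight. -/
def stopAtOnce (β : ℝ) (ν : Measure ℝ) : Set ℝ :=
  {x | 0 < x ∧ ENNReal.ofReal (discount β 2) * ∫⁻ x', max (ENNReal.ofReal x) (ENNReal.ofReal x') ∂ν ≤
    ENNReal.ofReal (discount β 1) * ENNReal.ofReal x}

section StopAtOnce

variable {K : ℕ} {β : ℝ} {ν : Measure ℝ}

lemma measurableSet_stopAtOnce [SFinite ν] : MeasurableSet (stopAtOnce β ν) := by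
  refine MeasurableSet.inter measurableSet_Ioi (measurableSet_le (Measurable.const_mul ?_ _)
    (measurable_const.mul ENNReal.measurable_ofReal))
  exact Measurable.lintegral_prod_right' (f := fun q : ℝ × ℝ =>
    max (ENNReal.ofReal q.1) (ENNReal.ofReal q.2)) (by fun_prop)

/-- This includes infinite weights, that is, users with throughput zero. -/
lemma lookaheadStop_eq_one (hK : 0 < K) {y : Fin K → ℝ≥0∞} (hy : Antitone y) {X : Fin K → ℝ}
    (hX : X ⟨0, hK⟩ ∈ stopAtOnce β ν) : lookaheadStop β ν y X = 1 := by
  refine le_antisymm (lookaheadStop_le_of_not le_rfl ?_) (one_le_lookaheadStop hK)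
  rintro ⟨h1, hlt⟩
  have hw : weightedMax y X 1 = y ⟨0, hK⟩ * ENNReal.ofReal (X ⟨0, hK⟩) := by
    unfold weightedMax
    apply le_antisymm
    · refine iSup_le fun i => iSup_le fun hi => ?_
      have : i = ⟨0, hK⟩ := Fin.ext (by simpa using hi)
      rw [this]
    · exact le_iSup₂_of_le (⟨0, hK⟩ : Fin K) (by simp) le_rfl
  rw [hw] at hlt
  refine absurd hlt (not_lt.2 ?_)
  have hyle : y ⟨1, h1⟩ ≤ y ⟨0, hK⟩ := hy (by simp)
  calc ENNReal.ofReal (discount β (1 + 1)) * ∫⁻ x, max (y ⟨0, hK⟩ * ENNReal.ofReal (X ⟨0, hK⟩))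
        (y ⟨1, h1⟩ * ENNReal.ofReal x) ∂ν
      ≤ ENNReal.ofReal (discount β 2) *
        ∫⁻ x, y ⟨0, hK⟩ * max (ENNReal.ofReal (X ⟨0, hK⟩)) (ENNReal.ofReal x) ∂ν := by
        gcongr with x
        exact max_le (by gcongr; exact le_max_left _ _) (by gcongr; exact le_max_right _ _)
    _ = y ⟨0, hK⟩ * (ENNReal.ofReal (discount β 2) *
        ∫⁻ x, max (ENNReal.ofReal (X ⟨0, hK⟩)) (ENNReal.ofReal x) ∂ν) := by
        rw [lintegral_const_mul _ (by fun_prop)]; ring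
    _ ≤ y ⟨0, hK⟩ * (ENNReal.ofReal (discount β 1) * ENNReal.ofReal (X ⟨0, hK⟩)) := by
        exact mul_le_mul_right hX.2 _
    _ = _ := by ring

/-- If probing never stopped at once, an a.s. bound `a` on the rate could be improved to `ρ a` with a
fixed `ρ < 1`, so that the rate would vanish. -/
lemma measure_stopAtOnce_pos [IsProbabilityMeasure ν] (hβ : 0 < β) (hβ1 : β < 1)
    (hν : ∀ᵐ x ∂ν, 0 ≤ x)
    (hi : Integrable (fun x : ℝ => x) ν) (h1 : ∫ x, x ∂ν = 1) : 0 < ν (stopAtOnce β ν) := by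
  by_contra hc
  have hE : ∀ᵐ x ∂ν, x ∉ stopAtOnce β ν := measure_eq_zero_iff_ae_notMem.1 (by simpa using hc)
  have e1 : discount β 1 = 1 - β := by
    unfold discount; rw [max_eq_left] <;> push_cast <;> linarith
  have e2 : discount β 2 < 1 - β := by
    unfold discount; refine max_lt ?_ ?_ <;> push_cast <;> linarith
  have hi' : ∀ x, Integrable (fun x' : ℝ => max x x') ν := fun x => (integrable_const x).sup hi
  have hnot : ∀ x, 0 < x → x ∉ stopAtOnce β ν →
      (1 - β) * x < discount β 2 * ∫ x', max x x' ∂ν := by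
    intro x hx hn
    by_contra hc'
    refine hn ⟨hx, ?_⟩
    simp_rw [← ENNReal.ofReal_max]
    rw [← ofReal_integral_eq_lintegral_ofReal (hi' x)
      (Eventually.of_forall fun x' => hx.le.trans (le_max_left _ _)),
      ← ENNReal.ofReal_mul (discount_nonneg _ _), ← ENNReal.ofReal_mul (discount_nonneg _ _), e1]
    exact ENNReal.ofReal_le_ofReal (not_lt.1 hc')
  set ρ := discount β 2 / (1 - β) with hρ
  have hρ0 : 0 ≤ ρ := div_nonneg (discount_nonneg _ _) (by linarith)
  have hρ1 : ρ < 1 := (div_lt_one (by linarith)).2 e2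
  have hd : discount β 2 = ρ * (1 - β) := by
    rw [hρ, div_mul_cancel₀]; linarith
  have hstep : ∀ a : ℝ, 0 ≤ a → (∀ᵐ x ∂ν, x ≤ a) → ∀ᵐ x ∂ν, x ≤ ρ * a := by
    intro a ha hxa
    filter_upwards [hE, hxa] with x hxE hx
    rcases le_or_gt x 0 with h0 | h0
    · exact h0.trans (mul_nonneg hρ0 ha)
    have h2 : ∫ x', max x x' ∂ν ≤ a := by
      calc ∫ x', max x x' ∂ν ≤ ∫ _, a ∂ν := by
            refine integral_mono_ae (hi' x) (integrable_const _) ?_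
            filter_upwards [hxa] with x' hx'
            exact max_le hx hx'
        _ = a := by simp
    have h3 := hnot x h0 hxE
    rw [hd] at h3
    have h4 : ρ * (1 - β) * ∫ x', max x x' ∂ν ≤ ρ * (1 - β) * a :=
      mul_le_mul_of_nonneg_left h2 (mul_nonneg hρ0 (by linarith))
    have h5 : (1 - β) * x < (1 - β) * (ρ * a) := by linarith
    exact (lt_of_mul_lt_mul_left h5 (by linarith)).le
  have hbase : ∀ᵐ x ∂ν, x ≤ ρ / (1 - ρ) := by
    filter_upwards [hE] with x hxE
    have hb : 0 < 1 - ρ := by linarith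
    rcases le_or_gt x 0 with h0 | h0
    · exact h0.trans (div_nonneg hρ0 hb.le)
    have h2 : ∫ x', max x x' ∂ν ≤ x + 1 := by
      calc ∫ x', max x x' ∂ν ≤ ∫ x', x + x' ∂ν := by
            refine integral_mono_ae (hi' x) ((integrable_const _).add hi) ?_
            filter_upwards [hν] with x' hx'
            exact max_le (by linarith) (by linarith)
        _ = x + 1 := by
            rw [integral_add (integrable_const _) hi, h1]; simp
    have h3 := hnot x h0 hxE
    rw [hd] at h3
    have h4 : ρ * (1 - β) * ∫ x', max x x' ∂ν ≤ ρ * (1 - β) * (x + 1) :=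
      mul_le_mul_of_nonneg_left h2 (mul_nonneg hρ0 (by linarith))
    have h5 : (1 - β) * x < (1 - β) * (ρ * (x + 1)) := by linarith
    have h6 := lt_of_mul_lt_mul_left h5 (by linarith)
    rw [le_div_iff₀ hb]
    linarith
  have hall : ∀ n : ℕ, ∀ᵐ x ∂ν, x ≤ ρ ^ n * (ρ / (1 - ρ)) := by
    intro n
    induction n with
    | zero => simpa using hbase
    | succ n ih =>
      have := hstep _ (mul_nonneg (pow_nonneg hρ0 n) (div_nonneg hρ0 (by linarith))) ih
      rw [pow_succ']
      simpa [mul_assoc] using this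
  have hzero : ∀ᵐ x ∂ν, x ≤ 0 := by
    filter_upwards [ae_all_iff.2 hall] with x hx
    have ht := (tendsto_pow_atTop_nhds_zero_of_lt_one hρ0 hρ1).mul_const (ρ / (1 - ρ))
    rw [zero_mul] at ht
    exact ge_of_tendsto' ht hx
  have := integral_nonpos_of_ae (μ := ν) (f := fun x : ℝ => x) hzero
  linarith

lemma integral_stopAtOnce_pos [IsProbabilityMeasure ν] (hβ : 0 < β) (hβ1 : β < 1)
    (hν : ∀ᵐ x ∂ν, 0 ≤ x)
    (hi : Integrable (fun x : ℝ => x) ν) (h1 : ∫ x, x ∂ν = 1) :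
    0 < ∫ x in stopAtOnce β ν, x ∂ν := by
  rw [setIntegral_pos_iff_support_of_nonneg_ae (ae_restrict_of_ae hν) hi.integrableOn]
  refine (measure_stopAtOnce_pos hβ hβ1 hν hi h1).trans_le (measure_mono fun x hx => ?_)
  exact ⟨hx.1.ne', hx⟩

end StopAtOnce

/-! ### The mean service of the algorithm -/

/-- What the convergence proof uses about the mean service `p` at a throughput vector `x`, both
measured in units of the mean rates: a total service bound, a lower bound for the service weighted by
the marginal utilities `1 / x k`, and a lower bound for the service of some worst-off user, which is
what remains of the second bound at the boundary of the orthant. -/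
structure IsProportionalService {K : ℕ} (κ c : ℝ) (x p : Fin K → ℝ) : Prop where
  nonneg : ∀ k, 0 ≤ p k
  le_one : ∀ k, p k ≤ 1
  sum_le : ∑ k, p k ≤ K * κ
  le_sum : (∀ k, 0 < x k) → κ * ∑ k, 1 / x k ≤ ∑ k, p k / x k
  exists_min : ∃ k, (∀ l, x k ≤ x l) ∧ c ≤ p k

section Positions

variable {K : ℕ} {β : ℝ} {ν : Measure ℝ} {r : Fin K → ℝ}

/-- The weights of the users listed in the probing order. -/
def posWeight (r : Fin K → ℝ) (σ : Equiv.Perm (Fin K)) (T : Fin K → ℝ) (i : Fin K) : ℝ≥0∞ :=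
  normalized (r (σ i)) (T (σ i))

/-- The rates of the users listed in the probing order, in units of the mean rates. -/
def posRate (r : Fin K → ℝ) (σ : Equiv.Perm (Fin K)) (R : Fin K → ℝ) (i : Fin K) : ℝ :=
  R (σ i) / r (σ i)

lemma normalized_eq_mul {a ρ τ : ℝ} (ha : 0 < a) :
    normalized ρ τ = normalized a τ * ENNReal.ofReal (ρ / a) := by
  unfold normalized
  have : ENNReal.ofReal ρ = ENNReal.ofReal a * ENNReal.ofReal (ρ / a) := by
    rw [← ENNReal.ofReal_mul ha.le, mul_div_cancel₀ _ ha.ne']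
  rw [this, ENNReal.mul_div_right_comm]

lemma bestSoFar_eq (hr : ∀ k, 0 < r k) (σ : Equiv.Perm (Fin K)) (T R : Fin K → ℝ) (j : ℕ) :
    bestSoFar σ T R j = weightedMax (posWeight r σ T) (posRate r σ R) j := by
  unfold bestSoFar weightedMax posWeight posRate
  simp_rw [← normalized_eq_mul (hr _)]

lemma continues_iff (hr : ∀ k, 0 < r k) (σ : Equiv.Perm (Fin K)) (T R : Fin K → ℝ) (j : ℕ) :
    Continues β ν r σ T R j ↔
      LookaheadContinues β ν (posWeight r σ T) (posRate r σ R) j := by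
  unfold Continues LookaheadContinues
  rw [bestSoFar_eq hr, ofReal_discount, ofReal_discount]
  push_cast
  refine exists_congr fun h => ?_
  have : ∫⁻ ρ, max (weightedMax (posWeight r σ T) (posRate r σ R) j)
      (normalized ρ (T (σ ⟨j, h⟩))) ∂(rateLaw ν r (σ ⟨j, h⟩)) =
      ∫⁻ x, max (weightedMax (posWeight r σ T) (posRate r σ R) j)
        (posWeight r σ T ⟨j, h⟩ * ENNReal.ofReal x) ∂ν := by
    unfold rateLaw
    rw [lintegral_map (by unfold normalized; fun_prop) (by fun_prop)]
    refine lintegral_congr fun x => ?_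
    rw [normalized_eq_mul (hr (σ ⟨j, h⟩)), mul_div_cancel_left₀ _ (hr _).ne']
    rfl
  rw [this]

lemma numProbes_eq (hr : ∀ k, 0 < r k) (σ : Equiv.Perm (Fin K)) (T R : Fin K → ℝ) :
    numProbes β ν r σ T R = lookaheadStop β ν (posWeight r σ T) (posRate r σ R) := by
  unfold numProbes lookaheadStop
  simp_rw [continues_iff hr]

instance [IsProbabilityMeasure ν] (k : Fin K) : IsProbabilityMeasure (rateLaw ν r k) :=
  Measure.isProbabilityMeasure_map (by fun_prop)

lemma measurePreserving_posRate [IsProbabilityMeasure ν] (hr : ∀ k, 0 < r k)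
    (σ : Equiv.Perm (Fin K)) :
    MeasurePreserving (posRate r σ) (Measure.pi (rateLaw ν r)) (Measure.pi fun _ => ν) := by
  have h1 : ∀ k, MeasurePreserving (fun x => x / r k) (rateLaw ν r k) ν := by
    intro k
    refine ⟨by fun_prop, ?_⟩
    unfold rateLaw
    rw [Measure.map_map (by fun_prop) (by fun_prop)]
    convert Measure.map_id
    ext x
    simp [mul_div_cancel_left₀ _ (hr k).ne']
  exact (measurePreserving_reindex (fun _ => ν) σ).comp
    (measurePreserving_pi (rateLaw ν r) (fun _ => ν) h1)

lemma ae_rates_nonneg [IsProbabilityMeasure ν] (hν : ∀ᵐ x ∂ν, 0 ≤ x) (hr : ∀ k, 0 < r k) :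
    ∀ᵐ R : Fin K → ℝ ∂(Measure.pi (rateLaw ν r)), ∀ k, 0 ≤ R k := by
  have := (measurePreserving_posRate (ν := ν) hr (Equiv.refl _)).quasiMeasurePreserving.ae
    (ae_pi_nonneg hν)
  filter_upwards [this] with R hR k
  have h := hR k
  simp only [posRate, Equiv.refl_apply] at h
  have h' := mul_nonneg h (hr k).le
  rwa [div_mul_cancel₀ _ (hr k).ne'] at h'

lemma integrable_rate [IsProbabilityMeasure ν] (hr : ∀ k, 0 < r k)
    (hi : Integrable (fun x : ℝ => x) ν) (k : Fin K) :
    Integrable (fun R : Fin K → ℝ => R k) (Measure.pi (rateLaw ν r)) := by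
  have := ((measurePreserving_posRate (ν := ν) hr (Equiv.refl _)).integrable_comp_of_integrable
    (integrable_eval_pi hi k)).const_mul (r k)
  refine this.congr (Eventually.of_forall fun R => ?_)
  simp [posRate, mul_div_cancel₀ _ (hr k).ne']

lemma integral_posRate [IsProbabilityMeasure ν] (hr : ∀ k, 0 < r k) (σ : Equiv.Perm (Fin K))
    {f : (Fin K → ℝ) → ℝ} (hf : Integrable f (Measure.pi fun _ => ν)) :
    ∫ R, f (posRate r σ R) ∂(Measure.pi (rateLaw ν r)) = ∫ X, f X ∂(Measure.pi fun _ => ν) := by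
  have h := measurePreserving_posRate (ν := ν) hr σ
  conv_rhs => rw [← h.map_eq]
  exact (integral_map h.measurable.aemeasurable (by rw [h.map_eq]; exact hf.1)).symm

lemma integral_rate [IsProbabilityMeasure ν] (hr : ∀ k, 0 < r k)
    (hi : Integrable (fun x : ℝ => x) ν) (hmean : ∫ x, x ∂ν = 1) (k : Fin K) :
    ∫ R : Fin K → ℝ, R k ∂(Measure.pi (rateLaw ν r)) = r k := by
  have h := integral_posRate (ν := ν) hr (Equiv.refl _) (integrable_eval_pi hi k)
  have h2 : ∫ X : Fin K → ℝ, X k ∂(Measure.pi fun _ => ν) = 1 := by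
    have h3 := (measurePreserving_eval (fun _ : Fin K => ν) k)
    rw [← hmean]
    conv_rhs => rw [← h3.map_eq]
    exact (integral_map h3.measurable.aemeasurable measurable_id.aestronglyMeasurable).symm
  rw [h2] at h
  simp only [posRate, Equiv.refl_apply] at h
  rw [integral_div, div_eq_one_iff_eq (hr k).ne'] at h
  exact h

end Positions

namespace Rule

variable {K : ℕ} {β : ℝ} {ν : Measure ℝ} {r : Fin K → ℝ}

lemma measurable_posWeight (A : Rule β ν r) :
    Measurable fun T => posWeight r (A.order T) T := by
  refine measurable_pi_iff.2 fun i => ?_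
  have h : Measurable fun p : Fin K × (Fin K → ℝ) => normalized (r p.1) (p.2 p.1) :=
    measurable_from_prod_countable_right fun k => by unfold normalized; fun_prop
  exact h.comp ((A.measurable_order i).prodMk measurable_id)

lemma measurable_posRate (A : Rule β ν r) :
    Measurable fun p : (Fin K → ℝ) × (Fin K → ℝ) => posRate r (A.order p.1) p.2 := by
  refine measurable_pi_iff.2 fun i => ?_
  have h : Measurable fun p : Fin K × (Fin K → ℝ) => p.2 p.1 / r p.1 :=
    measurable_from_prod_countable_right fun k => by fun_prop
  exact h.comp (((A.measurable_order i).comp measurable_fst).prodMk measurable_snd)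

lemma measurable_transmitted [SFinite ν] (hK : 0 < K) (hr : ∀ k, 0 < r k) (A : Rule β ν r)
    (k : Fin K) :
    Measurable fun p : (Fin K → ℝ) × (Fin K → ℝ) => A.transmitted p.1 p.2 k := by
  unfold transmitted
  have h : Measurable fun p : (Fin K → ℝ) × (Fin K → ℝ) =>
      numProbes β ν r (A.order p.1) p.1 p.2 := by
    simp_rw [numProbes_eq hr]
    exact Measurable.comp (f := fun p : (Fin K → ℝ) × (Fin K → ℝ) =>
      (posWeight r (A.order p.1) p.1, posRate r (A.order p.1) p.2))
      (g := fun q : (Fin K → ℝ≥0∞) × (Fin K → ℝ) => lookaheadStop β ν q.1 q.2)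
      (measurable_lookaheadStop hK)
      ((A.measurable_posWeight.comp measurable_fst).prodMk A.measurable_posRate)
  have h' : Measurable fun p : (Fin K → ℝ) × (Fin K → ℝ) =>
      1 - (numProbes β ν r (A.order p.1) p.1 p.2 : ℝ) * β :=
    (measurable_from_nat (f := fun n : ℕ => 1 - (n : ℝ) * β)).comp h
  have hp : MeasurableSet {p : (Fin K → ℝ) × (Fin K → ℝ) | A.pick p.1 p.2 = k} :=
    A.measurable_pick (measurableSet_singleton k)
  exact (h'.mul ((measurable_pi_apply k).comp measurable_snd)).mul
    (Measurable.ite hp measurable_const measurable_const)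

lemma discount_numProbes_pos (hK : 0 < K) (hβ1 : β < 1) (hr : ∀ k, 0 < r k)
    (σ : Equiv.Perm (Fin K)) (T R : Fin K → ℝ) : 0 < 1 - (numProbes β ν r σ T R : ℝ) * β := by
  rw [numProbes_eq hr]
  exact discount_lookaheadStop_pos hK hβ1

lemma transmitted_nonneg (hK : 0 < K) (hβ1 : β < 1) (hr : ∀ k, 0 < r k) (A : Rule β ν r)
    (T : Fin K → ℝ) {R : Fin K → ℝ} {k : Fin K} (hR : 0 ≤ R k) : 0 ≤ A.transmitted T R k := by
  unfold transmitted
  have := discount_numProbes_pos (ν := ν) hK hβ1 hr (A.order T) T R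
  split_ifs <;> positivity

lemma transmitted_le (hβ : 0 < β) (A : Rule β ν r)
    (T : Fin K → ℝ) {R : Fin K → ℝ} {k : Fin K} (hR : 0 ≤ R k) : A.transmitted T R k ≤ R k := by
  unfold transmitted
  have h1 : (1 - (numProbes β ν r (A.order T) T R : ℝ) * β) ≤ 1 := by
    have : 0 ≤ (numProbes β ν r (A.order T) T R : ℝ) * β := by positivity
    linarith
  have h2 := mul_le_of_le_one_left hR h1
  split_ifs
  · simpa using h2
  · simpa using hR

/-- The mean amounts of data `E[B(n) | T(n-1) = T]` transmitted in a slot. -/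
def meanService (A : Rule β ν r) (T : Fin K → ℝ) (k : Fin K) : ℝ :=
  ∫ R, A.transmitted T R k ∂(Measure.pi (rateLaw ν r))

lemma drift_eq (A : Rule β ν r) (T : Fin K → ℝ) (k : Fin K) :
    A.drift T k = A.meanService T k - T k := by
  rw [drift, meanService]; ring

lemma sum_mul_transmitted (A : Rule β ν r) (a T R : Fin K → ℝ) :
    ∑ k, a k * A.transmitted T R k =
      (1 - numProbes β ν r (A.order T) T R * β) * (a (A.pick T R) * R (A.pick T R)) := by
  rw [Finset.sum_eq_single (A.pick T R)]
  · simp [transmitted]; ring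
  · intro k _ hk
    simp [transmitted, hk.symm]
  · simp

variable [IsProbabilityMeasure ν]

lemma integrable_transmitted (hK : 0 < K) (hβ : 0 < β) (hβ1 : β < 1) (hν : ∀ᵐ x ∂ν, 0 ≤ x)
    (hi : Integrable (fun x : ℝ => x) ν) (hr : ∀ k, 0 < r k) (A : Rule β ν r) (T : Fin K → ℝ)
    (k : Fin K) :
    Integrable (fun R => A.transmitted T R k) (Measure.pi (rateLaw ν r)) := by
  refine (integrable_rate hr hi k).mono' ?_ ?_
  · exact (Measurable.comp (f := fun R : Fin K → ℝ => (T, R)) (A.measurable_transmitted hK hr k)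
      (by fun_prop)).aestronglyMeasurable
  · filter_upwards [ae_rates_nonneg hν hr] with R hR
    rw [Real.norm_of_nonneg (A.transmitted_nonneg hK hβ1 hr T (hR k))]
    exact A.transmitted_le hβ T (hR k)

lemma sum_mul_meanService (hK : 0 < K) (hβ : 0 < β) (hβ1 : β < 1) (hν : ∀ᵐ x ∂ν, 0 ≤ x)
    (hi : Integrable (fun x : ℝ => x) ν) (hr : ∀ k, 0 < r k) (A : Rule β ν r) (a T : Fin K → ℝ) :
    ∑ k, a k * A.meanService T k =
      ∫ R, (1 - numProbes β ν r (A.order T) T R * β) * (a (A.pick T R) * R (A.pick T R))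
        ∂(Measure.pi (rateLaw ν r)) := by
  simp_rw [← sum_mul_transmitted, meanService]
  rw [integral_finsetSum _ fun k _ =>
    (A.integrable_transmitted hK hβ hβ1 hν hi hr T k).const_mul (a k)]
  simp_rw [integral_const_mul]

/-- In units of the mean rates, the total service cannot exceed the value of the symmetric
problem. -/
lemma sum_meanService_div_le (hK : 0 < K) (hβ : 0 < β) (hβ1 : β < 1) (hν : ∀ᵐ x ∂ν, 0 ≤ x)
    (hi : Integrable (fun x : ℝ => x) ν) (hr : ∀ k, 0 < r k) (A : Rule β ν r) (T : Fin K → ℝ) :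
    ∑ k, A.meanService T k / r k ≤ symmetricValue K β ν := by
  set σ := A.order T with hσ
  have hm := measurable_lookaheadStop_right (β := β) (ν := ν) hK (posWeight r σ T)
  have hint := integrable_stopped (β := β) hβ.le hν hi (y := fun _ : Fin K => (1 : ℝ))
    (fun _ => zero_le_one) hm
  have h1 := integral_stopped_le_symmetricValue hβ hν hi hK
    (N := lookaheadStop β ν (posWeight r σ T)) (fun _ => one_le_lookaheadStop hK)
    (fun _ => lookaheadStop_le hK) (fun j => hm measurableSet_Ioi)
    (fun j h X x => lt_lookaheadStop_update hK h x)
  rw [← integral_posRate hr σ hint] at h1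
  refine le_trans (le_of_eq ?_) (le_trans (integral_mono_ae (?_ : Integrable (fun R =>
    (1 - numProbes β ν r (A.order T) T R * β) *
      ((r (A.pick T R))⁻¹ * R (A.pick T R))) _)
    ((measurePreserving_posRate hr σ).integrable_comp_of_integrable hint) ?_) h1)
  · rw [← A.sum_mul_meanService hK hβ hβ1 hν hi hr (fun k => (r k)⁻¹)]
    exact Finset.sum_congr rfl fun k _ => by rw [div_eq_inv_mul]
  · simp_rw [← A.sum_mul_transmitted (fun k => (r k)⁻¹)]
    exact integrable_finsetSum _ fun k _ =>
      (A.integrable_transmitted hK hβ hβ1 hν hi hr T k).const_mul _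
  · filter_upwards [] with R
    obtain ⟨i, hi1, hi2⟩ := A.pick_probed T R
    rw [← hi2]
    simp only [Function.comp]
    rw [numProbes_eq hr] at hi1 ⊢
    rw [← discount_lookaheadStop hK hβ1]
    refine mul_le_mul_of_nonneg_left ?_ (discount_nonneg _ _)
    have := le_runMax (y := fun _ => (1 : ℝ)) (X := posRate r σ R) hi1
    rw [one_mul] at this
    rwa [← div_eq_inv_mul]

/-- The service weighted by the marginal utilities `1 / T k` is at least what each user would get
in the symmetric problem. -/
lemma symmetricValue_mul_le_sum_meanService_div (hK : 0 < K) (hβ : 0 < β) (hβ1 : β < 1)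
    (hν : ∀ᵐ x ∂ν, 0 ≤ x) (hi : Integrable (fun x : ℝ => x) ν) (hr : ∀ k, 0 < r k)
    (A : Rule β ν r) {T : Fin K → ℝ} (hT : ∀ k, 0 < T k) :
    symmetricValue K β ν / K * ∑ k, r k / T k ≤ ∑ k, A.meanService T k / T k := by
  set σ := A.order T with hσ
  set y : Fin K → ℝ := fun i => r (σ i) / T (σ i) with hy
  have hy0 : ∀ i, 0 ≤ y i := fun i => (div_pos (hr _) (hT _)).le
  have hyw : posWeight r σ T = fun i => ENNReal.ofReal (y i) := by
    ext i
    simp only [posWeight, normalized, hy, ENNReal.ofReal_div_of_pos (hT _)]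
  have hanti : Antitone y := by
    intro i j hij
    have := A.order_sorted T hij
    change posWeight r σ T j ≤ posWeight r σ T i at this
    rw [hyw] at this
    exact (ENNReal.ofReal_le_ofReal_iff (hy0 i)).1 this
  have h1 := symmetricValue_mul_sum_le hβ hν hi hK hy0 hanti
  have hsum : ∑ i, y i = ∑ k, r k / T k := Equiv.sum_comp σ fun k => r k / T k
  have hm := measurable_lookaheadStop_right (β := β) (ν := ν) hK fun i => ENNReal.ofReal (y i)
  rw [hsum, ← integral_posRate hr σ (integrable_stopped hβ.le hν hi hy0 hm)] at h1
  refine h1.trans (le_of_eq ?_)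
  have h2 := A.sum_mul_meanService hK hβ hβ1 hν hi hr (fun k => (T k)⁻¹) T
  rw [Finset.sum_congr rfl fun k _ => (div_eq_inv_mul (A.meanService T k) (T k)), h2]
  refine integral_congr_ae ?_
  filter_upwards [ae_rates_nonneg hν hr] with R hR
  have h3 := A.pick_best T R
  rw [numProbes_eq hr, bestSoFar_eq hr, ← hσ, hyw, weightedMax_ofReal hy0, normalized,
    ← ENNReal.ofReal_div_of_pos (hT _),
    ENNReal.ofReal_eq_ofReal_iff (div_nonneg (hR _) (hT _).le) (runMax_nonneg _)] at h3
  rw [numProbes_eq hr, ← hσ, hyw, discount_lookaheadStop hK hβ1, ← h3, div_eq_inv_mul]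

/-- The user that is probed first has a least throughput in units of the mean rates, and its mean
service is bounded below. -/
lemma exists_min_le_meanService (hK : 0 < K) (hβ : 0 < β) (hβ1 : β < 1)
    (hν : ∀ᵐ x ∂ν, 0 ≤ x) (hi : Integrable (fun x : ℝ => x) ν) (hr : ∀ k, 0 < r k)
    (A : Rule β ν r) {T : Fin K → ℝ} (hT : ∀ k, 0 ≤ T k) :
    ∃ k, (∀ l, T k / r k ≤ T l / r l) ∧
      (1 - β) * ∫ x in stopAtOnce β ν, x ∂ν ≤ A.meanService T k / r k := by
  set σ := A.order T with hσ
  have hanti : Antitone (posWeight r σ T) := A.order_sorted T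
  refine ⟨σ ⟨0, hK⟩, fun l => ?_, ?_⟩
  · obtain ⟨i, rfl⟩ := σ.surjective l
    have h := hanti (show (⟨0, hK⟩ : Fin K) ≤ i from Nat.zero_le _)
    unfold posWeight normalized at h
    rcases (hT (σ ⟨0, hK⟩)).eq_or_lt with h0 | h0
    · rw [← h0, zero_div]
      exact div_nonneg (hT _) (hr _).le
    rcases (hT (σ i)).eq_or_lt with h1 | h1
    · rw [← h1, ENNReal.ofReal_zero, ENNReal.div_zero (by simpa using hr _),
        ← ENNReal.ofReal_div_of_pos h0, top_le_iff] at h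
      exact absurd h ENNReal.ofReal_ne_top
    rw [← ENNReal.ofReal_div_of_pos h0, ← ENNReal.ofReal_div_of_pos h1,
      ENNReal.ofReal_le_ofReal_iff (div_pos (hr _) h0).le, div_le_div_iff₀ h1 h0] at h
    rw [div_le_div_iff₀ (hr _) (hr _)]
    linarith
  · set E := stopAtOnce β ν with hE
    have hme : MeasurableSet E := measurableSet_stopAtOnce
    have hg : Integrable (fun X : Fin K → ℝ => (1 - β) * E.indicator (fun x => x) (X ⟨0, hK⟩))
        (Measure.pi fun _ => ν) :=
      ((measurePreserving_eval (fun _ : Fin K => ν) ⟨0, hK⟩).integrable_comp_of_integrable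
        (hi.indicator hme)).const_mul _
    have h3 := (measurePreserving_eval (fun _ : Fin K => ν) ⟨0, hK⟩)
    have h4 : ∫ X : Fin K → ℝ, E.indicator (fun x => x) (X ⟨0, hK⟩) ∂(Measure.pi fun _ => ν) =
        ∫ x in E, x ∂ν := by
      rw [← integral_indicator hme]
      conv_rhs => rw [← h3.map_eq]
      exact (integral_map h3.measurable.aemeasurable
        (measurable_id.indicator hme).aestronglyMeasurable).symm
    rw [← h4, ← integral_const_mul, ← integral_posRate hr σ hg, meanService, ← integral_div]
    refine integral_mono_ae ((measurePreserving_posRate hr σ).integrable_comp_of_integrable hg)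
      ((A.integrable_transmitted hK hβ hβ1 hν hi hr T _).div_const _) ?_
    filter_upwards [ae_rates_nonneg hν hr] with R hR
    by_cases hx : posRate r σ R ⟨0, hK⟩ ∈ E
    · have hN : numProbes β ν r (A.order T) T R = 1 := by
        rw [numProbes_eq hr]
        exact lookaheadStop_eq_one hK hanti hx
      obtain ⟨i, hi1, hi2⟩ := A.pick_probed T R
      have hi0 : i = ⟨0, hK⟩ := Fin.ext (by rw [hN] at hi1; simpa using hi1)
      subst hi0
      rw [Set.indicator_of_mem hx, transmitted, hN, ← hi2, ← hσ, if_pos rfl, posRate]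
      apply le_of_eq
      push_cast
      ring
    · simp only [Set.indicator_of_notMem hx, mul_zero]
      exact div_nonneg (A.transmitted_nonneg hK hβ1 hr T (hR _)) (hr _).le

lemma meanService_nonneg (hK : 0 < K) (hβ1 : β < 1)
    (hν : ∀ᵐ x ∂ν, 0 ≤ x) (hr : ∀ k, 0 < r k)
    (A : Rule β ν r) (T : Fin K → ℝ) (k : Fin K) : 0 ≤ A.meanService T k :=
  integral_nonneg_of_ae <| by
    filter_upwards [ae_rates_nonneg hν hr] with R hR
    exact A.transmitted_nonneg hK hβ1 hr T (hR k)

lemma meanService_le (hK : 0 < K) (hβ : 0 < β) (hβ1 : β < 1)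
    (hν : ∀ᵐ x ∂ν, 0 ≤ x) (hi : Integrable (fun x : ℝ => x) ν) (hmean : ∫ x, x ∂ν = 1)
    (hr : ∀ k, 0 < r k) (A : Rule β ν r) (T : Fin K → ℝ) (k : Fin K) :
    A.meanService T k ≤ r k := by
  rw [← integral_rate (ν := ν) hr hi hmean k]
  refine integral_mono_ae (A.integrable_transmitted hK hβ hβ1 hν hi hr T k)
    (integrable_rate hr hi k) ?_
  filter_upwards [ae_rates_nonneg hν hr] with R hR
  exact A.transmitted_le hβ T (hR k)

lemma isProportionalService (hK : 0 < K) (hβ : 0 < β) (hβ1 : β < 1)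
    (hν : ∀ᵐ x ∂ν, 0 ≤ x) (hi : Integrable (fun x : ℝ => x) ν) (hmean : ∫ x, x ∂ν = 1)
    (hr : ∀ k, 0 < r k) (A : Rule β ν r) {T : Fin K → ℝ} (hT : ∀ k, 0 ≤ T k) :
    IsProportionalService (symmetricValue K β ν / K) ((1 - β) * ∫ x in stopAtOnce β ν, x ∂ν)
      (fun k => T k / r k) (fun k => A.meanService T k / r k) where
  nonneg k := div_nonneg (A.meanService_nonneg hK hβ1 hν hr T k) (hr k).le
  le_one k := (div_le_one (hr k)).2 (A.meanService_le hK hβ hβ1 hν hi hmean hr T k)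
  sum_le := by
    rw [mul_div_cancel₀ _ (by exact_mod_cast hK.ne')]
    exact A.sum_meanService_div_le hK hβ hβ1 hν hi hr T
  le_sum hx := by
    have hT' : ∀ k, 0 < T k := fun k => by
      have := mul_pos (hx k) (hr k)
      rwa [div_mul_cancel₀ _ (hr k).ne'] at this
    have := A.symmetricValue_mul_le_sum_meanService_div hK hβ hβ1 hν hi hr hT'
    simp_rw [one_div_div, div_div_div_cancel_right₀ (hr _).ne']
    exact this
  exists_min := A.exists_min_le_meanService hK hβ hβ1 hν hi hr hT

end Rule

/-! ### The Lyapunov function -/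

/-- The convex function `u - 1 - log u` of `u = z / κ`, with minimum `0` at `z = κ`.  Summed over the
users it is a Lyapunov function. -/
def entropyGap (κ z : ℝ) : ℝ := z / κ - 1 - Real.log (z / κ)

section Entropy

variable {κ : ℝ}

lemma entropyGap_le (hκ : 0 < κ) {z : ℝ} (hz : 0 < z) :
    entropyGap κ z ≤ z / κ + κ * (1 / z) - 2 := by
  have h := Real.one_sub_inv_le_log_of_pos (div_pos hz hκ)
  rw [inv_div] at h
  unfold entropyGap
  have : κ * (1 / z) = κ / z := by ring
  linarith

lemma sq_le_entropyGap (hκ : 0 < κ) {z : ℝ} (hz : 0 < z) :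
    (√(z / κ) - 1) ^ 2 ≤ entropyGap κ z := by
  have hu : 0 < z / κ := div_pos hz hκ
  have h1 := Real.log_le_sub_one_of_pos (Real.sqrt_pos.2 hu)
  rw [Real.log_sqrt hu.le] at h1
  have h2 := Real.sq_sqrt hu.le
  unfold entropyGap
  nlinarith

lemma entropyGap_nonneg (hκ : 0 < κ) {z : ℝ} (hz : 0 < z) : 0 ≤ entropyGap κ z :=
  (sq_nonneg _).trans (sq_le_entropyGap hκ hz)

/-- The first-order expansion of `entropyGap` with its remainder bound. -/
lemma entropyGap_add_le (hκ : 0 < κ) {z δ : ℝ} (hz : 0 < z) (hz' : 0 < z + δ) :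
    entropyGap κ (z + δ) ≤ entropyGap κ z + (1 / κ - 1 / z) * δ + δ ^ 2 / (z * (z + δ)) := by
  have h := Real.one_sub_inv_le_log_of_pos (div_pos hz' hz)
  rw [inv_div] at h
  unfold entropyGap
  rw [Real.log_div hz'.ne' hz.ne'] at h
  rw [Real.log_div hz'.ne' hκ.ne', Real.log_div hz.ne' hκ.ne']
  have e1 : (z + δ) / κ = z / κ + 1 / κ * δ := by ring
  have e2 : δ ^ 2 / (z * (z + δ)) - 1 / z * δ = z / (z + δ) - 1 := by field_simp; ring
  rw [e1]
  linarith

/-- Convexity of `entropyGap`: the graph lies above the tangent at `z`. -/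
lemma entropyGap_sub_le (hκ : 0 < κ) {y z : ℝ} (hy : 0 < y) (hz : 0 < z) :
    entropyGap κ z - entropyGap κ y ≤ (1 / κ - 1 / z) * (z - y) := by
  have h := Real.one_sub_inv_le_log_of_pos (div_pos hz hy)
  rw [Real.log_div hz.ne' hy.ne', inv_div] at h
  unfold entropyGap
  rw [Real.log_div hy.ne' hκ.ne', Real.log_div hz.ne' hκ.ne']
  have e1 : (1 / κ - 1 / z) * (z - y) = z / κ - y / κ - (1 - y / z) := by field_simp
  rw [e1]
  linarith

variable {K : ℕ}

/-- The Lyapunov function decreases exponentially along the mean dynamics. -/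
lemma sum_drift_le (hκ : 0 < κ) {x p : Fin K → ℝ} (hx : ∀ k, 0 < x k)
    (h1 : ∑ k, p k ≤ K * κ) (h2 : κ * ∑ k, 1 / x k ≤ ∑ k, p k / x k) :
    ∑ k, (1 / κ - 1 / x k) * (p k - x k) ≤ -∑ k, entropyGap κ (x k) := by
  have h3 : ∑ k, entropyGap κ (x k) ≤ ∑ k, (x k / κ + κ * (1 / x k) - 2) :=
    Finset.sum_le_sum fun k _ => entropyGap_le hκ (hx k)
  have h4 : ∑ k, (1 / κ - 1 / x k) * (p k - x k) =
      (∑ k, p k) / κ - (∑ k, x k) / κ - ∑ k, p k / x k + K := by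
    rw [Finset.sum_div, Finset.sum_div, ← Finset.sum_sub_distrib, ← Finset.sum_sub_distrib]
    have : (K : ℝ) = ∑ _k : Fin K, (1 : ℝ) := by simp
    rw [this, ← Finset.sum_add_distrib]
    refine Finset.sum_congr rfl fun k _ => ?_
    have := (hx k).ne'
    field_simp
    ring
  have h5 : ∑ k, (x k / κ + κ * (1 / x k) - 2) =
      (∑ k, x k) / κ + κ * ∑ k, 1 / x k - 2 * K := by
    rw [Finset.sum_sub_distrib, Finset.sum_add_distrib, Finset.sum_div, Finset.mul_sum]
    simp [mul_comm]
  have h6 : (∑ k, p k) / κ ≤ K := (div_le_iff₀ hκ).2 h1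
  linarith

/-- Shifting the argument of the Lyapunov function by `d > 0` removes its singularity at the boundary
of the orthant and costs only `O(d)` in the decrease.  When all throughputs are at least `d₀` this is
a perturbation of `sum_drift_le`; otherwise the service of a worst-off user dominates. -/
lemma exists_sum_shifted_drift_le (hκ : 0 < κ) {c : ℝ} (hc : 0 < c) (K : ℕ) :
    ∃ C d₀ : ℝ, 0 < C ∧ 0 < d₀ ∧ ∀ d, 0 < d → d ≤ d₀ → ∀ x p : Fin K → ℝ, (∀ k, 0 ≤ x k) →
      IsProportionalService κ c x p →
      ∑ k, (1 / κ - 1 / (x k + d)) * (p k - x k) ≤ -∑ k, entropyGap κ (x k + d) + C * d := by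
  rcases Nat.eq_zero_or_pos K with rfl | hK
  · exact ⟨1, 1, one_pos, one_pos, fun d hd _ x p _ _ => by simpa using hd.le⟩
  have hKr : (0 : ℝ) < K := by exact_mod_cast hK
  set M : ℝ := |Real.log (2 * K * κ / c)| with hM
  have hM0 : 0 ≤ M := abs_nonneg _
  set d₀ : ℝ := 1 / (2 * (2 * K * M / c + 1)) with hd₀
  have hden : 0 < 2 * (2 * K * M / c + 1) := by positivity
  have hd₀pos : 0 < d₀ := by positivity
  refine ⟨K / d₀ ^ 2 + K / κ, d₀, by positivity, hd₀pos, fun d hd hdd x p hx hp => ?_⟩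
  have hxd : ∀ k, 0 < x k + d := fun k => by linarith [hx k]
  have hstart : ∑ k, (1 / κ - 1 / (x k + d)) * (p k - x k) ≤
      K - (∑ k, x k) / κ - ∑ k, p k / (x k + d) + K := by
    have h6 : (∑ k, p k) / κ ≤ K := (div_le_iff₀ hκ).2 hp.sum_le
    have : ∑ k, (1 / κ - 1 / (x k + d)) * (p k - x k) ≤
        (∑ k, p k) / κ - (∑ k, x k) / κ - ∑ k, p k / (x k + d) + K := by
      have e : (K : ℝ) = ∑ _k : Fin K, (1 : ℝ) := by simp
      rw [Finset.sum_div, Finset.sum_div, ← Finset.sum_sub_distrib, ← Finset.sum_sub_distrib, e,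
        ← Finset.sum_add_distrib]
      refine Finset.sum_le_sum fun k _ => ?_
      have h1 : x k / (x k + d) ≤ 1 := (div_le_one (hxd k)).2 (by linarith)
      have e1 : (1 / κ - 1 / (x k + d)) * (p k - x k) =
          p k / κ - x k / κ - p k / (x k + d) + x k / (x k + d) := by ring
      linarith
    linarith
  have hKd : (K : ℝ) * d / κ = K / κ * d := by ring
  obtain ⟨k₀, hmin, hck⟩ := hp.exists_min
  rcases le_or_gt d₀ (x k₀) with hcase | hcase
  · have hxd₀ : ∀ k, d₀ ≤ x k := fun k => hcase.trans (hmin k)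
    have hxpos : ∀ k, 0 < x k := fun k => hd₀pos.trans_le (hxd₀ k)
    have hA : ∑ k, p k / x k ≤ ∑ k, p k / (x k + d) + K / d₀ ^ 2 * d := by
      have e : K / d₀ ^ 2 * d = ∑ _k : Fin K, d / d₀ ^ 2 := by simp; ring
      rw [e, ← Finset.sum_add_distrib]
      refine Finset.sum_le_sum fun k _ => ?_
      have e2 : p k / x k = p k / (x k + d) + p k * d / (x k * (x k + d)) := by
        have := (hxpos k).ne'
        have := (hxd k).ne'
        field_simp
      rw [e2]
      have : p k * d / (x k * (x k + d)) ≤ d / d₀ ^ 2 := by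
        apply div_le_div₀ hd.le (mul_le_of_le_one_left hd.le (hp.le_one k)) (by positivity)
        nlinarith [hxd₀ k]
      linarith
    have hB : ∑ k, 1 / (x k + d) ≤ ∑ k, 1 / x k :=
      Finset.sum_le_sum fun k _ => one_div_le_one_div_of_le (hxpos k) (by linarith)
    have hC := hp.le_sum hxpos
    have hD : κ * ∑ k, 1 / (x k + d) ≤ κ * ∑ k, 1 / x k := mul_le_mul_of_nonneg_left hB hκ.le
    have hE : ∑ k, entropyGap κ (x k + d) ≤
        (∑ k, x k) / κ + K * d / κ + κ * ∑ k, 1 / (x k + d) - 2 * K := by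
      have : ∑ k, entropyGap κ (x k + d) ≤ ∑ k, ((x k + d) / κ + κ * (1 / (x k + d)) - 2) :=
        Finset.sum_le_sum fun k _ => entropyGap_le hκ (hxd k)
      refine this.trans (le_of_eq ?_)
      rw [Finset.sum_sub_distrib, Finset.sum_add_distrib, ← Finset.sum_div, Finset.mul_sum,
        Finset.sum_add_distrib]
      simp
      ring
    linarith
  · set a := 1 / (x k₀ + d) with ha
    have hapos : 0 < a := by have := hxd k₀; positivity
    have hlarge : 2 * K * M / c ≤ a := by
      have h1 : x k₀ + d ≤ 2 * d₀ := by linarith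
      have h2 : 1 / (2 * d₀) ≤ a := one_div_le_one_div_of_le (hxd k₀) h1
      have h3 : 1 / (2 * d₀) = 2 * K * M / c + 1 := by
        rw [hd₀]; field_simp
      linarith
    have hlog : (K : ℝ) + K * Real.log (κ * a) ≤ c * a := by
      have e : κ * a = (c * a / (2 * K)) * (2 * K * κ / c) := by field_simp
      rw [e, Real.log_mul (by positivity) (by positivity)]
      have h1 := Real.log_le_sub_one_of_pos (show 0 < c * a / (2 * K) by positivity)
      have h2 : Real.log (2 * K * κ / c) ≤ M := le_abs_self _
      have h3 : K * (Real.log (c * a / (2 * K)) + Real.log (2 * K * κ / c)) ≤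
          K * (c * a / (2 * K) - 1 + M) := mul_le_mul_of_nonneg_left (by linarith) hKr.le
      have h4 : K * (c * a / (2 * K) - 1 + M) = c * a / 2 - K + K * M := by field_simp
      have h5 : 2 * K * M ≤ a * c := (div_le_iff₀ hc).1 hlarge
      linarith
    have hserv : c * a ≤ ∑ k, p k / (x k + d) := by
      refine le_trans ?_ (Finset.single_le_sum (f := fun k => p k / (x k + d))
        (fun k _ => div_nonneg (hp.nonneg k) (hxd k).le) (Finset.mem_univ k₀))
      rw [ha, mul_one_div]
      exact div_le_div_of_nonneg_right hck (hxd k₀).le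
    have hE : ∑ k, entropyGap κ (x k + d) ≤
        (∑ k, x k) / κ + K * d / κ - K + K * Real.log (κ * a) := by
      have : ∑ k, entropyGap κ (x k + d) ≤
          ∑ k, ((x k + d) / κ - 1 + Real.log (κ * a)) := by
        refine Finset.sum_le_sum fun k _ => ?_
        unfold entropyGap
        have h1 : Real.log ((x k₀ + d) / κ) ≤ Real.log ((x k + d) / κ) :=
          Real.log_le_log (div_pos (hxd k₀) hκ)
            (div_le_div_of_nonneg_right (by linarith [hmin k]) hκ.le)
        have h2 : Real.log (κ * a) = -Real.log ((x k₀ + d) / κ) := by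
          rw [← Real.log_inv, inv_div, ha, mul_one_div]
        linarith
      refine this.trans (le_of_eq ?_)
      rw [Finset.sum_add_distrib, Finset.sum_sub_distrib, ← Finset.sum_div,
        Finset.sum_add_distrib]
      simp
      ring
    have : 0 ≤ K / d₀ ^ 2 * d := by positivity
    linarith

end Entropy

/-! ### Stochastic approximation with a convergent noise series -/

/-- Weighted averages with weights `1 / (n + 1)`. -/
lemma eventually_le_of_average {a b : ℕ → ℝ} {c ε : ℝ} (hε : 0 < ε)
    (hab : ∀ᶠ n : ℕ in atTop, a (n + 1) ≤ n / (n + 1) * a n + 1 / (n + 1) * b n)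
    (hb : ∀ᶠ n in atTop, b n ≤ c) : ∀ᶠ n in atTop, a n ≤ c + ε := by
  obtain ⟨m, hm⟩ := eventually_atTop.1 (hab.and hb)
  have key : ∀ j : ℕ, ((m + j : ℕ) : ℝ) * (a (m + j) - c) ≤ m * (a m - c) := by
    intro j
    induction j with
    | zero => simp
    | succ j ih =>
      obtain ⟨h1, h2⟩ := hm (m + j) (by omega)
      have hp : (0 : ℝ) < ((m + j : ℕ) : ℝ) + 1 := by positivity
      have h3 : (((m + j : ℕ) : ℝ) + 1) * a (m + j + 1) ≤ ((m + j : ℕ) : ℝ) * a (m + j) + c := by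
        calc (((m + j : ℕ) : ℝ) + 1) * a (m + j + 1)
            ≤ (((m + j : ℕ) : ℝ) + 1) * (((m + j : ℕ) : ℝ) / (((m + j : ℕ) : ℝ) + 1) * a (m + j) +
              1 / (((m + j : ℕ) : ℝ) + 1) * b (m + j)) := mul_le_mul_of_nonneg_left h1 hp.le
          _ = ((m + j : ℕ) : ℝ) * a (m + j) + b (m + j) := by field_simp
          _ ≤ _ := by linarith
      have e : m + (j + 1) = m + j + 1 := by omega
      rw [e, Nat.cast_succ]
      linarith
  have hlim : Tendsto (fun n : ℕ => m * (a m - c) / (n : ℝ)) atTop (𝓝 0) :=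
    tendsto_const_div_atTop_nhds_zero_nat _
  filter_upwards [hlim.eventually_lt_const hε, eventually_ge_atTop m, eventually_gt_atTop 0]
    with n hn hmn hn0
  have hk := key (n - m)
  rw [Nat.add_sub_cancel' hmn] at hk
  have hn0' : (0 : ℝ) < n := by exact_mod_cast hn0
  have : a n - c ≤ m * (a m - c) / (n : ℝ) := by
    rw [le_div_iff₀ hn0']; linarith
  linarith

/-- One step of the recursion, seen by one summand of the shifted Lyapunov function: `y` is the
shifted state, `z` differs from it by the tail of the noise series, `q` is the drift and `e` a small
bias. -/
lemma entropyGap_step_le {κ d M γ y z q e : ℝ} (hκ : 0 < κ) (hd : 0 < d) (hy : d / 2 ≤ y)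
    (hz : d / 2 ≤ z) (hz' : d / 2 ≤ z + γ * (q + e)) (hq : |q| ≤ M) (he : |e| ≤ 1) (hγ : 0 < γ) :
    entropyGap κ (z + γ * (q + e)) ≤ (1 - γ) * entropyGap κ z +
      γ * ((1 / κ - 1 / y) * q + entropyGap κ y +
        ((1 / κ + 2 / d) * (|z - y| + |e|) + 4 / d ^ 2 * M * |z - y| +
          γ * ((M + 1) ^ 2 * (4 / d ^ 2)))) := by
  have hd2 : 0 < d / 2 := by linarith
  have hypos : 0 < y := by linarith
  have hzpos : 0 < z := by linarith
  have hzpos' : 0 < z + γ * (q + e) := by linarith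
  have hM : 0 ≤ M := (abs_nonneg q).trans hq
  have h1 := entropyGap_add_le hκ hzpos hzpos'
  have h2 := entropyGap_sub_le hκ hypos hzpos
  have hinv : 1 / z ≤ 2 / d := by
    rw [div_le_div_iff₀ hzpos hd]; linarith
  have hinv0 : 0 < 1 / z := by positivity
  have hcoef : |1 / κ - 1 / z| ≤ 1 / κ + 2 / d := by
    have : 0 < 1 / κ := by positivity
    rw [abs_le]; constructor <;> linarith
  have h3 : (1 / κ - 1 / z) * (z - y) ≤ (1 / κ + 2 / d) * |z - y| :=
    (le_abs_self _).trans (by rw [abs_mul]; gcongr)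
  have h4 : (1 / κ - 1 / z) * e ≤ (1 / κ + 2 / d) * |e| :=
    (le_abs_self _).trans (by rw [abs_mul]; gcongr)
  have h5 : (1 / κ - 1 / z) * q ≤ (1 / κ - 1 / y) * q + 4 / d ^ 2 * M * |z - y| := by
    have e1 : (1 / κ - 1 / z) * q - (1 / κ - 1 / y) * q = (z - y) / (y * z) * q := by
      field_simp; ring
    have h6 : (z - y) / (y * z) * q ≤ 4 / d ^ 2 * M * |z - y| := by
      refine (le_abs_self _).trans ?_
      rw [abs_mul, abs_div, abs_of_pos (mul_pos hypos hzpos)]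
      have h7 : |z - y| / (y * z) ≤ |z - y| * (4 / d ^ 2) := by
        rw [div_eq_mul_inv]
        refine mul_le_mul_of_nonneg_left ?_ (abs_nonneg _)
        rw [← one_div, div_le_div_iff₀ (mul_pos hypos hzpos) (by positivity)]
        nlinarith
      calc |z - y| / (y * z) * |q| ≤ |z - y| * (4 / d ^ 2) * M := by gcongr
        _ = _ := by ring
    linarith
  have h8 : (γ * (q + e)) ^ 2 / (z * (z + γ * (q + e))) ≤ γ * (γ * ((M + 1) ^ 2 * (4 / d ^ 2))) := by
    have h9 : (q + e) ^ 2 ≤ (M + 1) ^ 2 := by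
      rw [← sq_abs (q + e)]
      have := abs_add_le q e
      gcongr
      linarith
    have h10 : 1 / (z * (z + γ * (q + e))) ≤ 4 / d ^ 2 := by
      rw [div_le_div_iff₀ (mul_pos hzpos hzpos') (by positivity)]
      nlinarith
    calc (γ * (q + e)) ^ 2 / (z * (z + γ * (q + e)))
        = γ ^ 2 * ((q + e) ^ 2 * (1 / (z * (z + γ * (q + e))))) := by ring
      _ ≤ γ ^ 2 * ((M + 1) ^ 2 * (4 / d ^ 2)) := by gcongr
      _ = _ := by ring
  have h11 : (1 / κ - 1 / z) * (γ * (q + e)) = γ * ((1 / κ - 1 / z) * q + (1 / κ - 1 / z) * e) := by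
    ring
  have h12 : γ * ((1 / κ - 1 / z) * q + (1 / κ - 1 / z) * e + entropyGap κ z) ≤
      γ * ((1 / κ - 1 / y) * q + entropyGap κ y +
        ((1 / κ + 2 / d) * (|z - y| + |e|) + 4 / d ^ 2 * M * |z - y|)) := by
    refine mul_le_mul_of_nonneg_left ?_ hγ.le
    linarith
  nlinarith

/-- Deterministic convergence of the recursion: the noise `ξ` enters through a convergent series, the
bias `e` tends to zero. -/
theorem tendsto_of_recursion {K : ℕ} {κ c : ℝ} (hκ : 0 < κ) (hc : 0 < c)
    {x p ξ e : ℕ → Fin K → ℝ}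
    (hrec : ∀ᶠ n : ℕ in atTop, ∀ k,
      x (n + 1) k = n / (n + 1) * x n k + 1 / (n + 1) * (p n k + ξ n k + e n k))
    (hx : ∀ n k, 0 ≤ x n k) (hp : ∀ n, IsProportionalService κ c (x n) (p n))
    (hξ : ∀ k, ∃ s, Tendsto (fun n => ∑ i ∈ Finset.range n, ξ i k / (i + 1)) atTop (𝓝 s))
    (he : ∀ k, Tendsto (fun n => e n k) atTop (𝓝 0)) :
    Tendsto x atTop (𝓝 fun _ => κ) := by
  choose s hs using hξ
  -- `N` is the tail of the noise series; adding it to `x` removes the noise from the recursion.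
  set N : ℕ → Fin K → ℝ := fun n k => s k - ∑ i ∈ Finset.range n, ξ i k / (i + 1) with hN
  have hNlim : ∀ k, Tendsto (fun n => N n k) atTop (𝓝 0) := fun k => by
    have := (hs k).const_sub (s k)
    rwa [sub_self] at this
  have hNabs : ∀ k, Tendsto (fun n => |N n k|) atTop (𝓝 0) := fun k => by
    simpa using (hNlim k).abs
  have heabs : ∀ k, Tendsto (fun n => |e n k|) atTop (𝓝 0) := fun k => by
    simpa using (he k).abs
  have hNev : ∀ ε, 0 < ε → ∀ᶠ n in atTop, ∀ k, |N n k| ≤ ε := fun ε hε =>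
    eventually_all.2 fun k => (hNabs k).eventually_le_const hε
  have heev : ∀ ε, 0 < ε → ∀ᶠ n in atTop, ∀ k, |e n k| ≤ ε := fun ε hε =>
    eventually_all.2 fun k => (heabs k).eventually_le_const hε
  have hrec' : ∀ᶠ n : ℕ in atTop, ∀ k, x (n + 1) k + N (n + 1) k =
      x n k + N n k + 1 / ((n : ℝ) + 1) * (p n k - x n k + e n k) := by
    filter_upwards [hrec] with n hn k
    rw [hn k]
    simp only [hN, Finset.sum_range_succ]
    have : (n : ℝ) + 1 ≠ 0 := by positivity
    field_simp
    ring
  have hbdd : ∀ᶠ n in atTop, ∀ k, x n k ≤ 5 := by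
    refine eventually_all.2 fun k => ?_
    have h1 : ∀ᶠ n in atTop, x n k + N n k ≤ 3 + 1 := by
      refine eventually_le_of_average (b := fun n => p n k + e n k + N n k) one_pos ?_ ?_
      · filter_upwards [hrec'] with n hn
        rw [hn k]
        apply le_of_eq
        have : (n : ℝ) + 1 ≠ 0 := by positivity
        field_simp
        ring
      · filter_upwards [hNev 1 one_pos, heev 1 one_pos] with n h1 h2
        have := (hp n).le_one k
        have := (abs_le.1 (h1 k)).2
        have := (abs_le.1 (h2 k)).2
        linarith
    filter_upwards [h1, hNev 1 one_pos] with n h1 h2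
    have := (abs_le.1 (h2 k)).1
    linarith
  obtain ⟨C, d₀, hC, hd₀, hdrift⟩ := exists_sum_shifted_drift_le hκ hc K
  have hlyap : ∀ d, 0 < d → d ≤ d₀ →
      ∀ᶠ n in atTop, ∑ k, entropyGap κ (x n k + N n k + d) ≤ (C + 1) * d + d := by
    intro d hd hdd
    have hd2 : 0 < d / 2 := by linarith
    set err : ℕ → Fin K → ℝ := fun n k => (1 / κ + 2 / d) * (|N n k| + |e n k|) +
      4 / d ^ 2 * 5 * |N n k| + 1 / ((n : ℝ) + 1) * ((5 + 1) ^ 2 * (4 / d ^ 2)) with herr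
    have herrlim : Tendsto (fun n => ∑ k, err n k) atTop (𝓝 0) := by
      have : ∀ k, Tendsto (fun n => err n k) atTop (𝓝 0) := fun k => by
        have h1 := (((hNabs k).add (heabs k)).const_mul (1 / κ + 2 / d)).add
          ((hNabs k).const_mul (4 / d ^ 2 * 5))
        have h2 := h1.add ((tendsto_one_div_add_atTop_nhds_zero_nat (𝕜 := ℝ)).mul_const
          ((5 + 1) ^ 2 * (4 / d ^ 2)))
        simp only [add_zero, mul_zero, zero_mul] at h2
        exact h2
      simpa using tendsto_finsetSum Finset.univ fun k _ => this k
    refine eventually_le_of_average (b := fun n => C * d + ∑ k, err n k) hd ?_ ?_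
    · filter_upwards [hrec', hbdd, hNev _ hd2, (tendsto_add_atTop_nat 1).eventually (hNev _ hd2),
        heev 1 one_pos] with n hn hb hN1 hN2 he1
      have hγ : (0 : ℝ) < 1 / ((n : ℝ) + 1) := by positivity
      have hstep : ∀ k, entropyGap κ (x (n + 1) k + N (n + 1) k + d) ≤
          (1 - 1 / ((n : ℝ) + 1)) * entropyGap κ (x n k + N n k + d) + 1 / ((n : ℝ) + 1) *
            ((1 / κ - 1 / (x n k + d)) * (p n k - x n k) + entropyGap κ (x n k + d) + err n k) := by
        intro k
        have e1 : x (n + 1) k + N (n + 1) k + d =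
            x n k + N n k + d + 1 / ((n : ℝ) + 1) * (p n k - x n k + e n k) := by
          rw [hn k]; ring
        have hz' : d / 2 ≤ x (n + 1) k + N (n + 1) k + d := by
          have := (abs_le.1 (hN2 k)).1
          have := hx (n + 1) k
          linarith
        rw [e1] at hz' ⊢
        have hq : |p n k - x n k| ≤ 5 := by
          have := (hp n).nonneg k
          have := (hp n).le_one k
          have := hx n k
          have := hb k
          rw [abs_le]; constructor <;> linarith
        have := entropyGap_step_le hκ hd (y := x n k + d) (z := x n k + N n k + d)
          (by linarith [hx n k]) (by linarith [hx n k, (abs_le.1 (hN1 k)).1]) hz' hq (he1 k) hγ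
        have e2 : x n k + N n k + d - (x n k + d) = N n k := by ring
        rwa [e2] at this
      refine (Finset.sum_le_sum fun k _ => hstep k).trans ?_
      rw [Finset.sum_add_distrib, ← Finset.mul_sum, ← Finset.mul_sum]
      have e3 : (1 - 1 / ((n : ℝ) + 1)) = n / (n + 1) := by
        have : (n : ℝ) + 1 ≠ 0 := by positivity
        field_simp; ring
      rw [e3]
      gcongr
      rw [Finset.sum_add_distrib, Finset.sum_add_distrib]
      have := hdrift d hd hdd (x n) (p n) (hx n) (hp n)
      linarith
    · filter_upwards [herrlim.eventually_le_const hd] with n hn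
      linarith
  refine tendsto_pi_nhds.2 fun k => Metric.tendsto_nhds.2 fun ε hε => ?_
  -- The shift `d` is taken so small that the value of the Lyapunov function pins `x n k` down to `ε`.
  have hsmall : ∀ᶠ d in 𝓝[>] (0 : ℝ), 3 * κ * √((C + 1) * d + d) + 2 * d < ε ∧
      (C + 1) * d + d ≤ 1 := by
    have h1 : Tendsto (fun d : ℝ => 3 * κ * √((C + 1) * d + d) + 2 * d) (𝓝[>] 0) (𝓝 0) := by
      have : Continuous fun d : ℝ => 3 * κ * √((C + 1) * d + d) + 2 * d := by fun_prop
      simpa using (this.tendsto 0).mono_left nhdsWithin_le_nhds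
    have h2 : Tendsto (fun d : ℝ => (C + 1) * d + d) (𝓝[>] 0) (𝓝 0) := by
      have : Continuous fun d : ℝ => (C + 1) * d + d := by fun_prop
      simpa using (this.tendsto 0).mono_left nhdsWithin_le_nhds
    exact (h1.eventually_lt_const hε).and (h2.eventually_le_const one_pos)
  obtain ⟨d, ⟨hd1, hd1'⟩, hd, hdd⟩ := (hsmall.and (Ioc_mem_nhdsGT hd₀)).exists
  filter_upwards [hlyap d hd hdd, hNev _ (show 0 < d / 2 by linarith), hNev d hd] with n hn hN1 hN2
  have hpos : ∀ k, 0 < x n k + N n k + d := fun k => by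
    have := hx n k
    have := (abs_le.1 (hN1 k)).1
    linarith
  have h1 : entropyGap κ (x n k + N n k + d) ≤ (C + 1) * d + d :=
    (Finset.single_le_sum (f := fun k => entropyGap κ (x n k + N n k + d))
      (fun k _ => entropyGap_nonneg hκ (hpos k)) (Finset.mem_univ k)).trans hn
  have h2 := (sq_le_entropyGap hκ (hpos k)).trans h1
  have hu := Real.sq_sqrt (div_pos (hpos k) hκ).le
  set v := √((x n k + N n k + d) / κ) with hv
  set ρ := √((C + 1) * d + d) with hρ
  have hρ0 : 0 ≤ ρ := Real.sqrt_nonneg _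
  have hρ1 : ρ ≤ 1 := Real.sqrt_le_one.2 hd1'
  have h3 : |v - 1| ≤ ρ := Real.abs_le_sqrt h2
  have h4 : |v ^ 2 - 1| ≤ 3 * ρ := by
    have e1 : v ^ 2 - 1 = (v - 1) * (v + 1) := by ring
    have hv0 : 0 ≤ v := Real.sqrt_nonneg _
    have hv2 := (abs_le.1 h3).2
    rw [e1, abs_mul, abs_of_nonneg (by linarith : 0 ≤ v + 1)]
    nlinarith [abs_nonneg (v - 1)]
  have h5 : x n k + N n k + d - κ = κ * (v ^ 2 - 1) := by
    rw [hu]; field_simp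
  rw [Real.dist_eq]
  have h6 : x n k - κ = κ * (v ^ 2 - 1) - N n k - d := by linarith
  rw [h6]
  have h7 : |κ * (v ^ 2 - 1)| ≤ 3 * κ * ρ := by
    rw [abs_mul, abs_of_pos hκ]
    nlinarith
  have h8 := abs_le.1 h7
  have h9 := abs_le.1 (hN2 k)
  rw [abs_lt]
  constructor <;> linarith

/-! ### The regularized differential equation -/

section Regularize

variable {K : ℕ}

/-- A linear inequality that holds near `x` up to arbitrarily small errors holds for the values of
the regularization at `x`. -/
lemma sum_le_of_mem_regularize {h : (Fin K → ℝ) → (Fin K → ℝ)} {x v a : Fin K → ℝ} {m : ℝ}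
    (hv : v ∈ regularize h x) (hle : ∀ ε, 0 < ε → ∀ᶠ y in 𝓝 x, ∑ k, a k * h y k ≤ m + ε) :
    ∑ k, a k * v k ≤ m := by
  refine le_of_forall_pos_le_add fun ε hε => ?_
  obtain ⟨δ, hδ, hball⟩ := Metric.eventually_nhds_iff_ball.1 (hle ε hε)
  have hv' : v ∈ closure (convexHull ℝ (h '' Metric.ball x δ)) := Set.mem_iInter₂.1 hv δ hδ
  have hlin : IsLinearMap ℝ fun w : Fin K → ℝ => ∑ k, a k * w k :=
    ⟨fun w w' => by simp [mul_add, Finset.sum_add_distrib],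
      fun c w => by simp [Finset.mul_sum, mul_left_comm]⟩
  have hconv : Convex ℝ {w : Fin K → ℝ | ∑ k, a k * w k ≤ m + ε} := convex_halfSpace_le hlin _
  have hclosed : IsClosed {w : Fin K → ℝ | ∑ k, a k * w k ≤ m + ε} :=
    isClosed_le (by fun_prop) continuous_const
  refine closure_minimal (convexHull_min ?_ hconv) hclosed hv'
  rintro _ ⟨y, hy, rfl⟩
  exact hball y hy

variable {κ c : ℝ} {r : Fin K → ℝ} {h : (Fin K → ℝ) → (Fin K → ℝ)}

lemma regularize_sum_le
    (hh : ∀ T, (∀ k, 0 < T k) →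
      IsProportionalService κ c (fun k => T k / r k) (fun k => (h T k + T k) / r k))
    {T v : Fin K → ℝ} (hT : ∀ k, 0 < T k) (hv : v ∈ regularize h T) :
    ∑ k, (v k + T k) / r k ≤ K * κ := by
  have key : ∑ k, (1 / r k) * v k ≤ K * κ - ∑ k, T k / r k := by
    refine sum_le_of_mem_regularize hv fun ε hε => ?_
    have hpos : ∀ᶠ y in 𝓝 T, ∀ k, 0 < y k := eventually_all.2 fun k =>
      (continuous_apply k).tendsto T |>.eventually_const_lt (hT k)
    have hcont : Tendsto (fun y : Fin K → ℝ => K * κ - ∑ k, y k / r k) (𝓝 T)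
        (𝓝 (K * κ - ∑ k, T k / r k)) := by
      have : Continuous fun y : Fin K → ℝ => K * κ - ∑ k, y k / r k := by fun_prop
      exact this.tendsto T
    filter_upwards [hpos, hcont.eventually_le_const (lt_add_of_pos_right _ hε)] with y hy hle
    have h1 := (hh y hy).sum_le
    simp only [add_div, Finset.sum_add_distrib] at h1
    simp only [one_div, inv_mul_eq_div]
    linarith
  simp only [one_div, inv_mul_eq_div] at key
  simp only [add_div, Finset.sum_add_distrib]
  linarith

lemma regularize_le_sum (hr : ∀ k, 0 < r k)
    (hh : ∀ T, (∀ k, 0 < T k) →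
      IsProportionalService κ c (fun k => T k / r k) (fun k => (h T k + T k) / r k))
    {T v : Fin K → ℝ} (hT : ∀ k, 0 < T k) (hv : v ∈ regularize h T) :
    κ * ∑ k, 1 / (T k / r k) ≤ ∑ k, (v k + T k) / r k / (T k / r k) := by
  have hcancel : ∀ (a : ℝ) (y : Fin K → ℝ) (k : Fin K), a / r k / (y k / r k) = a / y k :=
    fun a y k => div_div_div_cancel_right₀ (hr k).ne' _ _
  have key : ∑ k, (-(1 / T k)) * v k ≤ K - κ * ∑ k, 1 / (T k / r k) := by
    refine sum_le_of_mem_regularize hv fun ε hε => ?_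
    have hpos : ∀ᶠ y in 𝓝 T, ∀ k, 0 < y k := eventually_all.2 fun k =>
      (continuous_apply k).tendsto T |>.eventually_const_lt (hT k)
    -- The weights `1 / y k` of the inequality at `y` are replaced by the weights `1 / T k`.
    set U : (Fin K → ℝ) → ℝ := fun y => K - κ * ∑ k, 1 / (y k / r k) +
      ∑ k, |1 / y k - 1 / T k| * (r k + |y k|) with hU
    have hcont : Tendsto U (𝓝 T) (𝓝 (K - κ * ∑ k, 1 / (T k / r k))) := by
      have h1 : ContinuousAt U T := by
        have hy : ∀ k, ContinuousAt (fun y : Fin K → ℝ => y k) T := fun k =>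
          (continuous_apply k).continuousAt
        have e1 : ∀ k, ContinuousAt (fun y : Fin K → ℝ => 1 / (y k / r k)) T := fun k =>
          continuousAt_const.div ((hy k).div_const _) (div_pos (hT k) (hr k)).ne'
        have e2 : ∀ k, ContinuousAt (fun y : Fin K → ℝ => |1 / y k - 1 / T k| * (r k + |y k|)) T :=
          fun k => (((continuousAt_const.div (hy k) (hT k).ne').sub continuousAt_const).abs).mul
            (continuousAt_const.add (hy k).abs)
        exact (continuousAt_const.sub (continuousAt_const.mul
          (tendsto_finsetSum _ fun k _ => e1 k))).add (tendsto_finsetSum _ fun k _ => e2 k)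
      have h2 : U T = K - κ * ∑ k, 1 / (T k / r k) := by simp [hU]
      rw [← h2]
      exact h1
    filter_upwards [hpos, hcont.eventually_le_const (lt_add_of_pos_right _ hε)] with y hy hle
    refine le_trans ?_ hle
    have hs := hh y hy
    have h1 := hs.le_sum fun k => div_pos (hy k) (hr k)
    simp only [hcancel] at h1
    have h2 : ∑ k, (h y k + y k) / y k = ∑ k, h y k / y k + K := by
      have e : (K : ℝ) = ∑ _k : Fin K, (1 : ℝ) := by simp
      rw [e, ← Finset.sum_add_distrib]
      exact Finset.sum_congr rfl fun k _ => by rw [add_div, div_self (hy k).ne']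
    have h3 : ∑ k, (-(1 / T k)) * h y k ≤
        -∑ k, h y k / y k + ∑ k, |1 / y k - 1 / T k| * (r k + |y k|) := by
      rw [← Finset.sum_neg_distrib, ← Finset.sum_add_distrib]
      refine Finset.sum_le_sum fun k _ => ?_
      have e : -(1 / T k) * h y k = -(h y k / y k) + (1 / y k - 1 / T k) * h y k := by ring
      rw [e]
      have hb : |h y k| ≤ r k + |y k| := by
        have a1 := hs.nonneg k
        have a2 := hs.le_one k
        rw [div_le_one (hr k)] at a2
        have a3 := mul_nonneg a1 (hr k).le
        rw [div_mul_cancel₀ _ (hr k).ne'] at a3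
        rw [abs_of_pos (hy k), abs_le]
        have := hy k
        have := hr k
        constructor <;> linarith
      have : (1 / y k - 1 / T k) * h y k ≤ |1 / y k - 1 / T k| * (r k + |y k|) :=
        (le_abs_self _).trans (by rw [abs_mul]; gcongr)
      linarith
    simp only [hU]
    linarith
  have h2 : ∑ k, (v k + T k) / T k = -∑ k, (-(1 / T k)) * v k + K := by
    have e : (K : ℝ) = ∑ _k : Fin K, (1 : ℝ) := by simp
    rw [e, ← Finset.sum_neg_distrib, ← Finset.sum_add_distrib]
    refine Finset.sum_congr rfl fun k _ => ?_
    rw [add_div, div_self (hT k).ne']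
    ring
  simp only [hcancel]
  rw [h2]
  linarith

/-- The point with equal normalized throughputs is an equilibrium.  Otherwise a linear functional
separates `0` from the vector field near it; a small move of the marginal utilities in the direction
of that functional contradicts the lower bound for the weighted service. -/
lemma zero_mem_regularize (hκ : 0 < κ) (hr : ∀ k, 0 < r k)
    (hh : ∀ T, (∀ k, 0 < T k) →
      IsProportionalService κ c (fun k => T k / r k) (fun k => (h T k + T k) / r k)) :
    0 ∈ regularize h fun k => κ * r k := by
  refine Set.mem_iInter₂.2 fun δ hδ => ?_
  by_contra hc
  obtain ⟨f, u, hfu, hu⟩ := geometric_hahn_banach_closed_point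
    (convex_convexHull ℝ (h '' Metric.ball (fun k => κ * r k) δ)).closure isClosed_closure hc
  rw [map_zero] at hu
  set q : Fin K → ℝ := fun k => f (fun j => if k = j then 1 else 0) * r k with hq
  have hf : ∀ w : Fin K → ℝ, f w = ∑ k, q k * (w k / r k) := fun w => by
    have := (f : (Fin K → ℝ) →ₗ[ℝ] ℝ).pi_apply_eq_sum_univ w
    simp only [ContinuousLinearMap.coe_coe, smul_eq_mul] at this
    rw [this]
    refine Finset.sum_congr rfl fun k _ => ?_
    have := (hr k).ne'
    simp only [hq]
    field_simp
  set X : ℝ → Fin K → ℝ := fun s k => κ / (1 + s * q k) with hX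
  have hXlim : ∀ k, Tendsto (fun s => X s k) (𝓝[>] 0) (𝓝 κ) := fun k => by
    have h1 : ContinuousAt (fun s : ℝ => κ / (1 + s * q k)) 0 :=
      continuousAt_const.div (by fun_prop) (by simp)
    have h2 := h1.tendsto
    simp only [zero_mul, add_zero, div_one] at h2
    exact h2.mono_left nhdsWithin_le_nhds
  have hden : ∀ᶠ s in 𝓝[>] (0 : ℝ), ∀ k, 0 < 1 + s * q k := by
    refine eventually_all.2 fun k => ?_
    have h1 : Tendsto (fun s : ℝ => 1 + s * q k) (𝓝[>] 0) (𝓝 1) := by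
      have : Continuous fun s : ℝ => 1 + s * q k := by fun_prop
      simpa using (this.tendsto 0).mono_left nhdsWithin_le_nhds
    exact h1.eventually_const_lt one_pos
  have hball : ∀ᶠ s in 𝓝[>] (0 : ℝ), (fun k => X s k * r k) ∈ Metric.ball (fun k => κ * r k) δ :=
    (tendsto_pi_nhds.2 fun k => (hXlim k).mul_const (r k)).eventually (Metric.ball_mem_nhds _ hδ)
  have hev : ∀ᶠ s in 𝓝[>] (0 : ℝ), ∑ k, q k * (κ - X s k) ≤ u := by
    filter_upwards [hden, hball, self_mem_nhdsWithin] with s hs hb (hs0 : 0 < s)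
    have hXpos : ∀ k, 0 < X s k := fun k => div_pos hκ (hs k)
    have hm := (hfu _ (subset_closure (subset_convexHull ℝ _ ⟨_, hb, rfl⟩))).le
    rw [hf] at hm
    refine le_trans ?_ hm
    have hserv := hh (fun k => X s k * r k) fun k => mul_pos (hXpos k) (hr k)
    have hXr : ∀ k, X s k * r k / r k = X s k := fun k => mul_div_cancel_right₀ _ (hr k).ne'
    simp only [hXr, add_div] at hserv
    set p : Fin K → ℝ := fun k => h (fun k => X s k * r k) k / r k + X s k with hp
    have h1 : κ * ∑ k, 1 / X s k ≤ ∑ k, p k / X s k := hserv.le_sum hXpos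
    have h2 : ∑ k, p k ≤ K * κ := hserv.sum_le
    have e1 : κ * ∑ k, 1 / X s k = K + s * ∑ k, q k := by
      have e : (K : ℝ) = ∑ _k : Fin K, (1 : ℝ) := by simp
      rw [e, Finset.mul_sum, Finset.mul_sum, ← Finset.sum_add_distrib]
      refine Finset.sum_congr rfl fun k _ => ?_
      have := (hs k).ne'
      simp only [hX]
      field_simp
    have e2 : ∑ k, p k / X s k = (∑ k, p k + s * ∑ k, q k * p k) / κ := by
      rw [Finset.mul_sum, ← Finset.sum_add_distrib, Finset.sum_div]
      refine Finset.sum_congr rfl fun k _ => ?_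
      have := (hs k).ne'
      simp only [hX]
      field_simp
    rw [e1, e2, le_div_iff₀ hκ] at h1
    have h3 : s * (κ * ∑ k, q k) ≤ s * ∑ k, q k * p k := by linarith
    have h4 := le_of_mul_le_mul_left h3 hs0
    have e3 : ∑ k, q k * (κ - X s k) = κ * ∑ k, q k - ∑ k, q k * X s k := by
      rw [Finset.mul_sum, ← Finset.sum_sub_distrib]
      exact Finset.sum_congr rfl fun k _ => by ring
    have e4 : ∑ k, q k * (h (fun k => X s k * r k) k / r k) =
        ∑ k, q k * p k - ∑ k, q k * X s k := by
      rw [← Finset.sum_sub_distrib]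
      exact Finset.sum_congr rfl fun k _ => by simp only [hp]; ring
    rw [e3, e4]
    linarith
  have hlim : Tendsto (fun s => ∑ k, q k * (κ - X s k)) (𝓝[>] 0) (𝓝 0) := by
    have := tendsto_finsetSum Finset.univ fun k _ => ((hXlim k).const_sub κ).const_mul (q k)
    simpa using this
  exact absurd (le_of_tendsto hlim hev) (not_le.2 hu)

end Regularize

/-- A function whose increments are bounded by those of an absolutely continuous one is absolutely
continuous. -/
lemma absolutelyContinuousOnInterval_of_dist_le {E F : Type*} [PseudoMetricSpace E]
    [PseudoMetricSpace F] {f : ℝ → E} {g : ℝ → F} {a b C : ℝ} (hC : 0 < C)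
    (hf : AbsolutelyContinuousOnInterval f a b)
    (hfg : ∀ s ∈ Set.uIcc a b, ∀ t ∈ Set.uIcc a b, dist (g s) (g t) ≤ C * dist (f s) (f t)) :
    AbsolutelyContinuousOnInterval g a b := by
  rw [absolutelyContinuousOnInterval_iff] at hf ⊢
  intro ε hε
  obtain ⟨δ, hδ, h⟩ := hf (ε / C) (by positivity)
  refine ⟨δ, hδ, fun E hE hlt => ?_⟩
  have h1 := h E hE hlt
  rw [lt_div_iff₀ hC, mul_comm, Finset.mul_sum] at h1
  refine (Finset.sum_le_sum fun i hi => ?_).trans_lt h1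
  exact hfg _ (hE.1 i hi).1 _ (hE.1 i hi).2

/-- An absolutely continuous function with nonpositive derivative almost everywhere does not
increase. -/
lemma le_of_absolutelyContinuousOnInterval {f : ℝ → ℝ} {a b : ℝ} (hab : a ≤ b)
    (hf : AbsolutelyContinuousOnInterval f a b)
    (hd : ∀ᵐ t ∂(volume.restrict (Set.Ioc a b)), deriv f t ≤ 0) : f b ≤ f a := by
  have h1 := hf.integral_deriv_eq_sub
  rw [intervalIntegral.integral_of_le hab] at h1
  have h2 := integral_nonpos_of_ae hd
  linarith

section Solution

variable {K : ℕ} {κ c : ℝ} {r : Fin K → ℝ} {h : (Fin K → ℝ) → (Fin K → ℝ)} {φ : ℝ → Fin K → ℝ}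

lemma hasDerivAt_entropyGap (hκ : 0 < κ) {z : ℝ} (hz : 0 < z) :
    HasDerivAt (entropyGap κ) (1 / κ - 1 / z) z := by
  unfold entropyGap
  have h1 : HasDerivAt (fun z => z / κ) (1 / κ) z := (hasDerivAt_id z).div_const κ
  refine ((h1.sub_const 1).sub (h1.log (div_pos hz hκ).ne')).congr_deriv ?_
  field_simp

lemma abs_entropyGap_sub_le (hκ : 0 < κ) {m y z : ℝ} (hm : 0 < m) (hy : m ≤ y) (hz : m ≤ z) :
    |entropyGap κ y - entropyGap κ z| ≤ (1 / κ + 1 / m) * |y - z| := by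
  have aux : ∀ y z : ℝ, m ≤ y → m ≤ z →
      entropyGap κ z - entropyGap κ y ≤ (1 / κ + 1 / m) * |y - z| := by
    intro y z hy hz
    have hz0 := hm.trans_le hz
    refine (entropyGap_sub_le hκ (hm.trans_le hy) hz0).trans ?_
    refine (le_abs_self _).trans ?_
    rw [abs_mul, abs_sub_comm z y]
    gcongr
    have h1 : 1 / z ≤ 1 / m := one_div_le_one_div_of_le hm hz
    have h2 : 0 < 1 / z := by positivity
    have h3 : 0 < 1 / κ := by positivity
    rw [abs_le]; constructor <;> linarith
  rw [abs_le]
  have h1 := aux y z hy hz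
  have h2 := aux z y hz hy
  rw [abs_sub_comm z y] at h2
  constructor <;> linarith

lemma absolutelyContinuous_lyapunov (hκ : 0 < κ) (hr : ∀ k, 0 < r k) (hφ : IsSolution h φ) {b : ℝ}
    (hb : 0 ≤ b) :
    AbsolutelyContinuousOnInterval (fun t => ∑ k, entropyGap κ (φ t k / r k)) 0 b := by
  have hac := hφ.absolutelyContinuous b hb
  have hm : ∀ k, ∃ m, 0 < m ∧ ∀ t ∈ Set.uIcc 0 b, m ≤ φ t k / r k := by
    intro k
    have hc : ContinuousOn (fun t => φ t k / r k) (Set.uIcc 0 b) :=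
      ((continuous_apply k).comp_continuousOn hac.continuousOn).div_const _
    obtain ⟨t₀, ht₀, hmin⟩ := isCompact_uIcc.exists_isMinOn Set.nonempty_uIcc hc
    rw [Set.uIcc_of_le hb] at ht₀
    exact ⟨_, div_pos (hφ.pos t₀ ht₀.1 k) (hr k), fun t ht => hmin ht⟩
  choose m hm0 hm using hm
  have hterm : ∀ k, 0 < (1 / κ + 1 / m k) / r k := fun k => by
    have := hm0 k
    have := hr k
    positivity
  refine absolutelyContinuousOnInterval_of_dist_le
    (C := ∑ k, (1 / κ + 1 / m k) / r k + 1)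
    (add_pos_of_nonneg_of_pos (Finset.sum_nonneg fun k _ => (hterm k).le) one_pos) hac
    fun s hs t ht => ?_
  rw [Real.dist_eq, ← Finset.sum_sub_distrib]
  refine (Finset.abs_sum_le_sum_abs _ _).trans ?_
  have : ∑ k, |entropyGap κ (φ s k / r k) - entropyGap κ (φ t k / r k)| ≤
      ∑ k, (1 / κ + 1 / m k) / r k * dist (φ s) (φ t) := by
    refine Finset.sum_le_sum fun k _ => ?_
    refine (abs_entropyGap_sub_le hκ (hm0 k) (hm k s hs) (hm k t ht)).trans ?_
    rw [← sub_div, abs_div, abs_of_pos (hr k), mul_div_assoc', mul_div_right_comm, ← Real.dist_eq]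
    exact mul_le_mul_of_nonneg_left (dist_le_pi_dist _ _ k) (hterm k).le
  refine this.trans ?_
  rw [← Finset.sum_mul]
  gcongr
  linarith

/-- Solutions of the regularized equation converge to the point with equal normalized throughputs,
since the Lyapunov function decays exponentially. -/
lemma tendsto_of_isSolution (hκ : 0 < κ) (hr : ∀ k, 0 < r k)
    (hh : ∀ T, (∀ k, 0 < T k) →
      IsProportionalService κ c (fun k => T k / r k) (fun k => (h T k + T k) / r k))
    (hφ : IsSolution h φ) : Tendsto φ atTop (𝓝 fun k => κ * r k) := by
  set L : ℝ → ℝ := fun t => ∑ k, entropyGap κ (φ t k / r k) with hL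
  have hdecay : ∀ b, 0 ≤ b → Real.exp b * L b ≤ L 0 := by
    intro b hb
    have hexp : AbsolutelyContinuousOnInterval Real.exp 0 b :=
      Real.contDiff_exp.contDiffOn.absolutelyContinuousOnInterval
    have hac := hexp.fun_mul (absolutelyContinuous_lyapunov hκ hr hφ hb)
    have hle := le_of_absolutelyContinuousOnInterval hb hac ?_
    · simpa using hle
    · have hd := ae_restrict_of_ae_restrict_of_subset
          (show Set.Ioc 0 b ⊆ Set.Ioi 0 from fun _ ht => ht.1)
        hφ.deriv_mem
      filter_upwards [hd, ae_restrict_mem measurableSet_Ioc] with t ⟨v, hv, hder⟩ ht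
      have hpos := hφ.pos t ht.1.le
      have hx : ∀ k, 0 < φ t k / r k := fun k => div_pos (hpos k) (hr k)
      have hderk : ∀ k, HasDerivAt (fun t => entropyGap κ (φ t k / r k))
          ((1 / κ - 1 / (φ t k / r k)) * (v k / r k)) t := fun k =>
        HasDerivAt.comp t (hasDerivAt_entropyGap hκ (hx k))
          ((hasDerivAt_pi.1 hder k).div_const (r k))
      have hsum : HasDerivAt (fun t => ∑ k, entropyGap κ (φ t k / r k))
          (∑ k, (1 / κ - 1 / (φ t k / r k)) * (v k / r k)) t :=
        HasDerivAt.fun_sum fun k _ => hderk k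
      rw [((Real.hasDerivAt_exp t).fun_mul hsum).deriv]
      have hdrift := sum_drift_le hκ hx (p := fun k => (v k + φ t k) / r k)
        (regularize_sum_le hh hpos hv) (regularize_le_sum hr hh hpos hv)
      have e : ∀ k, (v k + φ t k) / r k - φ t k / r k = v k / r k := fun k => by ring
      simp only [e] at hdrift
      rw [← mul_add]
      exact mul_nonpos_of_nonneg_of_nonpos (Real.exp_pos t).le (by linarith)
  have hL0 : Tendsto (fun t => Real.exp (-t) * L 0) atTop (𝓝 0) := by
    simpa using Real.tendsto_exp_neg_atTop_nhds_zero.mul_const (L 0)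
  refine tendsto_pi_nhds.2 fun k => ?_
  have hsq : Tendsto (fun t => (√(φ t k / r k / κ) - 1) ^ 2) atTop (𝓝 0) := by
    refine squeeze_zero' (Eventually.of_forall fun t => sq_nonneg _) ?_ hL0
    filter_upwards [eventually_ge_atTop 0] with t ht
    have hx : ∀ k, 0 < φ t k / r k := fun k => div_pos (hφ.pos t ht k) (hr k)
    have h1 : entropyGap κ (φ t k / r k) ≤ L t :=
      Finset.single_le_sum (f := fun k => entropyGap κ (φ t k / r k))
        (fun k _ => entropyGap_nonneg hκ (hx k)) (Finset.mem_univ k)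
    refine (sq_le_entropyGap hκ (hx k)).trans (h1.trans ?_)
    have h2 := mul_le_mul_of_nonneg_left (hdecay t ht) (Real.exp_pos (-t)).le
    rwa [← mul_assoc, ← Real.exp_add, neg_add_cancel, Real.exp_zero, one_mul] at h2
  have habs : Tendsto (fun t => √(φ t k / r k / κ) - 1) atTop (𝓝 0) := by
    rw [tendsto_zero_iff_abs_tendsto_zero]
    have := (Real.continuous_sqrt.tendsto 0).comp hsq
    simpa [Function.comp_def, Real.sqrt_sq_eq_abs] using this
  have h3 := (((habs.add_const 1).pow 2).const_mul (κ * r k))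
  simp only [zero_add, one_pow, mul_one, sub_add_cancel] at h3
  refine h3.congr' ?_
  filter_upwards [eventually_ge_atTop 0] with t ht
  have h4 : 0 < φ t k / r k / κ := div_pos (div_pos (hφ.pos t ht k) (hr k)) hκ
  rw [Real.sq_sqrt h4.le]
  have := (hr k).ne'
  field_simp

end Solution

/-! ### Convergence of the centred noise -/

section Noise

variable {Ω E V : Type*} [MeasurableSpace E] [MeasurableSpace V]

/-- A function of a past variable `Z` and a fresh variable `W`, centred by integrating out `W`, is
orthogonal to every bounded past variable `U`. -/
lemma integral_mul_centered {m mΩ : MeasurableSpace Ω} {P : Measure Ω} [IsProbabilityMeasure P]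
    (hm : m ≤ mΩ) {Z : Ω → E} {W : Ω → V} {U : Ω → ℝ} {F : E → V → ℝ} {C D : ℝ}
    (hZ : Measurable[m] Z) (hU : Measurable[m] U) (hW : Measurable W)
    (hind : Indep m (MeasurableSpace.comap W inferInstance) P)
    (hF : Measurable (Function.uncurry F)) (hFC : ∀ z v, |F z v| ≤ C) (hUD : ∀ ω, |U ω| ≤ D) :
    ∫ ω, U ω * (F (Z ω) (W ω) - ∫ v, F (Z ω) v ∂(P.map W)) ∂P = 0 := by
  have hZ' : Measurable Z := hZ.mono hm le_rfl
  have hU' : Measurable U := hU.mono hm le_rfl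
  have : IsProbabilityMeasure (P.map W) := Measure.isProbabilityMeasure_map hW.aemeasurable
  have hpair : Measurable fun ω => (Z ω, U ω) := hZ'.prodMk hU'
  have : IsProbabilityMeasure (P.map fun ω => (Z ω, U ω)) :=
    Measure.isProbabilityMeasure_map hpair.aemeasurable
  have hG : Measurable fun z => ∫ v, F z v ∂(P.map W) :=
    (hF.stronglyMeasurable.integral_prod_right' (ν := P.map W)).measurable
  have hGC : ∀ z, |∫ v, F z v ∂(P.map W)| ≤ C := fun z => by
    have := norm_integral_le_of_norm_le_const (μ := P.map W) (f := F z) (C := C)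
      (Eventually.of_forall fun v => hFC z v)
    simpa using this
  have hFZ : Measurable fun ω => F (Z ω) (W ω) :=
    Measurable.comp (f := fun ω => (Z ω, W ω)) hF (hZ'.prodMk hW)
  have hbound : ∀ (u f : ℝ), |u| ≤ D → |f| ≤ C → ‖u * f‖ ≤ D * C := fun u f hu hf => by
    rw [norm_mul]
    exact mul_le_mul hu hf (norm_nonneg _) ((abs_nonneg _).trans hu)
  have hi1 : Integrable (fun ω => U ω * F (Z ω) (W ω)) P :=
    Integrable.of_bound (hU'.mul hFZ).aestronglyMeasurable (D * C)
      (Eventually.of_forall fun ω => hbound _ _ (hUD ω) (hFC _ _))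
  have hi2 : Integrable (fun ω => U ω * ∫ v, F (Z ω) v ∂(P.map W)) P :=
    Integrable.of_bound (hU'.mul (hG.comp hZ')).aestronglyMeasurable (D * C)
      (Eventually.of_forall fun ω => hbound _ _ (hUD ω) (hGC _))
  have hindep : IndepFun (fun ω => (Z ω, U ω)) W P := by
    rw [IndepFun_iff_Indep]
    refine indep_of_indep_of_le_left hind ?_
    exact (Measurable.prodMk (m := m) hZ hU).comap_le
  have hmap := (indepFun_iff_map_prod_eq_prod_map_map hpair.aemeasurable hW.aemeasurable).1 hindep
  have hg : Measurable fun q : (E × ℝ) × V => q.1.2 * F q.1.1 q.2 :=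
    (measurable_snd.comp measurable_fst).mul
      (Measurable.comp (f := fun q : (E × ℝ) × V => (q.1.1, q.2)) hF (by fun_prop))
  have htriple : Measurable fun ω => ((Z ω, U ω), W ω) := hpair.prodMk hW
  have hi3 : Integrable (fun q : (E × ℝ) × V => q.1.2 * F q.1.1 q.2)
      ((P.map fun ω => (Z ω, U ω)).prod (P.map W)) := by
    rw [← hmap, integrable_map_measure hg.aestronglyMeasurable htriple.aemeasurable]
    exact hi1
  have e1 : ∫ ω, U ω * F (Z ω) (W ω) ∂P = ∫ ω, U ω * ∫ v, F (Z ω) v ∂(P.map W) ∂P := by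
    calc ∫ ω, U ω * F (Z ω) (W ω) ∂P
        = ∫ q : (E × ℝ) × V, q.1.2 * F q.1.1 q.2 ∂(P.map fun ω => ((Z ω, U ω), W ω)) :=
          (integral_map htriple.aemeasurable hg.aestronglyMeasurable).symm
      _ = ∫ q : E × ℝ, ∫ v, q.2 * F q.1 v ∂(P.map W) ∂(P.map fun ω => (Z ω, U ω)) := by
          rw [hmap, integral_prod _ hi3]
      _ = ∫ q : E × ℝ, q.2 * ∫ v, F q.1 v ∂(P.map W) ∂(P.map fun ω => (Z ω, U ω)) := by
          simp_rw [integral_const_mul]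
      _ = _ := integral_map hpair.aemeasurable
          (measurable_snd.mul (hG.comp measurable_fst)).aestronglyMeasurable
  simp_rw [mul_sub]
  rw [integral_sub hi1 hi2, e1, sub_self]

/-- A series of weighted centred noise terms with summable second moments converges almost surely,
as an `L²`-bounded martingale. -/
theorem ae_exists_tendsto_noise {mΩ : MeasurableSpace Ω} {P : Measure Ω} [IsProbabilityMeasure P]
    (ℱ : Filtration ℕ mΩ) {Z : ℕ → Ω → E} {W : ℕ → Ω → V} {F : ℕ → E → V → ℝ} {C a : ℕ → ℝ} {B : ℝ}
    (hZ : ∀ n, Measurable[ℱ n] (Z n)) (hW : ∀ n, Measurable[ℱ (n + 1)] (W n))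
    (hind : ∀ n, Indep (ℱ n) (MeasurableSpace.comap (W n) inferInstance) P)
    (hF : ∀ n, Measurable (Function.uncurry (F n))) (hFC : ∀ n z v, |F n z v| ≤ C n)
    (hB : ∀ n, ∑ i ∈ Finset.range n, a i ^ 2 * ∫ ω, F i (Z i ω) (W i ω) ^ 2 ∂P ≤ B) :
    ∀ᵐ ω ∂P, ∃ s, Tendsto (fun n => ∑ i ∈ Finset.range n,
      a i * (F i (Z i ω) (W i ω) - ∫ v, F i (Z i ω) v ∂(P.map (W i)))) atTop (𝓝 s) := by
  have hW' : ∀ n, Measurable (W n) := fun n => (hW n).mono (ℱ.le _) le_rfl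
  set G : ℕ → E → ℝ := fun n z => ∫ v, F n z v ∂(P.map (W n)) with hG
  set ξ : ℕ → Ω → ℝ := fun n ω => F n (Z n ω) (W n ω) - G n (Z n ω) with hξ
  set S : ℕ → Ω → ℝ := fun n ω => ∑ i ∈ Finset.range n, a i * ξ i ω with hS
  have hprob : ∀ n, IsProbabilityMeasure (P.map (W n)) := fun n =>
    Measure.isProbabilityMeasure_map (hW' n).aemeasurable
  have hGm : ∀ n, Measurable (G n) := fun n =>
    ((hF n).stronglyMeasurable.integral_prod_right' (ν := P.map (W n))).measurable
  have hGC : ∀ n z, |G n z| ≤ C n := fun n z => by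
    have := norm_integral_le_of_norm_le_const (μ := P.map (W n)) (f := F n z) (C := C n)
      (Eventually.of_forall fun v => hFC n z v)
    simpa using this
  have hZs : ∀ n, Measurable[ℱ (n + 1)] (Z n) := fun n =>
    (hZ n).mono (ℱ.mono (Nat.le_succ n)) le_rfl
  have hFZ : ∀ n, Measurable[ℱ (n + 1)] fun ω => F n (Z n ω) (W n ω) := fun n =>
    (hF n).comp (Measurable.prodMk (m := ℱ (n + 1)) (hZs n) (hW n))
  have hξm : ∀ n, Measurable[ℱ (n + 1)] (ξ n) := fun n =>
    Measurable.sub (m := ℱ (n + 1)) (hFZ n) ((hGm n).comp (hZs n))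
  have hξC : ∀ n ω, |ξ n ω| ≤ 2 * C n := fun n ω => by
    have h1 := hFC n (Z n ω) (W n ω)
    have h2 := hGC n (Z n ω)
    rw [abs_le] at h1 h2 ⊢
    simp only [hξ]
    constructor <;> linarith
  have hSm : ∀ n, Measurable[ℱ n] (S n) := fun n => by
    refine Finset.measurable_sum (m := ℱ n) _ fun i hi => ?_
    refine Measurable.const_mul (m := ℱ n) ?_ _
    exact (hξm i).mono (ℱ.mono (Finset.mem_range.1 hi)) le_rfl
  have hSm' : ∀ n, Measurable (S n) := fun n => (hSm n).mono (ℱ.le n) le_rfl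
  have hξm' : ∀ n, Measurable (ξ n) := fun n => (hξm n).mono (ℱ.le _) le_rfl
  have hSD : ∀ n ω, |S n ω| ≤ ∑ i ∈ Finset.range n, |a i| * (2 * C i) := fun n ω =>
    (Finset.abs_sum_le_sum_abs _ _).trans (Finset.sum_le_sum fun i _ => by
      rw [abs_mul]
      exact mul_le_mul_of_nonneg_left (hξC i ω) (abs_nonneg _))
  have hSi : ∀ n, Integrable (S n) P := fun n =>
    Integrable.of_bound (hSm' n).aestronglyMeasurable _ (Eventually.of_forall (hSD n))
  have hξi : ∀ n, Integrable (ξ n) P := fun n =>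
    Integrable.of_bound (hξm' n).aestronglyMeasurable _ (Eventually.of_forall (hξC n))
  have horth : ∀ n (U : Ω → ℝ) (D : ℝ), Measurable[ℱ n] U → (∀ ω, |U ω| ≤ D) →
      ∫ ω, U ω * ξ n ω ∂P = 0 := fun n U D hU hUD =>
    integral_mul_centered (ℱ.le n) (hZ n) hU (hW' n) (hind n) (hF n) (hFC n) hUD
  have hSsucc : ∀ n ω, S (n + 1) ω = S n ω + a n * ξ n ω := fun n ω => by
    simp only [hS, Finset.sum_range_succ]
  have hmart : Martingale S ℱ P := by
    refine martingale_nat (fun n => (hSm n).stronglyMeasurable) hSi fun n => ?_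
    refine ae_eq_condExp_of_forall_setIntegral_eq (ℱ.le n) (hSi (n + 1))
      (fun s _ _ => (hSi n).integrableOn) (fun s hs _ => ?_) (hSm n).aestronglyMeasurable
    simp_rw [hSsucc]
    rw [integral_add (hSi n).integrableOn ((hξi n).const_mul _).integrableOn, integral_const_mul]
    have h1 := horth n (s.indicator fun _ => 1) 1
      (Measurable.indicator (m := ℱ n) measurable_const hs) fun ω => by
        by_cases h : ω ∈ s <;> simp [h]
    have h2 : ∀ ω, s.indicator (fun _ => (1 : ℝ)) ω * ξ n ω = s.indicator (ξ n) ω := fun ω => by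
      by_cases h : ω ∈ s <;> simp [h]
    simp_rw [h2] at h1
    rw [integral_indicator (ℱ.le n _ hs)] at h1
    rw [h1, mul_zero, add_zero]
  have hsq : ∀ (f : Ω → ℝ) (D : ℝ), Measurable f → (∀ ω, |f ω| ≤ D) →
      Integrable (fun ω => f ω ^ 2) P := fun f D hf hD =>
    Integrable.of_bound (hf.pow_const 2).aestronglyMeasurable (D ^ 2)
      (Eventually.of_forall fun ω => by
        rw [Real.norm_of_nonneg (sq_nonneg _), ← sq_abs]
        exact pow_le_pow_left₀ (abs_nonneg _) (hD ω) 2)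
  have hvar : ∀ n, ∫ ω, ξ n ω ^ 2 ∂P ≤ ∫ ω, F n (Z n ω) (W n ω) ^ 2 ∂P := fun n => by
    have h1 := horth n (fun ω => G n (Z n ω)) (C n) ((hGm n).comp (hZ n)) fun ω => hGC n _
    have hGZm : Measurable fun ω => G n (Z n ω) := (hGm n).comp ((hZ n).mono (ℱ.le n) le_rfl)
    have h2 : ∀ ω, ξ n ω ^ 2 = F n (Z n ω) (W n ω) ^ 2 - G n (Z n ω) ^ 2 -
        2 * (G n (Z n ω) * ξ n ω) := fun ω => by simp only [hξ]; ring
    have hi1 := hsq _ (C n) ((hFZ n).mono (ℱ.le _) le_rfl) fun ω => hFC n (Z n ω) (W n ω)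
    have hi2 := hsq _ (C n) hGZm fun ω => hGC n (Z n ω)
    have hi3 : Integrable (fun ω => G n (Z n ω) * ξ n ω) P :=
      (hξi n).bdd_mul hGZm.aestronglyMeasurable (Eventually.of_forall fun ω => hGC n (Z n ω))
    have hi4 : Integrable (fun ω => F n (Z n ω) (W n ω) ^ 2 - G n (Z n ω) ^ 2) P := hi1.sub hi2
    simp_rw [h2]
    rw [integral_sub hi4 (hi3.const_mul 2), integral_sub hi1 hi2, integral_const_mul, h1]
    have : 0 ≤ ∫ ω, G n (Z n ω) ^ 2 ∂P := integral_nonneg fun ω => sq_nonneg _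
    linarith
  have hS2 : ∀ n, ∫ ω, S n ω ^ 2 ∂P ≤
      ∑ i ∈ Finset.range n, a i ^ 2 * ∫ ω, F i (Z i ω) (W i ω) ^ 2 ∂P := by
    intro n
    induction n with
    | zero => simp [hS]
    | succ n ih =>
      have h2 : ∀ ω, S (n + 1) ω ^ 2 = S n ω ^ 2 + 2 * a n * (S n ω * ξ n ω) +
          a n ^ 2 * ξ n ω ^ 2 := fun ω => by rw [hSsucc]; ring
      have hi1 := hsq _ _ (hSm' n) (hSD n)
      have hi2 := hsq _ _ (hξm' n) (hξC n)
      have hi3 : Integrable (fun ω => S n ω * ξ n ω) P :=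
        (hξi n).bdd_mul (hSm' n).aestronglyMeasurable (Eventually.of_forall (hSD n))
      have hi4 : Integrable (fun ω => S n ω ^ 2 + 2 * a n * (S n ω * ξ n ω)) P :=
        hi1.add (hi3.const_mul _)
      simp_rw [h2]
      rw [integral_add hi4 (hi2.const_mul _),
        integral_add hi1 (hi3.const_mul _), integral_const_mul, integral_const_mul,
        horth n (S n) _ (hSm n) (hSD n), Finset.sum_range_succ]
      have := mul_le_mul_of_nonneg_left (hvar n) (sq_nonneg (a n))
      linarith
  refine hmart.submartingale.exists_ae_tendsto_of_bdd (R := Real.toNNReal (1 + B)) fun n => ?_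
  rw [eLpNorm_one_eq_lintegral_enorm, ← ofReal_integral_norm_eq_lintegral_enorm (hSi n)]
  refine ENNReal.ofReal_le_ofReal ?_
  calc ∫ ω, ‖S n ω‖ ∂P ≤ ∫ ω, 1 + S n ω ^ 2 ∂P := by
        refine integral_mono (hSi n).norm
          ((integrable_const _).add (hsq _ _ (hSm' n) (hSD n))) fun ω => ?_
        simp only [Real.norm_eq_abs]
        nlinarith [sq_abs (S n ω), sq_nonneg (|S n ω| - 1)]
    _ = 1 + ∫ ω, S n ω ^ 2 ∂P := by
        rw [integral_add (integrable_const _) (hsq _ _ (hSm' n) (hSD n))]; simp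
    _ ≤ 1 + B := by linarith [hS2 n, hB n]

end Noise

/-! ### Almost sure convergence of the throughputs -/

namespace Rule

variable {K : ℕ} {β : ℝ} {ν : Measure ℝ} {r : Fin K → ℝ}

open Classical in
/-- The data transmitted to user `k`, counted only if its rate in the slot is at most `n`. -/
def truncatedService (A : Rule β ν r) (k : Fin K) (n : ℕ) (T R : Fin K → ℝ) : ℝ :=
  if R k ∈ Set.Icc (0 : ℝ) n then A.transmitted T R k else 0

lemma measurable_truncatedService [SFinite ν] (hK : 0 < K) (hr : ∀ k, 0 < r k) (A : Rule β ν r)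
    (k : Fin K) (n : ℕ) : Measurable (Function.uncurry (A.truncatedService k n)) := by
  have hs : MeasurableSet {p : (Fin K → ℝ) × (Fin K → ℝ) | p.2 k ∈ Set.Icc (0 : ℝ) n} :=
    ((measurable_pi_apply k).comp measurable_snd) measurableSet_Icc
  exact Measurable.ite hs (A.measurable_transmitted hK hr k) measurable_const

lemma truncatedService_nonneg (hK : 0 < K) (hβ1 : β < 1) (hr : ∀ k, 0 < r k) (A : Rule β ν r)
    (k : Fin K) (n : ℕ) (T R : Fin K → ℝ) : 0 ≤ A.truncatedService k n T R := by
  unfold truncatedService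
  split_ifs with h
  · exact A.transmitted_nonneg hK hβ1 hr T h.1
  · exact le_rfl

lemma abs_truncatedService_le (hK : 0 < K) (hβ : 0 < β) (hβ1 : β < 1) (hr : ∀ k, 0 < r k)
    (A : Rule β ν r) (k : Fin K) (n : ℕ) (T R : Fin K → ℝ) :
    |A.truncatedService k n T R| ≤ n := by
  rw [abs_of_nonneg (A.truncatedService_nonneg hK hβ1 hr k n T R)]
  unfold truncatedService
  split_ifs with h
  · exact (A.transmitted_le hβ T h.1).trans h.2
  · positivity

lemma truncatedService_sq_le (hK : 0 < K) (hβ : 0 < β) (hβ1 : β < 1) (hr : ∀ k, 0 < r k)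
    (A : Rule β ν r) (k : Fin K) (n : ℕ) (T R : Fin K → ℝ) :
    A.truncatedService k n T R ^ 2 ≤ Set.indicator (Set.Ioc (-(n : ℝ)) n) id (R k) ^ 2 := by
  by_cases h : R k ∈ Set.Icc (0 : ℝ) n
  · have h0 := A.transmitted_nonneg hK hβ1 hr T h.1
    have h1 := A.transmitted_le hβ T h.1
    rw [truncatedService, if_pos h]
    rcases h.1.eq_or_lt with he | hlt
    · rw [← he] at h1
      rw [le_antisymm h1 h0]
      simpa using sq_nonneg _
    · have hm : R k ∈ Set.Ioc (-(n : ℝ)) n :=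
        ⟨by have := hlt.trans_le h.2; linarith, h.2⟩
      rw [Set.indicator_of_mem hm]
      exact pow_le_pow_left₀ h0 h1 2
  · rw [truncatedService, if_neg h]
    simpa using sq_nonneg _

open Classical in
/-- The bias caused by truncation, uniformly in the throughput vector. -/
lemma abs_integral_truncatedService_sub_le [IsProbabilityMeasure ν] (hK : 0 < K) (hβ : 0 < β)
    (hβ1 : β < 1) (hν : ∀ᵐ x ∂ν, 0 ≤ x) (hi : Integrable (fun x : ℝ => x) ν) (hr : ∀ k, 0 < r k)
    (A : Rule β ν r) (k : Fin K) (n : ℕ) (T : Fin K → ℝ) :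
    |∫ R, A.truncatedService k n T R ∂(Measure.pi (rateLaw ν r)) - A.meanService T k| ≤
      ∫ R : Fin K → ℝ, (if R k ∈ Set.Icc (0 : ℝ) n then 0 else R k) ∂(Measure.pi (rateLaw ν r)) := by
  have hs : MeasurableSet {R : Fin K → ℝ | R k ∈ Set.Icc (0 : ℝ) n} :=
    (measurable_pi_apply k) measurableSet_Icc
  have hi1 : Integrable (A.truncatedService k n T) (Measure.pi (rateLaw ν r)) :=
    Integrable.of_bound (Measurable.comp (f := fun R : Fin K → ℝ => (T, R))
      (A.measurable_truncatedService hK hr k n) (by fun_prop)).aestronglyMeasurable n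
      (Eventually.of_forall fun R => A.abs_truncatedService_le hK hβ hβ1 hr k n T R)
  have hi2 := A.integrable_transmitted hK hβ hβ1 hν hi hr T k
  have hi3 : Integrable (fun R : Fin K → ℝ => if R k ∈ Set.Icc (0 : ℝ) n then 0 else R k)
      (Measure.pi (rateLaw ν r)) := by
    refine (integrable_rate hr hi k).mono
      (Measurable.ite hs measurable_const (measurable_pi_apply k)).aestronglyMeasurable
      (Eventually.of_forall fun R => ?_)
    split_ifs <;> simp
  rw [meanService, ← integral_sub hi1 hi2]
  refine (abs_integral_le_integral_abs).trans (integral_mono_ae (hi1.sub hi2).abs hi3 ?_)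
  filter_upwards [ae_rates_nonneg hν hr] with R hR
  simp only [truncatedService]
  split_ifs with h
  · simp
  · rw [zero_sub, abs_neg, abs_of_nonneg (A.transmitted_nonneg hK hβ1 hr T (hR k))]
    exact A.transmitted_le hβ T (hR k)

lemma throughput_nonneg (hK : 0 < K) (hβ1 : β < 1) (hr : ∀ k, 0 < r k) (A : Rule β ν r)
    {R : ℕ → Fin K → ℝ} (hR : ∀ n k, 0 ≤ R n k) (n₀ : ℕ) {τ : Fin K → ℝ} (hτ : ∀ k, 0 ≤ τ k)
    (n : ℕ) (k : Fin K) : 0 ≤ A.throughput R n₀ τ n k := by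
  induction n generalizing k with
  | zero => exact hτ k
  | succ n ih =>
    rw [throughput]
    split_ifs
    · exact hτ k
    · have h1 := ih k
      have h2 := A.transmitted_nonneg hK hβ1 hr (A.throughput R n₀ τ n) (hR n k)
      positivity

end Rule

open Classical in
lemma tendsto_integral_rate_tail {K : ℕ} {ν : Measure ℝ} [IsProbabilityMeasure ν] {r : Fin K → ℝ}
    (hν : ∀ᵐ x ∂ν, 0 ≤ x) (hi : Integrable (fun x : ℝ => x) ν) (hr : ∀ k, 0 < r k) (k : Fin K) :
    Tendsto (fun n : ℕ => ∫ R : Fin K → ℝ, (if R k ∈ Set.Icc (0 : ℝ) n then 0 else R k)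
      ∂(Measure.pi (rateLaw ν r))) atTop (𝓝 0) := by
  have hs : ∀ n : ℕ, MeasurableSet {R : Fin K → ℝ | R k ∈ Set.Icc (0 : ℝ) n} := fun n =>
    (measurable_pi_apply k) measurableSet_Icc
  have := tendsto_integral_of_dominated_convergence (μ := Measure.pi (rateLaw ν r))
    (F := fun n : ℕ => fun R : Fin K → ℝ => if R k ∈ Set.Icc (0 : ℝ) n then 0 else R k)
    (f := fun _ => 0) (fun R => |R k|)
    (fun n => (Measurable.ite (hs n) measurable_const (measurable_pi_apply k)).aestronglyMeasurable)
    (integrable_rate hr hi k).abs (fun n => Eventually.of_forall fun R => ?_) ?_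
  · simpa using this
  · split_ifs <;> simp
  · filter_upwards [ae_rates_nonneg hν hr] with R hR
    refine tendsto_const_nhds.congr' ?_
    filter_upwards [eventually_ge_atTop ⌈R k⌉₊] with n hn
    rw [if_pos]
    exact ⟨hR k, (Nat.le_ceil _).trans (by exact_mod_cast hn)⟩

section AlmostSure

variable {K : ℕ} {β : ℝ} {ν : Measure ℝ} {r : Fin K → ℝ}
  {Ω : Type*} [mΩ : MeasurableSpace Ω] {P : Measure Ω}
  {R : ℕ → Fin K → Ω → ℝ}

/-- The σ-algebras generated by the rates of the first `n` slots. -/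
def ratePast (hRm : ∀ n k, Measurable (R n k)) : Filtration ℕ mΩ where
  seq n := ⨆ p ∈ {p : ℕ × Fin K | p.1 < n}, MeasurableSpace.comap (R p.1 p.2) inferInstance
  mono' _ _ hij := biSup_mono fun _ hp => lt_of_lt_of_le hp hij
  le' _ := iSup₂_le fun p _ => (hRm p.1 p.2).comap_le

lemma measurable_rate_ratePast (hRm : ∀ n k, Measurable (R n k)) {n m : ℕ} (h : n < m)
    (k : Fin K) : Measurable[ratePast hRm m] (R n k) := by
  refine measurable_iff_comap_le.2 ?_
  exact le_iSup₂_of_le (f := fun (p : ℕ × Fin K) (_ : p ∈ {p : ℕ × Fin K | p.1 < m}) =>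
    MeasurableSpace.comap (R p.1 p.2) inferInstance) (n, k) h le_rfl

lemma measurable_throughput [SFinite ν] (hK : 0 < K) (hr : ∀ k, 0 < r k) (A : Rule β ν r)
    (hRm : ∀ n k, Measurable (R n k)) (n₀ : ℕ) (τ : Fin K → ℝ) (n : ℕ) :
    Measurable[ratePast hRm n] fun ω => A.throughput (fun n k => R n k ω) n₀ τ n := by
  induction n with
  | zero => exact measurable_const
  | succ n ih =>
    simp only [Rule.throughput]
    split_ifs with h
    · exact measurable_const
    · have h1 := ih.mono ((ratePast hRm).mono (Nat.le_succ n)) le_rfl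
      have hR : Measurable[ratePast hRm (n + 1)] fun ω k => R n k ω :=
        @measurable_pi_lambda _ _ _ (ratePast hRm (n + 1)) _ _ fun k =>
          measurable_rate_ratePast hRm (Nat.lt_succ_self n) k
      refine @measurable_pi_lambda _ _ _ (ratePast hRm (n + 1)) _ _ fun k => ?_
      refine Measurable.add (m := ratePast hRm (n + 1)) ?_ ?_
      · exact Measurable.const_mul (m := ratePast hRm (n + 1)) ((measurable_pi_apply k).comp h1) _
      · refine Measurable.const_mul (m := ratePast hRm (n + 1)) ?_ _
        exact Measurable.comp (g := fun p : (Fin K → ℝ) × (Fin K → ℝ) => A.transmitted p.1 p.2 k)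
          (f := fun ω => (A.throughput (fun n k => R n k ω) n₀ τ n, fun k => R n k ω))
          (A.measurable_transmitted hK hr k) (Measurable.prodMk (m := ratePast hRm (n + 1)) h1 hR)

lemma indep_ratePast (hRm : ∀ n k, Measurable (R n k))
    (hind : iIndepFun (fun p : ℕ × Fin K => R p.1 p.2) P) (n : ℕ) :
    Indep (ratePast hRm n) (MeasurableSpace.comap (fun ω k => R n k ω) inferInstance) P := by
  have h := indep_iSup_of_disjoint (m := fun p : ℕ × Fin K =>
    MeasurableSpace.comap (R p.1 p.2) inferInstance) (fun p => (hRm p.1 p.2).comap_le) hind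
    (S := {p | p.1 < n}) (T := {p | p.1 = n})
    (Set.disjoint_left.2 fun p (h1 : p.1 < n) (h2 : p.1 = n) => by omega)
  refine indep_of_indep_of_le_right h ?_
  refine Measurable.comap_le (m₁ := ⨆ p ∈ {p : ℕ × Fin K | p.1 = n},
    MeasurableSpace.comap (R p.1 p.2) inferInstance)
    (@measurable_pi_lambda _ _ _ (⨆ p ∈ {p : ℕ × Fin K | p.1 = n},
      MeasurableSpace.comap (R p.1 p.2) inferInstance) _ _ fun k => ?_)
  refine measurable_iff_comap_le.2 ?_
  exact le_iSup₂_of_le (f := fun (p : ℕ × Fin K) (_ : p ∈ {p : ℕ × Fin K | p.1 = n}) =>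
    MeasurableSpace.comap (R p.1 p.2) inferInstance) (n, k) rfl le_rfl

lemma map_rates_eq_pi [IsProbabilityMeasure P] (hlaw : ∀ n k, HasLaw (R n k) (rateLaw ν r k) P)
    (hind : iIndepFun (fun p : ℕ × Fin K => R p.1 p.2) P) (n : ℕ) :
    P.map (fun ω k => R n k ω) = Measure.pi (rateLaw ν r) := by
  have h : iIndepFun (fun k : Fin K => R n k) P :=
    iIndepFun.precomp (g := fun k : Fin K => (n, k)) (fun _ _ h => (Prod.mk.inj h).2) hind
  rw [(iIndepFun_iff_map_fun_eq_pi_map fun k => (hlaw n k).aemeasurable).1 h]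
  congr 1
  ext1 k
  exact (hlaw n k).map_eq

/-- Almost sure convergence for rates that are measurable and nonnegative everywhere.  Truncating the
rate of slot `n + 1` at `n` changes only finitely many slots, leaves a bias that tends to zero, and
makes the second moments of the noise, weighted with the squared step sizes, summable. -/
lemma ae_tendsto_throughput_of_measurable [IsProbabilityMeasure ν] [IsProbabilityMeasure P]
    (hK : 0 < K) (hβ : 0 < β) (hβ1 : β < 1)
    (hν : ∀ᵐ x ∂ν, 0 ≤ x) (hi : Integrable (fun x : ℝ => x) ν) (hmean : ∫ x, x ∂ν = 1)
    (hr : ∀ k, 0 < r k) (A : Rule β ν r) (hRm : ∀ n k, Measurable (R n k))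
    (hR0 : ∀ n k ω, 0 ≤ R n k ω) (hlaw : ∀ n k, HasLaw (R n k) (rateLaw ν r k) P)
    (hind : iIndepFun (fun p : ℕ × Fin K => R p.1 p.2) P) (n₀ : ℕ) {τ : Fin K → ℝ}
    (hτ : ∀ k, 0 ≤ τ k) :
    ∀ᵐ ω ∂P, Tendsto (A.throughput (fun n k => R n k ω) n₀ τ) atTop
      (𝓝 fun k => symmetricValue K β ν / K * r k) := by
  classical
  set κ := symmetricValue K β ν / K with hκ
  have hκpos : 0 < κ := div_pos (symmetricValue_pos hβ hβ1 hν hi hmean hK) (by exact_mod_cast hK)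
  have hcpos : 0 < (1 - β) * ∫ x in stopAtOnce β ν, x ∂ν :=
    mul_pos (by linarith) (integral_stopAtOnce_pos hβ hβ1 hν hi hmean)
  set T : ℕ → Ω → Fin K → ℝ := fun n ω => A.throughput (fun n k => R n k ω) n₀ τ n with hT
  have hT0 : ∀ n ω k, 0 ≤ T n ω k := fun n ω k =>
    A.throughput_nonneg hK hβ1 hr (fun n k => hR0 n k ω) n₀ hτ n k
  have hmap := map_rates_eq_pi hlaw hind
  have hRint : ∀ k, Integrable (R 0 k) P := fun k => by
    have h1 := integrable_rate (ν := ν) hr hi k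
    rw [← hmap 0, integrable_map_measure (measurable_pi_apply k).aestronglyMeasurable
      (measurable_pi_lambda _ fun k => hRm 0 k).aemeasurable] at h1
    exact h1
  have hident : ∀ n k, IdentDistrib (R n k) (R 0 k) P P := fun n k =>
    ⟨(hRm n k).aemeasurable, (hRm 0 k).aemeasurable, by
      rw [(hlaw n k).map_eq, (hlaw 0 k).map_eq]⟩
  have hnoise : ∀ k, ∀ᵐ ω ∂P, ∃ s, Tendsto (fun n => ∑ i ∈ Finset.range n,
      1 / ((i : ℝ) + 1) * (A.truncatedService k i (T i ω) (fun k => R i k ω) -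
        ∫ v, A.truncatedService k i (T i ω) v ∂(P.map fun ω k => R i k ω))) atTop (𝓝 s) := by
    intro k
    refine ae_exists_tendsto_noise (ratePast hRm) (Z := T) (W := fun i ω k => R i k ω)
      (F := A.truncatedService k) (C := fun n => n) (a := fun i => 1 / ((i : ℝ) + 1))
      (B := 2 * ∫ ω, R 0 k ω ∂P) (measurable_throughput hK hr A hRm n₀ τ)
      (fun n => @measurable_pi_lambda _ _ _ (ratePast hRm (n + 1)) _ _ fun k =>
        measurable_rate_ratePast hRm (Nat.lt_succ_self n) k)
      (indep_ratePast hRm hind) (A.measurable_truncatedService hK hr k)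
      (A.abs_truncatedService_le hK hβ hβ1 hr k) fun n => ?_
    have hvar := @sum_variance_truncation_le Ω (@MeasureSpace.mk Ω mΩ P) ‹_› (R 0 k) (hRint k)
      (fun ω => hR0 0 k ω) n
    refine le_trans (Finset.sum_le_sum fun i _ => ?_) hvar
    have hid := ((hident i k).truncation (A := (i : ℝ))).sq.integral_eq
    have h1 : ∫ ω, A.truncatedService k i (T i ω) (fun k => R i k ω) ^ 2 ∂P ≤
        ∫ ω, (truncation (R 0 k) i ^ 2) ω ∂P := by
      have e : ∫ ω, (truncation (R 0 k) i ^ 2) ω ∂P = ∫ ω, truncation (R i k) i ω ^ 2 ∂P := by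
        simpa using hid.symm
      rw [e]
      refine integral_mono_of_nonneg (Eventually.of_forall fun ω => sq_nonneg _) ?_
        (Eventually.of_forall fun ω =>
          A.truncatedService_sq_le hK hβ hβ1 hr k i (T i ω) fun k => R i k ω)
      have h2 := ((hRm i k).aestronglyMeasurable (μ := P)).memLp_truncation (A := (i : ℝ)) (p := 2)
      exact h2.integrable_sq
    rcases Nat.eq_zero_or_pos i with rfl | hi0
    · have h2 : ∫ ω, (truncation (R 0 k) ((0 : ℕ) : ℝ) ^ 2) ω ∂P = 0 := by simp
      rw [h2] at h1
      simpa using h1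
    · have hi0' : (0 : ℝ) < i := by exact_mod_cast hi0
      have h3 : (1 / ((i : ℝ) + 1)) ^ 2 ≤ ((i : ℝ) ^ 2)⁻¹ := by
        rw [one_div, inv_pow]
        gcongr
        exact le_add_of_nonneg_right zero_le_one
      exact mul_le_mul h3 h1 (integral_nonneg fun ω => sq_nonneg _) (by positivity)
  have htrunc : ∀ k, ∀ᵐ ω ∂P, ∀ᶠ n : ℕ in atTop, R n k ω ≤ n := by
    intro k
    have h1 := @tsum_prob_mem_Ioi_lt_top Ω (@MeasureSpace.mk Ω mΩ P) ‹_› (R 0 k) (hRint k)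
      (fun ω => hR0 0 k ω)
    have h2 : ∑' n : ℕ, P {ω | R n k ω ∈ Set.Ioi (n : ℝ)} ≠ ∞ := by
      refine ne_of_lt (lt_of_le_of_lt (le_of_eq ?_) h1)
      refine tsum_congr fun n => ?_
      exact (hident n k).measure_mem_eq measurableSet_Ioi
    filter_upwards [ae_eventually_notMem h2] with ω hω
    filter_upwards [hω] with n hn
    simpa using hn
  filter_upwards [ae_all_iff.2 hnoise, ae_all_iff.2 htrunc] with ω hω1 hω2
  have hx : Tendsto (fun n k => T n ω k / r k) atTop (𝓝 fun _ => κ) := by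
    refine tendsto_of_recursion hκpos hcpos
      (p := fun n k => A.meanService (T n ω) k / r k)
      (ξ := fun n k => (A.truncatedService k n (T n ω) (fun k => R n k ω) -
        ∫ v, A.truncatedService k n (T n ω) v ∂(P.map fun ω k => R n k ω)) / r k)
      (e := fun n k => (∫ v, A.truncatedService k n (T n ω) v ∂(P.map fun ω k => R n k ω) -
        A.meanService (T n ω) k) / r k) ?_ ?_ ?_ ?_ ?_
    · filter_upwards [eventually_all.2 hω2, eventually_ge_atTop n₀] with n hn hn0 k
      have h1 : A.truncatedService k n (T n ω) (fun k => R n k ω) =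
          A.transmitted (T n ω) (fun k => R n k ω) k := if_pos ⟨hR0 n k ω, hn k⟩
      have h2 : T (n + 1) ω k = (n : ℝ) / (n + 1) * T n ω k +
          1 / ((n : ℝ) + 1) * A.transmitted (T n ω) (fun k => R n k ω) k := by
        simp only [hT, Rule.throughput, if_neg (not_lt.2 hn0)]
      rw [h2, h1]
      ring
    · exact fun n k => div_nonneg (hT0 n ω k) (hr k).le
    · exact fun n => A.isProportionalService hK hβ hβ1 hν hi hmean hr (hT0 n ω)
    · intro k
      obtain ⟨s, hs⟩ := hω1 k
      refine ⟨s / r k, (hs.div_const (r k)).congr fun n => ?_⟩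
      rw [Finset.sum_div]
      exact Finset.sum_congr rfl fun i _ => by ring
    · intro k
      have h1 : Tendsto (fun n : ℕ => ∫ v, A.truncatedService k n (T n ω) v
          ∂(P.map fun ω k => R n k ω) - A.meanService (T n ω) k) atTop (𝓝 0) := by
        refine squeeze_zero_norm (fun n => ?_) (tendsto_integral_rate_tail hν hi hr k)
        rw [hmap n]
        exact A.abs_integral_truncatedService_sub_le hK hβ hβ1 hν hi hr k n (T n ω)
      simpa using h1.div_const (r k)
  refine tendsto_pi_nhds.2 fun k => ?_
  have h1 := (tendsto_pi_nhds.1 hx k).mul_const (r k)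
  refine h1.congr fun n => ?_
  rw [div_mul_cancel₀ _ (hr k).ne']

lemma ae_tendsto_throughput [IsProbabilityMeasure ν] [IsProbabilityMeasure P]
    (hK : 0 < K) (hβ : 0 < β) (hβ1 : β < 1)
    (hν : ∀ᵐ x ∂ν, 0 ≤ x) (hi : Integrable (fun x : ℝ => x) ν) (hmean : ∫ x, x ∂ν = 1)
    (hr : ∀ k, 0 < r k) (A : Rule β ν r) (hlaw : ∀ n k, HasLaw (R n k) (rateLaw ν r k) P)
    (hind : iIndepFun (fun p : ℕ × Fin K => R p.1 p.2) P) (n₀ : ℕ) {τ : Fin K → ℝ}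
    (hτ : ∀ k, 0 ≤ τ k) :
    ∀ᵐ ω ∂P, Tendsto (A.throughput (fun n k => R n k ω) n₀ τ) atTop
      (𝓝 fun k => symmetricValue K β ν / K * r k) := by
  -- The rates are replaced by versions that are measurable and nonnegative everywhere.
  set R' : ℕ → Fin K → Ω → ℝ := fun n k ω => max ((hlaw n k).aemeasurable.mk (R n k) ω) 0 with hR'
  have hae : ∀ n k, R n k =ᵐ[P] R' n k := by
    intro n k
    have hnn : ∀ᵐ x ∂(rateLaw ν r k), 0 ≤ x := by
      unfold rateLaw
      rw [ae_map_iff (by fun_prop) measurableSet_Ici]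
      filter_upwards [hν] with x hx
      exact mul_nonneg (hr k).le hx
    have h1 : ∀ᵐ ω ∂P, 0 ≤ R n k ω := by
      rw [← (hlaw n k).map_eq] at hnn
      exact ae_of_ae_map (hlaw n k).aemeasurable hnn
    filter_upwards [h1, (hlaw n k).aemeasurable.ae_eq_mk] with ω h2 h3
    simp only [hR', ← h3, max_eq_left h2]
  have h := ae_tendsto_throughput_of_measurable hK hβ hβ1 hν hi hmean hr A (R := R')
    (fun n k => (hlaw n k).aemeasurable.measurable_mk.max measurable_const)
    (fun n k ω => le_max_right _ _) (fun n k => (hlaw n k).congr (hae n k).symm)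
    (hind.congr fun p => hae p.1 p.2) n₀ hτ
  filter_upwards [h, ae_all_iff.2 fun n => ae_all_iff.2 fun k => hae n k] with ω h1 h2
  have : (fun n k => R n k ω) = fun n k => R' n k ω := by
    ext n k; exact h2 n k
  rw [this]
  exact h1

end AlmostSure

/-- The point with equal normalized throughputs is the limit point of the mean dynamics. -/
lemma Rule.isLimitPoint {K : ℕ} {β : ℝ} {ν : Measure ℝ} [IsProbabilityMeasure ν] {r : Fin K → ℝ}
    (hK : 0 < K) (hβ : 0 < β) (hβ1 : β < 1)
    (hν : ∀ᵐ x ∂ν, 0 ≤ x) (hi : Integrable (fun x : ℝ => x) ν) (hmean : ∫ x, x ∂ν = 1)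
    (hr : ∀ k, 0 < r k) (A : Rule β ν r) :
    IsLimitPoint A.drift fun k => symmetricValue K β ν / K * r k := by
  have hκpos : 0 < symmetricValue K β ν / K :=
    div_pos (symmetricValue_pos hβ hβ1 hν hi hmean hK) (by exact_mod_cast hK)
  have hh : ∀ T : Fin K → ℝ, (∀ k, 0 < T k) →
      IsProportionalService (symmetricValue K β ν / K) ((1 - β) * ∫ x in stopAtOnce β ν, x ∂ν)
        (fun k => T k / r k) (fun k => (A.drift T k + T k) / r k) := fun T hT => by
    simp only [A.drift_eq, sub_add_cancel]
    exact A.isProportionalService hK hβ hβ1 hν hi hmean hr fun k => (hT k).le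
  exact ⟨fun k => mul_pos hκpos (hr k), zero_mem_regularize hκpos hr hh,
    fun φ hφ => tendsto_of_isSolution hκpos hr hh hφ⟩

end

end JPSPF

theorem theorem2 {K : ℕ} (hK : 0 < K) (β : ℝ) (hβ0 : 0 < β) (hβ1 : β < 1)
    (ν : Measure ℝ) [IsProbabilityMeasure ν] (hν_nonneg : ∀ᵐ x ∂ν, 0 ≤ x)
    (hν_int : Integrable (fun x : ℝ => x) ν) (hν_mean : ∫ x, x ∂ν = 1)
    (r : Fin K → ℝ) (hr : ∀ k, 0 < r k) :
    ∃ (Tstar : Fin K → ℝ) (κ : ℝ),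
      (∀ A : JPSPF.Rule β ν r,
        JPSPF.IsLimitPoint A.drift Tstar ∧
        ∀ {Ω : Type*} [MeasurableSpace Ω] (P : Measure Ω) [IsProbabilityMeasure P]
          (R : ℕ → Fin K → Ω → ℝ),
          (∀ n k, HasLaw (R n k) (JPSPF.rateLaw ν r k) P) →
          iIndepFun (fun p : ℕ × Fin K => R p.1 p.2) P →
          ∀ (n₀ : ℕ) (τ : Fin K → ℝ), (∀ k, 0 ≤ τ k) →
            ∀ᵐ ω ∂P, Tendsto (A.throughput (fun n k => R n k ω) n₀ τ) atTop (𝓝 Tstar)) ∧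
      ∀ k, Tstar k / r k = κ := by
  refine ⟨fun k => JPSPF.symmetricValue K β ν / K * r k, JPSPF.symmetricValue K β ν / K,
    fun A => ⟨A.isLimitPoint hK hβ0 hβ1 hν_nonneg hν_int hν_mean hr, ?_⟩,
    fun k => mul_div_cancel_right₀ _ (hr k).ne'⟩
  intro Ω _ P _ R hlaw hind n₀ τ hτ
  exact JPSPF.ae_tendsto_throughput hK hβ0 hβ1 hν_nonneg hν_int hν_mean hr A hlaw hind n₀ hτ
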